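/- Let $p>1$ be an odd integer, let $k\ge n+1$ be an integer, let $\phi_0\in C_0^\infty(\mathbb R^n)$ be real-valued, and let $\delta>0$. Let $V$ be the unique smooth periodic function on $\mathbb R$ with $V''+V^p=0$, $V(0)=1$, $V'(0)=0$, and let $$\phi^{(0)}(t,x)=\phi_0(x)\,V\bigl(t\,\phi_0(x)^{(p-1)/2}\bigr),$$ which is the unique solution of $\partial_{tt}u+u^p=0$, $u(0,x)=\phi_0(x)$, $\partial_tu(0,x)=0$. Then there exist constants $C,c>0$, depending only on $n$, $p$, $k$, $\delta$ and $\phi_0$, such that for every $0<\nu\le c$, with $T=c\,|\log\nu|^{c}$, there exists a real-valued solution $\phi\in C([0,T];H^{k+1}(\mathbb R^n))$, with $\phi_t\in C([0,T];H^{k}(\mathbb R^n))$ and $\phi_{tt}\in C([0,T];H^{k-1}(\mathbb R^n))$, of $$\partial_{tt}\phi-\nu^2\Delta\phi+\nu\sqrt{-\Delta}\,\partial_t\phi+\phi^p=0,\qquad \phi(0,x)=\phi_0(x),\quad \partial_t\phi(0,x)=0,$$ such that $$\|\phi(t)-\phi^{(0)}(t)\|_{H^k(\mathbb R^n)}+\|\phi_t(t)-\phi^{(0)}_t(t)\|_{H^k(\mathbb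 R^n)}\le C\,\nu^{1-\delta}\qquad\text{for all }0\le t\le c\,|\log\nu|^{c}.$$ Here $\sqrt{-\Delta}$ is the Fourier multiplier with symbol $|\xi|$. -/

import Mathlib

open MeasureTheory Filter Topology Set FourierTransform
open scoped ENNReal ContDiff SchwartzMap Laplacian

noncomputable section

/-- A real-valued square integrable function on `ℝⁿ`, as an element of the complex space `L²`. -/
def toL2 {n : ℕ} (f : EuclideanSpace ℝ (Fin n) → ℝ)
    (hf : MemLp f 2 (volume : Measure (EuclideanSpace ℝ (Fin n)))) :
    Lp ℂ 2 (volume : Measure (EuclideanSpace ℝ (Fin n))) :=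
  (hf.ofReal (K := ℂ)).toLp

open Classical in
/-- The norm of the inhomogeneous Sobolev space `H^s(ℝⁿ)`, `s ≥ 0`, with value `∞` for a function
that is not in `H^s`. Mathlib's `𝓕` has the kernel `exp (-2πi x·ξ)`, so that the classical frequency
is `2πξ`; the value is `((2π)⁻ⁿ ∫ (1 + |η|²)^s |f̂(η)|² dη)^(1/2)` with the classical transform
`f̂(η) = ∫ exp (-i x·η) f(x) dx`. -/
def sobolevENorm {n : ℕ} (s : ℝ) (f : EuclideanSpace ℝ (Fin n) → ℝ) : ℝ≥0∞ :=
  if hf : MemLp f 2 (volume : Measure (EuclideanSpace ℝ (Fin n))) then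
    eLpNorm (fun ξ : EuclideanSpace ℝ (Fin n) =>
      (((1 + (2 * Real.pi * ‖ξ‖) ^ 2) ^ (s / 2) : ℝ) : ℂ) *
        (𝓕 (toL2 f hf) : Lp ℂ 2 (volume : Measure (EuclideanSpace ℝ (Fin n)))) ξ) 2 volume
  else ⊤

/-- `g = Δ f` in the sense of distributions, for `f` and `g` in `L²(ℝⁿ)`. -/
def IsLaplacian {n : ℕ} (f g : EuclideanSpace ℝ (Fin n) → ℝ) : Prop :=
  ∃ (hf : MemLp f 2 (volume : Measure (EuclideanSpace ℝ (Fin n))))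
    (hg : MemLp g 2 (volume : Measure (EuclideanSpace ℝ (Fin n)))),
    Δ ((toL2 f hf : Lp ℂ 2 (volume : Measure (EuclideanSpace ℝ (Fin n)))) :
        𝓢'(EuclideanSpace ℝ (Fin n), ℂ)) =
      ((toL2 g hg : Lp ℂ 2 (volume : Measure (EuclideanSpace ℝ (Fin n)))) :
        𝓢'(EuclideanSpace ℝ (Fin n), ℂ))

/-- `g = √(-Δ) f`, for `f` and `g` in `L²(ℝⁿ)`: the Fourier multiplier with symbol the length of
the classical frequency, which is `2π‖ξ‖` for Mathlib's `𝓕`. -/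
def IsSqrtNegLaplacian {n : ℕ} (f g : EuclideanSpace ℝ (Fin n) → ℝ) : Prop :=
  ∃ (hf : MemLp f 2 (volume : Measure (EuclideanSpace ℝ (Fin n))))
    (hg : MemLp g 2 (volume : Measure (EuclideanSpace ℝ (Fin n)))),
    ∀ᵐ ξ : EuclideanSpace ℝ (Fin n),
      (𝓕 (toL2 g hg) : Lp ℂ 2 (volume : Measure (EuclideanSpace ℝ (Fin n)))) ξ =
        ((2 * Real.pi * ‖ξ‖ : ℝ) : ℂ) *
          (𝓕 (toL2 f hf) : Lp ℂ 2 (volume : Measure (EuclideanSpace ℝ (Fin n)))) ξ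

/-- `u ∈ C(I; H^s)`. -/
def ContinuousInSobolev {n : ℕ} (s : ℝ) (I : Set ℝ) (u : ℝ → EuclideanSpace ℝ (Fin n) → ℝ) :
    Prop :=
  ∀ t ∈ I, sobolevENorm s (u t) < ⊤ ∧
    Tendsto (fun τ => sobolevENorm s (fun x => u τ x - u t x)) (𝓝[I] t) (𝓝 0)

/-- At every time `t ∈ I` the curve `u` has the derivative `v t`, as a limit of difference quotients
in the norm of `H^s`. -/
def HasSobolevTimeDeriv {n : ℕ} (s : ℝ) (I : Set ℝ) (u v : ℝ → EuclideanSpace ℝ (Fin n) → ℝ) :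
    Prop :=
  ∀ t ∈ I, Tendsto (fun τ => sobolevENorm s (fun x => (u τ x - u t x) / (τ - t) - v t x))
    (𝓝[I \ {t}] t) (𝓝 0)

/-- `u`, with time derivative `v = u_t`, solves
`u_tt - ν² Δu + ν √(-Δ) u_t + u^p = 0`, `u(0) = φ₀`, `u_t(0) = 0` for times in `[0, T]`, where
`u ∈ C([0,T]; H^(k+1))` and `u_t ∈ C([0,T]; H^k)`; the second time derivative exists in `H^(k-1)`,
to which the other terms of the equation belong. -/
structure IsViscoDispersiveSolution {n : ℕ} (p k : ℕ) (ν T : ℝ)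
    (φ₀ : EuclideanSpace ℝ (Fin n) → ℝ) (u v : ℝ → EuclideanSpace ℝ (Fin n) → ℝ) : Prop where
  continuous : ContinuousInSobolev ((k : ℝ) + 1) (Icc 0 T) u
  continuous_deriv : ContinuousInSobolev (k : ℝ) (Icc 0 T) v
  hasDeriv : HasSobolevTimeDeriv (k : ℝ) (Icc 0 T) u v
  equation : ∃ w : ℝ → EuclideanSpace ℝ (Fin n) → ℝ,
    ContinuousInSobolev ((k : ℝ) - 1) (Icc 0 T) w ∧
    HasSobolevTimeDeriv ((k : ℝ) - 1) (Icc 0 T) v w ∧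
    ∀ t ∈ Icc 0 T, ∃ L D : EuclideanSpace ℝ (Fin n) → ℝ,
      IsLaplacian (u t) L ∧ IsSqrtNegLaplacian (v t) D ∧
      ∀ᵐ x : EuclideanSpace ℝ (Fin n),
        w t x - ν ^ 2 * L x + ν * D x + u t x ^ p = 0
  initial : ∀ x, u 0 x = φ₀ x
  initial_deriv : ∀ x, v 0 x = 0

/-- `V` is a smooth periodic solution of `V'' + V^p = 0`, `V(0) = 1`, `V'(0) = 0`. -/
structure IsLimitProfile (p : ℕ) (V : ℝ → ℝ) : Prop where
  smooth : ContDiff ℝ ∞ V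
  periodic : ∃ P > 0, Function.Periodic V P
  equation : ∀ t, deriv (deriv V) t + V t ^ p = 0
  initial : V 0 = 1
  initial_deriv : deriv V 0 = 0

/-- `ψ` solves `ψ_tt + ψ^p = 0`, `ψ(0) = φ₀`, `ψ_t(0) = 0`, an ordinary differential equation in
time at each point of space. -/
structure IsLimitSolution {n : ℕ} (p : ℕ) (φ₀ : EuclideanSpace ℝ (Fin n) → ℝ)
    (ψ : ℝ → EuclideanSpace ℝ (Fin n) → ℝ) : Prop where
  contDiff : ∀ x, ContDiff ℝ 2 (fun t => ψ t x)
  equation : ∀ t x, deriv (deriv (fun τ => ψ τ x)) t + ψ t x ^ p = 0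
  initial : ∀ x, ψ 0 x = φ₀ x
  initial_deriv : ∀ x, deriv (fun τ => ψ τ x) 0 = 0

/-- The function `φ₀(x) V(t φ₀(x)^((p-1)/2))`; the exponent is an integer for odd `p`. -/
def limitSolution {n : ℕ} (p : ℕ) (V : ℝ → ℝ) (φ₀ : EuclideanSpace ℝ (Fin n) → ℝ) :
    ℝ → EuclideanSpace ℝ (Fin n) → ℝ :=
  fun t x => φ₀ x * V (t * φ₀ x ^ ((p - 1) / 2))

end

/-! On the Fourier side the equation is one damped oscillator `y'' + a y' + a² y = -f` per
frequency, with `a = 2πν‖ξ‖`, coupled through the convolution power `f` that represents `φ ^ p`. The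
characteristic roots are `a (-1 ± i√3) / 2`, so the velocity kernel `oscVel (a t)` is bounded for `t
≥ 0` uniformly in `a`, and it differs from its value at `a = 0`, the kernel of the limit equation,
by `O(a t)`. Replacing one by the other thus costs a factor `ν` and one derivative, which the smooth
limit solution can afford (`norm_velOf_zero_sub_le`).

Everything is measured in the norms `sup (1 + ‖ξ‖) ^ N |F ξ|`. For `N > n` they form an algebra
under convolution (`norm_fconv_le`), and for larger `N` they control Sobolev norms
(`sobolevENorm_phys_le`), so no energy estimate is needed. The unknown is the difference `D` of the
two velocities; the position is recovered by integration in time. With an additional weight `exp (l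
t)`, each time integration gains `1 / l`, and `D` is the fixed point of a contraction on a ball of
radius `O(ν)` times a power of `1 + T` (`LimitSymbol.exists_fixedPoint`).

The profile `V` is periodic, hence has bounded derivatives of every order. Each space derivative of
`φ₀ V(t φ₀^m)` costs at most a factor of order `1 + t`, so all constants, `l` included, are
polynomial in `T`, and the error is at most `ν exp (K (1 + T) ^ j)`. For `T = c |log ν| ^ c` with
`c` small, the exponent is below `δ |log ν|` (`exists_logarithmic_time_scale`), which leaves `ν ^ (1
- δ)`.

The profile itself comes from conservation of energy: the orbit stays in a compact set, hence exists
globally, and its reflection symmetries make it periodic. -/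

/-! ### The limit profile -/

/-- The vector field on phase space of the equation `x'' + x ^ p = 0`. -/
def powerField (p : ℕ) (z : ℝ × ℝ) : ℝ × ℝ := (z.2, -z.1 ^ p)

lemma powerField_lipschitzOnWith (p : ℕ) (R : NNReal) :
    LipschitzOnWith (1 + p * R ^ (p - 1)) (powerField p) (Metric.closedBall 0 R) := by
  refine LipschitzOnWith.of_dist_le_mul fun z hz w hw => ?_
  rw [mem_closedBall_zero_iff] at hz hw
  have hz1 : |z.1| ≤ R := (norm_fst_le z).trans hz
  have hw1 : |w.1| ≤ R := (norm_fst_le w).trans hw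
  have h1 : |z.1 - w.1| ≤ dist z w := by
    rw [← Real.dist_eq]; exact le_max_left _ _
  have h2 : |z.2 - w.2| ≤ dist z w := by
    rw [← Real.dist_eq]; exact le_max_right _ _
  have h3 : |z.1 ^ p - w.1 ^ p| ≤ |z.1 - w.1| * p * max |z.1| |w.1| ^ (p - 1) :=
    abs_pow_sub_pow_le _ _ _
  have h4 : max |z.1| |w.1| ^ (p - 1) ≤ (R : ℝ) ^ (p - 1) :=
    pow_le_pow_left₀ (le_max_of_le_left (abs_nonneg _)) (max_le hz1 hw1) _
  have h5 : |z.1 - w.1| * p * max |z.1| |w.1| ^ (p - 1) ≤ dist z w * p * (R : ℝ) ^ (p - 1) := by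
    gcongr
  have h6 : 0 ≤ dist z w * p * (R : ℝ) ^ (p - 1) := by positivity
  have e : ((1 + p * R ^ (p - 1) : NNReal) : ℝ) * dist z w
      = dist z w + dist z w * p * (R : ℝ) ^ (p - 1) := by push_cast; ring
  rw [e]
  refine max_le ?_ ?_
  · simp only [powerField]; rw [Real.dist_eq]; linarith
  · simp only [powerField]; rw [dist_neg_neg, Real.dist_eq]
    linarith [dist_nonneg (x := z) (y := w)]

/-- The field is only locally Lipschitz, but on a compact time interval both solutions stay in a
common ball, where the uniqueness theorem applies. -/
lemma power_ode_unique (p : ℕ) {f f' g g' : ℝ → ℝ}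
    (hf : ∀ t, HasDerivAt f (f' t) t) (hf' : ∀ t, HasDerivAt f' (-f t ^ p) t)
    (hg : ∀ t, HasDerivAt g (g' t) t) (hg' : ∀ t, HasDerivAt g' (-g t ^ p) t)
    (h0 : f 0 = g 0) (h1 : f' 0 = g' 0) : f = g := by
  have hcf : Continuous fun t => (f t, f' t) :=
    (continuous_iff_continuousAt.2 fun t => (hf t).continuousAt).prodMk
      (continuous_iff_continuousAt.2 fun t => (hf' t).continuousAt)
  have hcg : Continuous fun t => (g t, g' t) :=
    (continuous_iff_continuousAt.2 fun t => (hg t).continuousAt).prodMk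
      (continuous_iff_continuousAt.2 fun t => (hg' t).continuousAt)
  ext t
  set b : ℝ := |t| + 1
  obtain ⟨R₁, hR₁⟩ := (isCompact_Icc (a := -b) (b := b)).exists_bound_of_continuousOn
    hcf.continuousOn
  obtain ⟨R₂, hR₂⟩ := (isCompact_Icc (a := -b) (b := b)).exists_bound_of_continuousOn
    hcg.continuousOn
  set R : NNReal := (max R₁ R₂).toNNReal
  have hb : 0 < b := by positivity
  have hR (s : ℝ) (hs : s ∈ Ioo (-b) b) : (f s, f' s) ∈ Metric.closedBall (0 : ℝ × ℝ) R ∧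
      (g s, g' s) ∈ Metric.closedBall (0 : ℝ × ℝ) R := by
    have hs' := Ioo_subset_Icc_self hs
    simp only [mem_closedBall_zero_iff, R, Real.coe_toNNReal']
    exact ⟨(hR₁ s hs').trans (le_max_of_le_left (le_max_left _ _)),
      (hR₂ s hs').trans (le_max_of_le_left (le_max_right _ _))⟩
  have := ODE_solution_unique_of_mem_Ioo (v := fun _ => powerField p)
    (s := fun _ => Metric.closedBall (0 : ℝ × ℝ) R) (t₀ := 0) (a := -b) (b := b)
    (f := fun t => (f t, f' t)) (g := fun t => (g t, g' t))
    (fun _ _ => powerField_lipschitzOnWith p R) ⟨by linarith, hb⟩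
    (fun s hs => ⟨(hf s).prodMk (hf' s), (hR s hs).1⟩)
    (fun s hs => ⟨(hg s).prodMk (hg' s), (hR s hs).2⟩)
    (by simp [h0, h1])
  have ht : t ∈ Ioo (-b) b := by
    constructor
    · linarith [neg_abs_le t]
    · linarith [le_abs_self t]
  exact (Prod.ext_iff.1 (this ht)).1

/-- The projection of the real line to `[-1, 1]`. -/
def unitClamp (x : ℝ) : ℝ := max (-1) (min 1 x)

lemma unitClamp_lipschitz : LipschitzWith 1 unitClamp :=
  (LipschitzWith.id.const_min 1).const_max (-1)

lemma unitClamp_continuous : Continuous unitClamp := unitClamp_lipschitz.continuous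

lemma abs_unitClamp_le (x : ℝ) : |unitClamp x| ≤ 1 := by
  unfold unitClamp; rw [abs_le]; constructor
  · exact le_max_left _ _
  · exact max_le (by norm_num) (min_le_left _ _)

lemma unitClamp_of_abs_le {x : ℝ} (h : |x| ≤ 1) : unitClamp x = x := by
  rw [abs_le] at h; unfold unitClamp; rw [min_eq_right h.2, max_eq_right h.1]

lemma unitClamp_neg (x : ℝ) : unitClamp (-x) = -unitClamp x := by
  unfold unitClamp
  rcases le_total x (-1) with h | h <;> rcases le_total x 1 with h' | h' <;> grind

lemma unitClamp_of_one_le {x : ℝ} (h : 1 ≤ x) : unitClamp x = 1 := by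
  unfold unitClamp; rw [min_eq_left h]; norm_num

lemma unitClamp_nonneg {x : ℝ} (h : 0 ≤ x) : 0 ≤ unitClamp x :=
  le_max_of_le_right (le_min zero_le_one h)

/-- The primitive of a power of `unitClamp`. -/
noncomputable def clampPrimitive (j : ℕ) (x : ℝ) : ℝ := ∫ s in (0 : ℝ)..x, unitClamp s ^ j

lemma clampPrimitive_hasDerivAt (j : ℕ) (x : ℝ) :
    HasDerivAt (clampPrimitive j) (unitClamp x ^ j) x :=
  (unitClamp_continuous.pow j).integral_hasStrictDerivAt 0 x |>.hasDerivAt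

lemma clampPrimitive_neg {j : ℕ} (hj : Odd j) (x : ℝ) :
    clampPrimitive j (-x) = clampPrimitive j x := by
  unfold clampPrimitive
  have h := intervalIntegral.integral_comp_neg (fun s => unitClamp s ^ j) (a := 0) (b := -x)
  simp only [unitClamp_neg, hj.neg_pow, neg_neg, neg_zero, intervalIntegral.integral_neg] at h
  rw [intervalIntegral.integral_symm 0 x] at h
  linarith

lemma clampPrimitive_abs {j : ℕ} (hj : Odd j) (x : ℝ) :
    clampPrimitive j |x| = clampPrimitive j x := by
  rcases abs_choice x with h | h <;> rw [h]
  exact clampPrimitive_neg hj x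

lemma clampPrimitive_nonneg {j : ℕ} (hj : Odd j) (x : ℝ) : 0 ≤ clampPrimitive j x := by
  rw [← clampPrimitive_abs hj]
  exact intervalIntegral.integral_nonneg (abs_nonneg x)
    fun s hs => pow_nonneg (unitClamp_nonneg hs.1) j

lemma clampPrimitive_one (j : ℕ) : clampPrimitive j 1 = 1 / (j + 1) := by
  unfold clampPrimitive
  rw [intervalIntegral.integral_congr (g := fun s => s ^ j)]
  · simp [integral_pow]
  · intro s hs
    rw [uIcc_of_le zero_le_one] at hs
    simp only
    rw [unitClamp_of_abs_le (abs_le.2 ⟨by linarith [hs.1], hs.2⟩)]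

/-- The integrand is `1` beyond `1`, so the even function `clampPrimitive j` grows there with slope
one: a bound on the truncated energy is a bound on the point. -/
lemma abs_le_one_of_clampPrimitive_le {j : ℕ} (hj : Odd j) {x : ℝ}
    (h : clampPrimitive j x ≤ clampPrimitive j 1) : |x| ≤ 1 := by
  by_contra! hx
  rw [← clampPrimitive_abs hj] at h
  have hi (a b : ℝ) : IntervalIntegrable (fun s => unitClamp s ^ j) volume a b :=
    (unitClamp_continuous.pow j).intervalIntegrable a b
  have e : clampPrimitive j |x| = clampPrimitive j 1 + (|x| - 1) := by
    unfold clampPrimitive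
    rw [← intervalIntegral.integral_add_adjacent_intervals (hi 0 1) (hi 1 |x|)]
    congr 1
    rw [intervalIntegral.integral_congr (g := fun _ => (1 : ℝ))]
    · simp
    · intro s hs
      rw [uIcc_of_le hx.le] at hs
      simp [unitClamp_of_one_le hs.1]
  linarith

/-- The field truncated to the unit square is bounded and globally Lipschitz, so its solutions exist
on any interval. The truncated system conserves its own energy, which keeps the orbit of `(1, 0)` in
the square, where the truncation has no effect. -/
lemma exists_power_ode_Ioo {p : ℕ} (hp : Odd p) (T : ℝ) (hT : 0 < T) :
    ∃ α : ℝ → ℝ × ℝ, α 0 = (1, 0) ∧ ∀ t ∈ Ioo (-T) T,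
      HasDerivAt α (powerField p (α t)) t ∧ α t ∈ Metric.closedBall (0 : ℝ × ℝ) 1 := by
  set F : ℝ × ℝ → ℝ × ℝ := fun z => powerField p (unitClamp z.1, unitClamp z.2) with hF
  have hmem (z : ℝ × ℝ) :
      (unitClamp z.1, unitClamp z.2) ∈ Metric.closedBall (0 : ℝ × ℝ) (1 : NNReal) := by
    rw [mem_closedBall_zero_iff]
    exact max_le (abs_unitClamp_le _) (abs_unitClamp_le _)
  have hc : LipschitzWith 1 (fun z : ℝ × ℝ => (unitClamp z.1, unitClamp z.2)) := by
    simpa using (unitClamp_lipschitz.comp LipschitzWith.prod_fst).prodMk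
      (unitClamp_lipschitz.comp LipschitzWith.prod_snd)
  have hlip : LipschitzOnWith ((1 + p * 1 ^ (p - 1)) * 1) F univ :=
    (powerField_lipschitzOnWith p 1).comp hc.lipschitzOnWith fun z _ => hmem z
  have hnorm (z : ℝ × ℝ) : ‖F z‖ ≤ 1 := by
    refine max_le (abs_unitClamp_le _) ?_
    simp only [hF, powerField, norm_neg, norm_pow, Real.norm_eq_abs]
    exact pow_le_one₀ (abs_nonneg _) (abs_unitClamp_le _)
  have hT0 : (0 : ℝ) ∈ Icc (-T) T := ⟨by linarith, hT.le⟩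
  -- The speed is at most `1`, so a ball of radius `T` around the initial point is never left; the
  -- Lipschitz constant puts no limit on the length of the interval.
  have hPL : IsPicardLindelof (fun _ => F) (⟨0, hT0⟩ : Icc (-T) T) ((1, 0) : ℝ × ℝ)
      T.toNNReal 0 1 ((1 + p * 1 ^ (p - 1)) * 1) :=
    { lipschitzOnWith := fun _ _ => hlip.mono (subset_univ _)
      continuousOn := fun _ _ => continuousOn_const
      norm_le := fun _ _ z _ => by simpa using hnorm z
      mul_max_le := by simp [hT.le] }
  obtain ⟨α, h0, hα⟩ := hPL.exists_eq_forall_mem_Icc_hasDerivWithinAt₀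
  have hd (t : ℝ) (ht : t ∈ Ioo (-T) T) : HasDerivAt α (F (α t)) t :=
    (hα t (Ioo_subset_Icc_self ht)).hasDerivAt (Icc_mem_nhds ht.1 ht.2)
  set H : ℝ → ℝ := fun t => clampPrimitive p (α t).1 + clampPrimitive 1 (α t).2 with hH
  have hHd (t : ℝ) (ht : t ∈ Ioo (-T) T) : HasDerivAt H 0 t := by
    have h1 := (clampPrimitive_hasDerivAt p (α t).1).comp t (hd t ht).fst
    have h2 := (clampPrimitive_hasDerivAt 1 (α t).2).comp t (hd t ht).snd
    convert! h1.add h2 using 1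
    simp only [hF, powerField]; ring
  have hconst (t : ℝ) (ht : t ∈ Ioo (-T) T) : H t = clampPrimitive p 1 := by
    have := (isOpen_Ioo (a := -T) (b := T)).is_const_of_deriv_eq_zero isPreconnected_Ioo
      (fun s hs => (hHd s hs).differentiableAt.differentiableWithinAt)
      (fun s hs => (hHd s hs).deriv) ht (⟨by linarith, hT⟩ : (0 : ℝ) ∈ Ioo (-T) T)
    rw [this]
    simp only [hH, h0]
    simp [clampPrimitive]
  refine ⟨α, h0, fun t ht => ?_⟩
  have h1 : |(α t).1| ≤ 1 := abs_le_one_of_clampPrimitive_le hp <| by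
    have := clampPrimitive_nonneg odd_one (α t).2
    linarith [hconst t ht]
  have h2 : |(α t).2| ≤ 1 := abs_le_one_of_clampPrimitive_le odd_one <| by
    have h3 := clampPrimitive_nonneg hp (α t).1
    -- The total energy `1 / (p + 1)` is at most `1 / 2`, the value at which the velocity would
    -- reach `1`.
    have h4 : clampPrimitive p 1 ≤ clampPrimitive 1 1 := by
      rw [clampPrimitive_one, clampPrimitive_one]
      have : (1 : ℝ) ≤ p := by exact_mod_cast hp.pos
      push_cast
      gcongr
    linarith [hconst t ht]
  refine ⟨?_, ?_⟩
  · have := hd t ht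
    simpa only [hF, unitClamp_of_abs_le h1, unitClamp_of_abs_le h2] using this
  · rw [mem_closedBall_zero_iff]
    exact max_le h1 h2

lemma exists_power_ode {p : ℕ} (hp : Odd p) :
    ∃ f f' : ℝ → ℝ, (∀ t, HasDerivAt f (f' t) t) ∧ (∀ t, HasDerivAt f' (-f t ^ p) t) ∧
      f 0 = 1 ∧ f' 0 = 0 ∧ ∀ t, |f t| ≤ 1 := by
  choose α h0 hα using fun N : ℕ => exists_power_ode_Ioo hp (N + 1 : ℝ) (by positivity)
  have hagree (N M : ℕ) (hNM : N ≤ M) (t : ℝ) (ht : |t| < N + 1) : α N t = α M t := by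
    have hsub : Ioo (-(N + 1 : ℝ)) (N + 1) ⊆ Ioo (-(M + 1 : ℝ)) (M + 1) := by
      have : (N : ℝ) ≤ M := by exact_mod_cast hNM
      exact Ioo_subset_Ioo (by linarith) (by linarith)
    have hpos : (0 : ℝ) < N + 1 := by positivity
    refine ODE_solution_unique_of_mem_Ioo (v := fun _ => powerField p)
      (s := fun _ => Metric.closedBall (0 : ℝ × ℝ) 1) (t₀ := 0)
      (fun _ _ => by simpa using powerField_lipschitzOnWith p 1) ⟨by linarith, hpos⟩
      (hα N) (fun s hs => hα M s (hsub hs)) (by rw [h0, h0]) (abs_lt.1 ht)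
  -- The solutions on growing intervals agree by uniqueness; the index `⌈|t|⌉₊` selects one whose
  -- interval contains `t`.
  set β : ℝ → ℝ × ℝ := fun t => α ⌈|t|⌉₊ t with hβ
  have hceil (t : ℝ) : |t| < (⌈|t|⌉₊ : ℝ) + 1 := (Nat.le_ceil _).trans_lt (lt_add_one _)
  have hβd (t : ℝ) : HasDerivAt β (powerField p (β t)) t := by
    have hev : β =ᶠ[𝓝 t] α (⌈|t|⌉₊ + 1) := by
      have : ∀ᶠ s in 𝓝 t, |s| < (⌈|t|⌉₊ : ℝ) + 1 :=
        continuous_abs.continuousAt.eventually_lt continuousAt_const (hceil t)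
      filter_upwards [this] with s hs
      refine hagree _ _ (Nat.ceil_le.2 ?_) s (hceil s)
      push_cast; exact hs.le
    rw [hev.eq_of_nhds]
    refine HasDerivAt.congr_of_eventuallyEq (hα _ t (abs_lt.1 ?_)).1 hev
    push_cast; linarith [hceil t]
  refine ⟨fun t => (β t).1, fun t => (β t).2, fun t => (hβd t).fst, fun t => (hβd t).snd, ?_, ?_,
    fun t => ?_⟩
  · simp [hβ, h0]
  · simp [hβ, h0]
  · exact (norm_fst_le _).trans (mem_closedBall_zero_iff.1 (hα _ t (abs_lt.1 (hceil t))).2)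

/-- A solution without zero would stay positive, hence be concave on the half line with negative
slope from time `1` on, and so be unbounded below. -/
lemma power_ode_exists_zero {p : ℕ} {f f' : ℝ → ℝ}
    (hf : ∀ t, HasDerivAt f (f' t) t) (hf' : ∀ t, HasDerivAt f' (-f t ^ p) t)
    (h0 : f 0 = 1) (h1 : f' 0 = 0) (hb : ∀ t, |f t| ≤ 1) : ∃ t₀ > 0, f t₀ = 0 := by
  have hcf : Continuous f := continuous_iff_continuousAt.2 fun t => (hf t).continuousAt
  have hcf' : Continuous f' := continuous_iff_continuousAt.2 fun t => (hf' t).continuousAt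
  by_contra! hne
  have hpos (t : ℝ) (ht : 0 ≤ t) : 0 < f t := by
    by_contra! hneg
    obtain ⟨s, hs, hs0⟩ := intermediate_value_Icc' ht hcf.continuousOn
      (show (0 : ℝ) ∈ Icc (f t) (f 0) from ⟨hneg, by rw [h0]; exact zero_le_one⟩)
    rcases hs.1.eq_or_lt with h | h
    · rw [← h, h0] at hs0; exact one_ne_zero hs0
    · exact hne s h hs0
  have hanti : StrictAntiOn f' (Ici 0) := by
    refine strictAntiOn_of_deriv_neg (convex_Ici 0) hcf'.continuousOn fun t ht => ?_
    rw [interior_Ici] at ht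
    rw [(hf' t).deriv, neg_lt_zero]
    exact pow_pos (hpos t (le_of_lt ht)) p
  have hneg : f' 1 < 0 := by
    have := hanti (mem_Ici.2 le_rfl) (mem_Ici.2 zero_le_one) one_pos
    rwa [h1] at this
  -- Up to this time the solution would drop by at least `3`, while two values in `[-1, 1]` differ
  -- by at most `2`.
  set T : ℝ := 1 + 3 / (-f' 1) with hT
  have hpos3 : 0 < 3 / (-f' 1) := div_pos (by norm_num) (by linarith)
  obtain ⟨c, hc, hc'⟩ := exists_hasDerivAt_eq_slope f f' (show (1 : ℝ) < T by linarith)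
    hcf.continuousOn fun t _ => hf t
  have h2 : f' c ≤ f' 1 :=
    hanti.antitoneOn (mem_Ici.2 zero_le_one) (mem_Ici.2 (by linarith [hc.1])) hc.1.le
  have h3 : f T - f 1 = f' c * (T - 1) := by
    rw [hc']; field_simp [show T - 1 ≠ 0 by linarith]
  have h4 : f' c * (T - 1) ≤ -3 := by
    have : f' c * (T - 1) ≤ f' 1 * (T - 1) := by
      apply mul_le_mul_of_nonneg_right h2; linarith
    have e : f' 1 * (T - 1) = -3 := by
      rw [hT]; field_simp [hneg.ne]; ring
    linarith
  have h5 := abs_le.1 (hb T)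
  have h6 := abs_le.1 (hb 1)
  linarith

/-- By uniqueness the solution is even about `0` and odd about its zero `t₀` (here the nonlinearity
has to be odd). The composition of the two reflections is the shift by `2 t₀` with a change of sign,
so `4 t₀` is a period. -/
lemma power_ode_periodic {p : ℕ} (hp : Odd p) {f f' : ℝ → ℝ}
    (hf : ∀ t, HasDerivAt f (f' t) t) (hf' : ∀ t, HasDerivAt f' (-f t ^ p) t)
    (h0 : f 0 = 1) (h1 : f' 0 = 0) (hb : ∀ t, |f t| ≤ 1) :
    ∃ P > 0, Function.Periodic f P := by
  obtain ⟨t₀, ht₀, hz⟩ := power_ode_exists_zero hf hf' h0 h1 hb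
  have heven : (fun t => f (-t)) = f := by
    refine power_ode_unique p (f' := fun t => -f' (-t)) (fun t => ?_) (fun t => ?_) hf hf'
      (by simp) (by simp [h1])
    · convert! (hf (-t)).scomp t (hasDerivAt_neg t) using 1; simp
    · convert! ((hf' (-t)).scomp t (hasDerivAt_neg t)).neg using 1; simp
  have hrefl : (fun t => f (t₀ + t)) = fun t => -f (t₀ - t) := by
    refine power_ode_unique p (f' := fun t => f' (t₀ + t)) (g' := fun t => f' (t₀ - t))
      (fun t => ?_) (fun t => ?_) (fun t => ?_) (fun t => ?_) (by simp [hz]) (by simp)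
    · exact (hf (t₀ + t)).comp_const_add t₀ t
    · exact (hf' (t₀ + t)).comp_const_add t₀ t
    · convert! ((hf (t₀ - t)).comp_const_sub t₀ t).neg using 1; simp
    · convert! (hf' (t₀ - t)).comp_const_sub t₀ t using 1; simp [hp.neg_pow]
  have hanti (t : ℝ) : f (t + 2 * t₀) = -f t := by
    have h2 := congrFun hrefl (t + t₀)
    have h3 := congrFun heven t
    rw [show t + 2 * t₀ = t₀ + (t + t₀) by ring, h2, show t₀ - (t + t₀) = -t by ring, h3]
  refine ⟨4 * t₀, by linarith, fun t => ?_⟩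
  rw [show t + 4 * t₀ = (t + 2 * t₀) + 2 * t₀ by ring, hanti, hanti, neg_neg]

lemma power_ode_contDiff {p : ℕ} {f f' : ℝ → ℝ}
    (hf : ∀ t, HasDerivAt f (f' t) t) (hf' : ∀ t, HasDerivAt f' (-f t ^ p) t) :
    ContDiff ℝ ∞ f := by
  have key (j : ℕ) : ContDiff ℝ j f ∧ ContDiff ℝ j f' := by
    induction j with
    | zero =>
      exact ⟨contDiff_zero.2 (continuous_iff_continuousAt.2 fun t => (hf t).continuousAt),
        contDiff_zero.2 (continuous_iff_continuousAt.2 fun t => (hf' t).continuousAt)⟩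
    | succ j ih =>
      constructor
      · push_cast
        rw [contDiff_succ_iff_deriv]
        refine ⟨fun t => (hf t).differentiableAt, by simp, ?_⟩
        rw [show deriv f = f' from funext fun t => (hf t).deriv]
        exact ih.2
      · push_cast
        rw [contDiff_succ_iff_deriv]
        refine ⟨fun t => (hf' t).differentiableAt, by simp, ?_⟩
        rw [show deriv f' = fun t => -f t ^ p from funext fun t => (hf' t).deriv]
        exact (ih.1.pow p).neg
  exact contDiff_infty.2 fun j => (key j).1

lemma IsLimitProfile.hasDerivAt {p : ℕ} {V : ℝ → ℝ} (hV : IsLimitProfile p V) (t : ℝ) :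
    HasDerivAt V (deriv V t) t :=
  (hV.smooth.differentiable (by simp) t).hasDerivAt

lemma IsLimitProfile.contDiff_deriv {p : ℕ} {V : ℝ → ℝ} (hV : IsLimitProfile p V) :
    ContDiff ℝ ∞ (deriv V) :=
  (contDiff_infty_iff_deriv.1 hV.smooth).2

lemma IsLimitProfile.hasDerivAt_deriv {p : ℕ} {V : ℝ → ℝ} (hV : IsLimitProfile p V) (t : ℝ) :
    HasDerivAt (deriv V) (-V t ^ p) t := by
  have := (hV.contDiff_deriv.differentiable (by simp) t).hasDerivAt
  rwa [eq_neg_of_add_eq_zero_left (hV.equation t)] at this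

theorem existsUnique_isLimitProfile {p : ℕ} (hp : Odd p) : ∃! V : ℝ → ℝ, IsLimitProfile p V := by
  obtain ⟨f, f', hf, hf', h0, h1, hb⟩ := exists_power_ode hp
  have hd : deriv f = f' := funext fun t => (hf t).deriv
  refine ⟨f, ⟨power_ode_contDiff hf hf', power_ode_periodic hp hf hf' h0 h1 hb, fun t => ?_, h0,
    by rw [hd, h1]⟩, fun g hg => ?_⟩
  · rw [hd, (hf' t).deriv, neg_add_cancel]
  · exact power_ode_unique p hg.hasDerivAt hg.hasDerivAt_deriv hf hf' (by rw [hg.initial, h0])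
      (by rw [hg.initial_deriv, h1])

/-! ### The limit solution -/

section LimitSolution

variable {n p : ℕ} {V : ℝ → ℝ} {φ₀ : EuclideanSpace ℝ (Fin n) → ℝ}

/-- The time derivative of `limitSolution`. -/
noncomputable def limitVelocity {n : ℕ} (p : ℕ) (V : ℝ → ℝ) (φ₀ : EuclideanSpace ℝ (Fin n) → ℝ) :
    ℝ → EuclideanSpace ℝ (Fin n) → ℝ :=
  fun t x => φ₀ x ^ ((p - 1) / 2 + 1) * deriv V (t * φ₀ x ^ ((p - 1) / 2))

lemma hasDerivAt_limitSolution (hV : IsLimitProfile p V) (t : ℝ) (x : EuclideanSpace ℝ (Fin n)) :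
    HasDerivAt (fun τ => limitSolution p V φ₀ τ x) (limitVelocity p V φ₀ t x) t := by
  have h := ((hV.hasDerivAt (t * φ₀ x ^ ((p - 1) / 2))).scomp t
    ((hasDerivAt_id t).mul_const (φ₀ x ^ ((p - 1) / 2)))).const_mul (φ₀ x)
  convert! h using 1
  simp only [limitVelocity, smul_eq_mul]
  ring

lemma hasDerivAt_limitVelocity (hp : Odd p) (hV : IsLimitProfile p V) (t : ℝ)
    (x : EuclideanSpace ℝ (Fin n)) :
    HasDerivAt (fun τ => limitVelocity p V φ₀ τ x) (-limitSolution p V φ₀ t x ^ p) t := by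
  have h := ((hV.hasDerivAt_deriv (t * φ₀ x ^ ((p - 1) / 2))).scomp t
    ((hasDerivAt_id t).mul_const (φ₀ x ^ ((p - 1) / 2)))).const_mul (φ₀ x ^ ((p - 1) / 2 + 1))
  convert! h using 1
  obtain ⟨m, rfl⟩ := hp
  simp only [limitSolution, smul_eq_mul, Nat.add_sub_cancel, Nat.mul_div_cancel_left m two_pos]
  ring

lemma isLimitSolution_limitSolution (hp : Odd p) (hV : IsLimitProfile p V) :
    IsLimitSolution p φ₀ (limitSolution p V φ₀) where
  contDiff x := contDiff_const.mul
    ((hV.smooth.of_le (WithTop.coe_le_coe.2 le_top)).comp (contDiff_id.mul contDiff_const))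
  equation t x := by
    rw [show deriv (fun τ => limitSolution p V φ₀ τ x) = fun τ => limitVelocity p V φ₀ τ x from
      funext fun τ => (hasDerivAt_limitSolution hV τ x).deriv,
      (hasDerivAt_limitVelocity hp hV t x).deriv, neg_add_cancel]
  initial x := by simp [limitSolution, hV.initial]
  initial_deriv x := by
    rw [(hasDerivAt_limitSolution hV 0 x).deriv]
    simp [limitVelocity, hV.initial_deriv]

lemma IsLimitSolution.eq_limitSolution (hp : Odd p) (hV : IsLimitProfile p V)
    {ψ : ℝ → EuclideanSpace ℝ (Fin n) → ℝ} (hψ : IsLimitSolution p φ₀ ψ) :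
    ψ = limitSolution p V φ₀ := by
  have key (χ : ℝ → EuclideanSpace ℝ (Fin n) → ℝ) (hχ : IsLimitSolution p φ₀ χ)
      (x : EuclideanSpace ℝ (Fin n)) :
      (∀ t, HasDerivAt (fun τ => χ τ x) (deriv (fun τ => χ τ x) t) t) ∧
      ∀ t, HasDerivAt (deriv fun τ => χ τ x) (-χ t x ^ p) t := by
    refine ⟨fun t => ((hχ.contDiff x).differentiable (by simp) t).hasDerivAt, fun t => ?_⟩
    have h1 : ContDiff ℝ (1 + 1) (fun τ => χ τ x) := hχ.contDiff x
    have h2 := ((contDiff_succ_iff_deriv.1 h1).2.2.differentiable (by simp) t).hasDerivAt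
    rwa [eq_neg_of_add_eq_zero_left (hχ.equation t x)] at h2
  have hL := isLimitSolution_limitSolution (φ₀ := φ₀) hp hV
  ext t x
  exact congrFun (power_ode_unique p (key ψ hψ x).1 (key ψ hψ x).2 (key _ hL x).1 (key _ hL x).2
    (by rw [hψ.initial, hL.initial]) (by rw [hψ.initial_deriv, hL.initial_deriv])) t

end LimitSolution

/-! ### Polynomially decaying functions and their convolutions -/

section Decay

variable {E : Type*} [NormedAddCommGroup E]

/-- The function `(1 + ‖ξ‖) ^ (-M)`. -/
noncomputable def decay (M : ℕ) (ξ : E) : ℝ := ((1 + ‖ξ‖) ^ M)⁻¹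

lemma decay_pos (M : ℕ) (ξ : E) : 0 < decay M ξ := by unfold decay; positivity

lemma decay_le_one (M : ℕ) (ξ : E) : decay M ξ ≤ 1 :=
  inv_le_one_of_one_le₀ (one_le_pow₀ (by linarith [norm_nonneg ξ]))

lemma continuous_decay (M : ℕ) : Continuous (decay M : E → ℝ) := by
  unfold decay
  exact Continuous.inv₀ (by fun_prop) fun ξ => by positivity

lemma decay_neg (M : ℕ) (ξ : E) : decay M (-ξ) = decay M ξ := by simp [decay]

lemma decay_antitone {M N : ℕ} (h : M ≤ N) (ξ : E) : decay N ξ ≤ decay M ξ :=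
  inv_anti₀ (by positivity) (pow_le_pow_right₀ (by linarith [norm_nonneg ξ]) h)

lemma one_add_norm_pow_mul_decay (j M : ℕ) (ξ : E) :
    (1 + ‖ξ‖) ^ j * decay (M + j) ξ = decay M ξ := by
  have : (1 + ‖ξ‖) ≠ 0 := by positivity
  unfold decay
  field_simp
  ring

lemma norm_mul_decay_succ_le (M : ℕ) (ξ : E) : ‖ξ‖ * decay (M + 1) ξ ≤ decay M ξ := by
  rw [← one_add_norm_pow_mul_decay 1 M ξ, pow_one]
  exact mul_le_mul_of_nonneg_right (by linarith) (decay_pos _ _).le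

/-- By the triangle inequality `1 + ‖ξ‖ ≤ 2 max (1 + ‖η‖) (1 + ‖ξ - η‖)`, so at least one factor
already decays in `ξ` and the other is left to be integrated. -/
lemma decay_mul_decay_le (M : ℕ) (ξ η : E) :
    decay M η * decay M (ξ - η) ≤ 2 ^ M * decay M ξ * (decay M η + decay M (ξ - η)) := by
  have h1 : 1 + ‖ξ‖ ≤ 2 * max (1 + ‖η‖) (1 + ‖ξ - η‖) := by
    have : ‖ξ‖ ≤ ‖η‖ + ‖ξ - η‖ := by simpa using norm_add_le η (ξ - η)
    have := le_max_left (1 + ‖η‖) (1 + ‖ξ - η‖)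
    have := le_max_right (1 + ‖η‖) (1 + ‖ξ - η‖)
    linarith
  have h2 : (1 + ‖ξ‖) ^ M ≤ 2 ^ M * ((1 + ‖η‖) ^ M + (1 + ‖ξ - η‖) ^ M) := by
    refine (pow_le_pow_left₀ (by positivity) h1 M).trans ?_
    rw [mul_pow]
    gcongr
    rcases max_choice (1 + ‖η‖) (1 + ‖ξ - η‖) with h | h <;> rw [h]
    · exact le_add_of_nonneg_right (by positivity)
    · exact le_add_of_nonneg_left (by positivity)
  unfold decay
  have e1 : 0 < (1 + ‖ξ‖) ^ M := by positivity
  have e2 : 0 < (1 + ‖η‖) ^ M := by positivity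
  have e3 : 0 < (1 + ‖ξ - η‖) ^ M := by positivity
  have h3 : 1 ≤ ((1 + ‖ξ‖) ^ M)⁻¹ * (2 ^ M * ((1 + ‖η‖) ^ M + (1 + ‖ξ - η‖) ^ M)) := by
    rw [← div_eq_inv_mul, one_le_div e1]; exact h2
  calc ((1 + ‖η‖) ^ M)⁻¹ * ((1 + ‖ξ - η‖) ^ M)⁻¹
      ≤ ((1 + ‖η‖) ^ M)⁻¹ * ((1 + ‖ξ - η‖) ^ M)⁻¹ *
        (((1 + ‖ξ‖) ^ M)⁻¹ * (2 ^ M * ((1 + ‖η‖) ^ M + (1 + ‖ξ - η‖) ^ M))) :=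
        le_mul_of_one_le_right (by positivity) h3
    _ = _ := by field_simp; ring

lemma nonneg_of_decay {M : ℕ} {A : ℝ} {F : E → ℂ} (hFA : ∀ ξ, ‖F ξ‖ ≤ A * decay M ξ) : 0 ≤ A :=
  nonneg_of_mul_nonneg_left ((norm_nonneg _).trans (hFA 0)) (decay_pos M 0)

lemma norm_mul_le_of_decay {M : ℕ} {A B : ℝ} {F G : E → ℂ}
    (hFA : ∀ ξ, ‖F ξ‖ ≤ A * decay M ξ) (hGB : ∀ ξ, ‖G ξ‖ ≤ B * decay M ξ) (ξ η : E) :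
    ‖F η * G (ξ - η)‖ ≤ A * B * (decay M η * decay M (ξ - η)) := by
  rw [norm_mul]
  calc _ ≤ (A * decay M η) * (B * decay M (ξ - η)) :=
        mul_le_mul (hFA η) (hGB _) (norm_nonneg _)
          (mul_nonneg (nonneg_of_decay hFA) (decay_pos _ _).le)
    _ = _ := by ring

variable [InnerProductSpace ℝ E] [FiniteDimensional ℝ E] [MeasurableSpace E] [BorelSpace E]

lemma integrable_decay {M : ℕ} (hM : Module.finrank ℝ E < M) :
    Integrable (decay M : E → ℝ) := by
  have := integrable_one_add_norm (E := E) (μ := volume) (r := M) (by exact_mod_cast hM)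
  refine this.congr (Eventually.of_forall fun ξ => ?_)
  simp only [decay]
  rw [Real.rpow_neg (by positivity), Real.rpow_natCast]

variable (E) in
/-- A constant in the convolution inequality for `decay M`. -/
noncomputable def convConst (M : ℕ) : ℝ := 1 + 2 ^ (M + 1) * ∫ ξ : E, decay M ξ

lemma one_le_convConst (M : ℕ) : 1 ≤ convConst E M := by
  have : 0 ≤ ∫ ξ : E, decay M ξ := integral_nonneg fun ξ => (decay_pos M ξ).le
  unfold convConst
  have : 0 ≤ 2 ^ (M + 1) * ∫ ξ : E, decay M ξ := by positivity
  linarith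

lemma integrable_decay_mul_decay {M : ℕ} (hM : Module.finrank ℝ E < M) (ξ : E) :
    Integrable fun η : E => decay M η * decay M (ξ - η) := by
  refine (integrable_decay hM).mono' ?_ (Eventually.of_forall fun η => ?_)
  · exact ((continuous_decay M).mul
      ((continuous_decay M).comp (continuous_const.sub continuous_id))).aestronglyMeasurable
  · rw [Real.norm_of_nonneg (mul_pos (decay_pos _ _) (decay_pos _ _)).le]
    exact mul_le_of_le_one_right (decay_pos _ _).le (decay_le_one _ _)

lemma integral_decay_mul_decay_le {M : ℕ} (hM : Module.finrank ℝ E < M) (ξ : E) :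
    ∫ η : E, decay M η * decay M (ξ - η) ≤ convConst E M * decay M ξ := by
  have hi := integrable_decay (E := E) hM
  have hi' : Integrable fun η : E => decay M (ξ - η) := hi.comp_sub_left ξ
  calc ∫ η : E, decay M η * decay M (ξ - η)
      ≤ ∫ η : E, 2 ^ M * decay M ξ * (decay M η + decay M (ξ - η)) :=
        integral_mono (integrable_decay_mul_decay hM ξ) ((hi.add hi').const_mul _)
          fun η => decay_mul_decay_le M ξ η
    _ = 2 ^ (M + 1) * (∫ η : E, decay M η) * decay M ξ := by
        rw [integral_const_mul, integral_add hi hi', integral_sub_left_eq_self (decay M) volume ξ]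
        ring
    _ ≤ _ := by
        refine mul_le_mul_of_nonneg_right ?_ (decay_pos _ _).le
        unfold convConst; linarith

/-- The convolution of complex functions. -/
noncomputable def fconv (F G : E → ℂ) (ξ : E) : ℂ := ∫ η, F η * G (ξ - η)

/-- The convolution powers: `cpow F j` is the convolution of `j + 1` copies of `F`. -/
noncomputable def cpow (F : E → ℂ) : ℕ → E → ℂ
  | 0 => F
  | j + 1 => fconv F (cpow F j)

lemma integrable_of_decay {M : ℕ} (hM : Module.finrank ℝ E < M) {A : ℝ} {F : E → ℂ}
    (hF : Continuous F) (hFA : ∀ ξ, ‖F ξ‖ ≤ A * decay M ξ) : Integrable F :=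
  ((integrable_decay hM).const_mul A).mono' hF.aestronglyMeasurable (Eventually.of_forall hFA)

lemma integrable_fconv {M : ℕ} (hM : Module.finrank ℝ E < M) {A B : ℝ} {F G : E → ℂ}
    (hF : Continuous F) (hG : Continuous G)
    (hFA : ∀ ξ, ‖F ξ‖ ≤ A * decay M ξ) (hGB : ∀ ξ, ‖G ξ‖ ≤ B * decay M ξ) (ξ : E) :
    Integrable fun η => F η * G (ξ - η) :=
  ((integrable_decay_mul_decay hM ξ).const_mul (A * B)).mono'
    (hF.mul (hG.comp (continuous_const.sub continuous_id))).aestronglyMeasurable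
    (Eventually.of_forall (norm_mul_le_of_decay hFA hGB ξ))

/-- The algebra property of the weighted sup norm. It needs `decay M` to be integrable, hence `M`
above the dimension. -/
lemma norm_fconv_le {M : ℕ} (hM : Module.finrank ℝ E < M) {A B : ℝ} {F G : E → ℂ}
    (hFA : ∀ ξ, ‖F ξ‖ ≤ A * decay M ξ) (hGB : ∀ ξ, ‖G ξ‖ ≤ B * decay M ξ) (ξ : E) :
    ‖fconv F G ξ‖ ≤ convConst E M * A * B * decay M ξ := by
  have hAB : 0 ≤ A * B := mul_nonneg (nonneg_of_decay hFA) (nonneg_of_decay hGB)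
  calc ‖fconv F G ξ‖ ≤ ∫ η, A * B * (decay M η * decay M (ξ - η)) :=
        norm_integral_le_of_norm_le ((integrable_decay_mul_decay hM ξ).const_mul _)
          (Eventually.of_forall (norm_mul_le_of_decay hFA hGB ξ))
    _ ≤ A * B * (convConst E M * decay M ξ) := by
        rw [integral_const_mul]
        exact mul_le_mul_of_nonneg_left (integral_decay_mul_decay_le hM ξ) hAB
    _ = _ := by ring

lemma continuous_fconv {Y : Type*} [TopologicalSpace Y] [FirstCountableTopology Y] {M : ℕ}
    (hM : Module.finrank ℝ E < M) {A B : ℝ} {F G : Y → E → ℂ}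
    (hF : Continuous fun z : Y × E => F z.1 z.2) (hG : Continuous fun z : Y × E => G z.1 z.2)
    (hFA : ∀ y ξ, ‖F y ξ‖ ≤ A * decay M ξ) (hGB : ∀ y ξ, ‖G y ξ‖ ≤ B * decay M ξ) :
    Continuous fun z : Y × E => fconv (F z.1) (G z.1) z.2 := by
  unfold fconv
  refine continuous_of_dominated (bound := fun η => A * B * decay M η) (fun z => ?_)
    (fun z => Eventually.of_forall fun η => ?_) ((integrable_decay hM).const_mul _)
    (Eventually.of_forall fun η => ?_)
  · refine Continuous.aestronglyMeasurable (Continuous.mul ?_ ?_)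
    · exact hF.comp (Continuous.prodMk_right z.1)
    · exact hG.comp (continuous_const.prodMk (continuous_const.sub continuous_id))
  · refine (norm_mul_le_of_decay (hFA z.1) (hGB z.1) z.2 η).trans ?_
    refine mul_le_mul_of_nonneg_left
      (mul_le_of_le_one_right (decay_pos _ _).le (decay_le_one _ _))
      (mul_nonneg (nonneg_of_decay (hFA z.1)) (nonneg_of_decay (hGB z.1)))
  · exact (hF.comp (continuous_fst.prodMk continuous_const)).mul
      (hG.comp (continuous_fst.prodMk (continuous_snd.sub continuous_const)))

lemma norm_cpow_le {M : ℕ} (hM : Module.finrank ℝ E < M) {A : ℝ} {F : E → ℂ}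
    (hFA : ∀ ξ, ‖F ξ‖ ≤ A * decay M ξ) (j : ℕ) (ξ : E) :
    ‖cpow F j ξ‖ ≤ convConst E M ^ j * A ^ (j + 1) * decay M ξ := by
  induction j generalizing ξ with
  | zero => simpa [cpow] using hFA ξ
  | succ j ih =>
    refine (norm_fconv_le hM hFA ih ξ).trans (le_of_eq ?_)
    ring

lemma continuous_cpow {Y : Type*} [TopologicalSpace Y] [FirstCountableTopology Y] {M : ℕ}
    (hM : Module.finrank ℝ E < M) {A : ℝ} {F : Y → E → ℂ}
    (hF : Continuous fun z : Y × E => F z.1 z.2)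
    (hFA : ∀ y ξ, ‖F y ξ‖ ≤ A * decay M ξ) (j : ℕ) :
    Continuous fun z : Y × E => cpow (F z.1) j z.2 := by
  induction j with
  | zero => exact hF
  | succ j ih => exact continuous_fconv hM hF ih hFA fun y => norm_cpow_le hM (hFA y) j

lemma continuous_cpow_apply {M : ℕ} (hM : Module.finrank ℝ E < M) {A : ℝ} {F : E → ℂ}
    (hF : Continuous F) (hFA : ∀ ξ, ‖F ξ‖ ≤ A * decay M ξ) (j : ℕ) : Continuous (cpow F j) :=
  (continuous_cpow (Y := Unit) hM (F := fun _ => F) (hF.comp continuous_snd) (fun _ => hFA) j).comp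
    (Continuous.prodMk_right ())

/-- The Lipschitz bound for the nonlinearity, by telescoping: `F * F^j - G * G^j = (F - G) * F^j + G
* (F^j - G^j)`. Each of the `j + 1` factors is exchanged once. -/
lemma norm_cpow_sub_cpow_le {M : ℕ} (hM : Module.finrank ℝ E < M) {A ε : ℝ} {F G : E → ℂ}
    (hF : Continuous F) (hG : Continuous G)
    (hFA : ∀ ξ, ‖F ξ‖ ≤ A * decay M ξ) (hGA : ∀ ξ, ‖G ξ‖ ≤ A * decay M ξ)
    (hFG : ∀ ξ, ‖F ξ - G ξ‖ ≤ ε * decay M ξ) (j : ℕ) (ξ : E) :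
    ‖cpow F j ξ - cpow G j ξ‖ ≤ (j + 1) * convConst E M ^ j * A ^ j * ε * decay M ξ := by
  induction j generalizing ξ with
  | zero => simpa [cpow] using hFG ξ
  | succ j ih =>
    have hFj := norm_cpow_le hM hFA j
    have hGj := norm_cpow_le hM hGA j
    have cFj := continuous_cpow_apply hM hF hFA j
    have cGj := continuous_cpow_apply hM hG hGA j
    have hFi := integrable_fconv hM hF cFj hFA hFj ξ
    have hGi := integrable_fconv hM hG cGj hGA hGj ξ
    have h1 := integrable_fconv hM (hF.sub hG) cFj hFG hFj ξ
    have h2 := integrable_fconv hM hG (cFj.sub cGj) hGA ih ξ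
    have e : cpow F (j + 1) ξ - cpow G (j + 1) ξ =
        fconv (fun η => F η - G η) (cpow F j) ξ +
          fconv G (fun η => cpow F j η - cpow G j η) ξ := by
      simp only [cpow, fconv]
      rw [← integral_sub hFi hGi]
      have := integral_add h1 h2
      simp only [Pi.sub_apply] at this
      rw [← this]
      congr 1; ext η; ring
    rw [e]
    refine (norm_add_le _ _).trans
      ((add_le_add (norm_fconv_le hM hFG hFj ξ) (norm_fconv_le hM hGA ih ξ)).trans (le_of_eq ?_))
    push_cast
    ring

/-- The symmetry of the Fourier transforms of real functions. -/
def HermitianSymm (F : E → ℂ) : Prop := ∀ ξ, F (-ξ) = starRingEnd ℂ (F ξ)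

lemma HermitianSymm.fconv {F G : E → ℂ} (hF : HermitianSymm F) (hG : HermitianSymm G) :
    HermitianSymm (fconv F G) := fun ξ => by
  unfold _root_.fconv
  rw [← integral_conj, ← integral_neg_eq_self]
  congr 1; ext η
  rw [hF, map_mul, ← hG, neg_sub, sub_neg_eq_add]
  congr 2
  abel

lemma HermitianSymm.cpow {F : E → ℂ} (hF : HermitianSymm F) (j : ℕ) :
    HermitianSymm (cpow F j) := by
  induction j with
  | zero => exact hF
  | succ j ih => exact hF.fconv ih

end Decay

/-! ### Real functions given by their Fourier transforms -/

section Phys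

variable {n : ℕ}

/-- The real function with Fourier transform `F`, for `F` with `HermitianSymm`. -/
noncomputable def phys (F : EuclideanSpace ℝ (Fin n) → ℂ) (x : EuclideanSpace ℝ (Fin n)) : ℝ :=
  (𝓕⁻ F x).re

/-- Continuous functions, bounded by a multiple of `decay M`, that are Fourier transforms of real
functions. -/
structure IsSymbol (M : ℕ) (F : EuclideanSpace ℝ (Fin n) → ℂ) : Prop where
  continuous : Continuous F
  symm : HermitianSymm F
  bound : ∃ A, ∀ ξ, ‖F ξ‖ ≤ A * decay M ξ

variable {M : ℕ} {F G : EuclideanSpace ℝ (Fin n) → ℂ}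

lemma finrank_lt_of_lt (hM : n < M) : Module.finrank ℝ (EuclideanSpace ℝ (Fin n)) < M := by
  simpa using hM

lemma IsSymbol.integrable (hM : n < M) (hF : IsSymbol M F) : Integrable F := by
  obtain ⟨A, hA⟩ := hF.bound
  exact integrable_of_decay (finrank_lt_of_lt hM) hF.continuous hA

lemma memLp_decay (hM : n < M) :
    MemLp (decay M : EuclideanSpace ℝ (Fin n) → ℝ) 2 volume := by
  rw [memLp_two_iff_integrable_sq (continuous_decay M).aestronglyMeasurable]
  refine (integrable_decay (finrank_lt_of_lt hM)).mono'
    ((continuous_decay M).pow 2).aestronglyMeasurable (Eventually.of_forall fun ξ => ?_)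
  rw [Real.norm_of_nonneg (sq_nonneg _), sq]
  exact mul_le_of_le_one_right (decay_pos _ _).le (decay_le_one _ _)

lemma IsSymbol.memLp (hM : n < M) (hF : IsSymbol M F) : MemLp F 2 volume := by
  obtain ⟨A, hA⟩ := hF.bound
  refine (((memLp_decay hM).const_mul A)).mono' hF.continuous.aestronglyMeasurable
    (Eventually.of_forall hA)

lemma IsSymbol.add (hF : IsSymbol M F) (hG : IsSymbol M G) : IsSymbol M fun ξ => F ξ + G ξ := by
  obtain ⟨A, hA⟩ := hF.bound
  obtain ⟨B, hB⟩ := hG.bound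
  refine ⟨hF.continuous.add hG.continuous, fun ξ => ?_, A + B, fun ξ => ?_⟩
  · rw [hF.symm, hG.symm, map_add]
  · rw [add_mul]; exact (norm_add_le _ _).trans (add_le_add (hA ξ) (hB ξ))

lemma IsSymbol.const_mul (hF : IsSymbol M F) (c : ℝ) : IsSymbol M fun ξ => (c : ℂ) * F ξ := by
  obtain ⟨A, hA⟩ := hF.bound
  refine ⟨continuous_const.mul hF.continuous, fun ξ => ?_, |c| * A, fun ξ => ?_⟩
  · rw [hF.symm, map_mul, Complex.conj_ofReal]
  · rw [norm_mul, Complex.norm_real, Real.norm_eq_abs, mul_assoc]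
    exact mul_le_mul_of_nonneg_left (hA ξ) (abs_nonneg c)

lemma IsSymbol.sub (hF : IsSymbol M F) (hG : IsSymbol M G) : IsSymbol M fun ξ => F ξ - G ξ := by
  have := hF.add (hG.const_mul (-1))
  simpa [sub_eq_add_neg] using this

lemma IsSymbol.mono {N : ℕ} (hF : IsSymbol M F) (h : N ≤ M) : IsSymbol N F := by
  obtain ⟨A, hA⟩ := hF.bound
  exact ⟨hF.continuous, hF.symm, A, fun ξ => (hA ξ).trans
    (mul_le_mul_of_nonneg_left (decay_antitone h ξ) (nonneg_of_decay hA))⟩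

lemma IsSymbol.norm_mul (hF : IsSymbol (M + 1) F) (c : ℝ) :
    IsSymbol M fun ξ => ((c * ‖ξ‖ : ℝ) : ℂ) * F ξ := by
  obtain ⟨A, hA⟩ := hF.bound
  refine ⟨by have := hF.continuous; fun_prop, fun ξ => ?_, |c| * A, fun ξ => ?_⟩
  · rw [hF.symm, map_mul, Complex.conj_ofReal, norm_neg]
  · rw [_root_.norm_mul, Complex.norm_real, Real.norm_eq_abs, abs_mul, abs_norm]
    calc |c| * ‖ξ‖ * ‖F ξ‖ ≤ |c| * ‖ξ‖ * (A * decay (M + 1) ξ) := by gcongr; exact hA ξ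
      _ = |c| * A * (‖ξ‖ * decay (M + 1) ξ) := by ring
      _ ≤ _ := mul_le_mul_of_nonneg_left (norm_mul_decay_succ_le M ξ)
        (mul_nonneg (abs_nonneg _) (nonneg_of_decay hA))

lemma IsSymbol.fconv (hM : n < M) (hF : IsSymbol M F) (hG : IsSymbol M G) :
    IsSymbol M (fconv F G) := by
  obtain ⟨A, hA⟩ := hF.bound
  obtain ⟨B, hB⟩ := hG.bound
  refine ⟨?_, hF.symm.fconv hG.symm, _, norm_fconv_le (finrank_lt_of_lt hM) hA hB⟩
  exact (continuous_fconv (Y := Unit) (finrank_lt_of_lt hM) (F := fun _ => F) (G := fun _ => G)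
    (hF.continuous.comp continuous_snd) (hG.continuous.comp continuous_snd) (fun _ => hA)
    (fun _ => hB)).comp (Continuous.prodMk_right ())

lemma IsSymbol.cpow (hM : n < M) (hF : IsSymbol M F) (j : ℕ) : IsSymbol M (cpow F j) := by
  induction j with
  | zero => exact hF
  | succ j ih => exact hF.fconv hM ih

lemma ofReal_phys (hF : HermitianSymm F) (x : EuclideanSpace ℝ (Fin n)) :
    (phys F x : ℂ) = 𝓕⁻ F x := by
  rw [phys, ← Complex.conj_eq_iff_re]
  rw [Real.fourierInv_eq', ← integral_conj, ← integral_neg_eq_self]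
  congr 1; ext v
  rw [hF]
  simp only [smul_eq_mul, map_mul, Complex.conj_conj]
  congr 1
  rw [← Complex.exp_conj]
  simp [map_ofNat]

lemma phys_add (hM : n < M) (hF : IsSymbol M F) (hG : IsSymbol M G)
    (x : EuclideanSpace ℝ (Fin n)) : phys (fun ξ => F ξ + G ξ) x = phys F x + phys G x := by
  have h := congrFun (VectorFourier.fourierIntegral_add (μ := volume) (L := innerₗ _)
    Real.continuous_fourierChar continuous_inner (hF.integrable hM) (hG.integrable hM)) (-x)
  simp only [phys, Real.fourierInv_eq_fourier_neg]
  rw [← Complex.add_re]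
  exact congrArg Complex.re h

lemma phys_const_mul (c : ℝ) (x : EuclideanSpace ℝ (Fin n)) :
    phys (fun ξ => (c : ℂ) * F ξ) x = c * phys F x := by
  have h := congrFun (VectorFourier.fourierIntegral_const_smul (μ := volume)
    (L := innerₗ (EuclideanSpace ℝ (Fin n))) Real.fourierChar F (c : ℂ)) (-x)
  simp only [phys, Real.fourierInv_eq_fourier_neg]
  rw [← Complex.re_ofReal_mul]
  exact congrArg Complex.re h

lemma phys_sub (hM : n < M) (hF : IsSymbol M F) (hG : IsSymbol M G)
    (x : EuclideanSpace ℝ (Fin n)) : phys (fun ξ => F ξ - G ξ) x = phys F x - phys G x := by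
  have h := phys_add hM hF (hG.const_mul (-1)) x
  rw [phys_const_mul] at h
  simpa [sub_eq_add_neg] using h

lemma phys_fconv (hM : n < M) (hF : IsSymbol M F) (hG : IsSymbol M G)
    (x : EuclideanSpace ℝ (Fin n)) : phys (fconv F G) x = phys F x * phys G x := by
  have h := Real.fourier_mul_convolution_eq (hF.integrable hM) (hG.integrable hM) (-x)
  have h' : 𝓕⁻ (fconv F G) x = 𝓕⁻ F x * 𝓕⁻ G x := by
    simp only [Real.fourierInv_eq_fourier_neg]; exact h
  rw [← ofReal_phys hF.symm, ← ofReal_phys hG.symm, ← ofReal_phys (hF.symm.fconv hG.symm)] at h'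
  exact_mod_cast h'

lemma phys_cpow (hM : n < M) (hF : IsSymbol M F) (j : ℕ) (x : EuclideanSpace ℝ (Fin n)) :
    phys (cpow F j) x = phys F x ^ (j + 1) := by
  induction j with
  | zero => simp [cpow]
  | succ j ih =>
    rw [cpow, phys_fconv hM hF (hF.cpow hM j), ih]; ring

lemma continuous_fourierInv (hF : Integrable F) : Continuous (𝓕⁻ F) := by
  have h : Continuous (𝓕 F) :=
    VectorFourier.fourierIntegral_continuous Real.continuous_fourierChar continuous_inner hF
  rw [show 𝓕⁻ F = fun x => 𝓕 F (-x) from funext fun x => Real.fourierInv_eq_fourier_neg F x]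
  exact h.comp continuous_neg

lemma integral_schwartz_fourierInv (hF : Integrable F)
    (h : 𝓢(EuclideanSpace ℝ (Fin n), ℂ)) :
    ∫ ξ, (𝓕⁻ h) ξ * F ξ = ∫ x, h x * 𝓕⁻ F x := by
  have hF' : Integrable fun ξ => F (-ξ) := hF.comp_neg
  have h1 := VectorFourier.integral_bilin_fourierIntegral_eq_flip (ContinuousLinearMap.mul ℂ ℂ)
    (L := innerₗ (EuclideanSpace ℝ (Fin n))) (μ := volume) (ν := volume)
    Real.continuous_fourierChar continuous_inner h.integrable hF'
  rw [flip_innerₗ] at h1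
  have h2 : ∫ ξ, (𝓕⁻ h) ξ * F ξ = ∫ ξ, 𝓕 (h : EuclideanSpace ℝ (Fin n) → ℂ) ξ * F (-ξ) := by
    rw [← integral_neg_eq_self]
    congr 1; ext ξ
    rw [SchwartzMap.fourierInv_coe, Real.fourierInv_eq_fourier_neg, neg_neg]
  rw [h2, Real.fourierInv_eq_fourier_comp_neg]
  exact h1

/-- The inverse transform on `L²` is defined abstractly. It agrees with the Fourier integral because
both have the same pairing with every test function, the transform moving to the test function in
each case. -/
lemma fourierInv_toLp_ae (hM : n < M) (hF : IsSymbol M F) :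
    (𝓕⁻ ((hF.memLp hM).toLp F) : Lp ℂ 2 (volume : Measure (EuclideanSpace ℝ (Fin n))))
      =ᵐ[volume] 𝓕⁻ F := by
  set G := (hF.memLp hM).toLp F
  refine ae_eq_of_integral_contDiff_smul_eq ((Lp.memLp _).locallyIntegrable (by norm_num))
    (continuous_fourierInv (hF.integrable hM)).locallyIntegrable fun g hg hg' => ?_
  have hg₁ : HasCompactSupport (Complex.ofRealCLM ∘ g) := hg'.comp_left rfl
  have hg₂ : ContDiff ℝ ∞ (Complex.ofRealCLM ∘ g) := by fun_prop
  set h := hg₁.toSchwartzMap hg₂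
  have h1 : ((𝓕⁻ G : Lp ℂ 2 (volume : Measure (EuclideanSpace ℝ (Fin n)))) :
      𝓢'(EuclideanSpace ℝ (Fin n), ℂ)) h = ∫ ξ, (𝓕⁻ h) ξ * F ξ := by
    rw [← Lp.fourierInv_toTemperedDistribution_eq, TemperedDistribution.fourierInv_apply,
      Lp.toTemperedDistribution_apply]
    refine integral_congr_ae ?_
    filter_upwards [(hF.memLp hM).coeFn_toLp] with ξ hξ
    rw [hξ, smul_eq_mul]
  rw [Lp.toTemperedDistribution_apply, integral_schwartz_fourierInv (hF.integrable hM)] at h1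
  simpa [h] using h1

lemma ofReal_phys_ae (hM : n < M) (hF : IsSymbol M F) :
    (fun x => (phys F x : ℂ)) =ᵐ[volume]
      (𝓕⁻ ((hF.memLp hM).toLp F) : Lp ℂ 2 (volume : Measure (EuclideanSpace ℝ (Fin n)))) := by
  filter_upwards [fourierInv_toLp_ae hM hF] with x hx
  rw [hx, ofReal_phys hF.symm]

lemma memLp_phys (hM : n < M) (hF : IsSymbol M F) : MemLp (phys F) 2 volume := by
  have h : MemLp (𝓕⁻ F) 2 volume := (Lp.memLp _).ae_eq (fourierInv_toLp_ae hM hF)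
  exact h.re

lemma toL2_phys (hM : n < M) (hF : IsSymbol M F) (h : MemLp (phys F) 2 volume) :
    toL2 (phys F) h = 𝓕⁻ ((hF.memLp hM).toLp F) := by
  refine Lp.ext (((h.ofReal (K := ℂ)).coeFn_toLp).trans (ofReal_phys_ae hM hF))

lemma fourier_toL2_phys (hM : n < M) (hF : IsSymbol M F) (h : MemLp (phys F) 2 volume) :
    𝓕 (toL2 (phys F) h) = (hF.memLp hM).toLp F := by
  rw [toL2_phys hM hF, FourierTransform.fourier_fourierInv_eq]

lemma sobolevENorm_phys (hM : n < M) (hF : IsSymbol M F) (s : ℝ) :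
    sobolevENorm s (phys F) = eLpNorm (fun ξ : EuclideanSpace ℝ (Fin n) =>
      (((1 + (2 * Real.pi * ‖ξ‖) ^ 2) ^ (s / 2) : ℝ) : ℂ) * F ξ) 2 volume := by
  have h := memLp_phys hM hF
  rw [sobolevENorm, dif_pos h]
  refine eLpNorm_congr_ae ?_
  rw [fourier_toL2_phys hM hF h]
  filter_upwards [(hF.memLp hM).coeFn_toLp] with ξ hξ
  rw [hξ]

lemma sobolev_weight_le {s : ℝ} {σ : ℕ} (hs : s ≤ σ) (ξ : EuclideanSpace ℝ (Fin n)) :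
    (1 + (2 * Real.pi * ‖ξ‖) ^ 2) ^ (s / 2) ≤ 7 ^ σ * (1 + ‖ξ‖) ^ σ := by
  have h0 : 0 ≤ 2 * Real.pi * ‖ξ‖ := by positivity
  have h1 : 2 * Real.pi * ‖ξ‖ ≤ 7 * ‖ξ‖ := by
    have := Real.pi_lt_d2
    exact mul_le_mul_of_nonneg_right (by linarith) (norm_nonneg ξ)
  have h2 : 1 + (2 * Real.pi * ‖ξ‖) ^ 2 ≤ (7 * (1 + ‖ξ‖)) ^ 2 := by
    have := norm_nonneg ξ
    nlinarith [pow_le_pow_left₀ h0 h1 2]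
  calc (1 + (2 * Real.pi * ‖ξ‖) ^ 2) ^ (s / 2)
      ≤ (1 + (2 * Real.pi * ‖ξ‖) ^ 2) ^ ((σ : ℝ) / 2) :=
        Real.rpow_le_rpow_of_exponent_le (by nlinarith) (by linarith)
    _ ≤ ((7 * (1 + ‖ξ‖)) ^ 2) ^ ((σ : ℝ) / 2) :=
        Real.rpow_le_rpow (by positivity) h2 (by positivity)
    _ = _ := by
        rw [← Real.rpow_natCast (7 * (1 + ‖ξ‖)) 2, ← Real.rpow_mul (by positivity)]
        rw [show ((2 : ℕ) : ℝ) * ((σ : ℝ) / 2) = σ by push_cast; ring, Real.rpow_natCast, mul_pow]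

/-- In the exponent `n + 1 + σ`, the Sobolev weight uses up `σ` powers and the remaining `n + 1`
make the result square integrable. The factor `7` bounds `2π`. -/
lemma norm_sobolev_weight_mul_le {s : ℝ} {σ : ℕ} (hs : s ≤ σ) {A : ℝ}
    {ξ : EuclideanSpace ℝ (Fin n)} {z : ℂ} (hz : ‖z‖ ≤ A * decay (n + 1 + σ) ξ) :
    ‖(((1 + (2 * Real.pi * ‖ξ‖) ^ 2) ^ (s / 2) : ℝ) : ℂ) * z‖ ≤
      7 ^ σ * A * decay (n + 1) ξ := by
  rw [_root_.norm_mul, Complex.norm_real, Real.norm_of_nonneg (by positivity)]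
  calc _ ≤ (7 ^ σ * (1 + ‖ξ‖) ^ σ) * (A * decay (n + 1 + σ) ξ) :=
        mul_le_mul (sobolev_weight_le hs ξ) hz (norm_nonneg _) (by positivity)
    _ = 7 ^ σ * A * ((1 + ‖ξ‖) ^ σ * decay (n + 1 + σ) ξ) := by ring
    _ = _ := by rw [one_add_norm_pow_mul_decay]

/-- A constant that bounds Sobolev norms by suprema of Fourier transforms. -/
noncomputable def sobolevConst (n σ : ℕ) : ℝ :=
  7 ^ σ * (eLpNorm (decay (n + 1) : EuclideanSpace ℝ (Fin n) → ℝ) 2 volume).toReal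

lemma sobolevENorm_phys_le {s : ℝ} {σ : ℕ} (hs : s ≤ σ) (hF : IsSymbol (n + 1 + σ) F) {A : ℝ}
    (hA : ∀ ξ, ‖F ξ‖ ≤ A * decay (n + 1 + σ) ξ) :
    sobolevENorm s (phys F) ≤ ENNReal.ofReal (sobolevConst n σ * A) := by
  have hA0 := nonneg_of_decay hA
  rw [sobolevENorm_phys (by omega) hF]
  calc _ ≤ eLpNorm (fun ξ : EuclideanSpace ℝ (Fin n) => 7 ^ σ * A * decay (n + 1) ξ) 2 volume :=
        eLpNorm_mono_real fun ξ => norm_sobolev_weight_mul_le hs (hA ξ)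
    _ = _ := by
        rw [show (fun ξ : EuclideanSpace ℝ (Fin n) => 7 ^ σ * A * decay (n + 1) ξ) =
          (7 ^ σ * A) • (decay (n + 1) : EuclideanSpace ℝ (Fin n) → ℝ) from rfl,
          eLpNorm_const_smul, sobolevConst, mul_right_comm,
          ENNReal.ofReal_mul (by positivity), ENNReal.ofReal_toReal
            (memLp_decay (Nat.lt_succ_self n)).eLpNorm_ne_top, Real.enorm_of_nonneg (by positivity)]

/-- Dominated convergence: with a uniform bound by `decay`, convergence at each frequency is enough.
All continuity and differentiability in Sobolev spaces reduces to this. -/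
lemma tendsto_sobolevENorm_phys {s : ℝ} {σ : ℕ} (hs : s ≤ σ) {l : Filter ℝ}
    [l.IsCountablyGenerated] {F : ℝ → EuclideanSpace ℝ (Fin n) → ℂ} {A : ℝ}
    (hF : ∀ᶠ τ in l, IsSymbol (n + 1 + σ) (F τ))
    (hA : ∀ᶠ τ in l, ∀ ξ, ‖F τ ξ‖ ≤ A * decay (n + 1 + σ) ξ)
    (hlim : ∀ ξ, Tendsto (fun τ => F τ ξ) l (𝓝 0)) :
    Tendsto (fun τ => sobolevENorm s (phys (F τ))) l (𝓝 0) := by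
  set w : EuclideanSpace ℝ (Fin n) → ℂ := fun ξ =>
    (((1 + (2 * Real.pi * ‖ξ‖) ^ 2) ^ (s / 2) : ℝ) : ℂ) with hw
  have hwc : Continuous w := by
    refine Complex.continuous_ofReal.comp (Continuous.rpow_const (by fun_prop) fun ξ => ?_)
    exact Or.inl (by positivity)
  have hint : Tendsto (fun τ => ∫⁻ ξ, ‖w ξ * F τ ξ‖ₑ ^ (2 : ℝ)) l (𝓝 0) := by
    have h0 : ∫⁻ _ : EuclideanSpace ℝ (Fin n), (0 : ℝ≥0∞) = 0 := by simp
    rw [← h0]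
    refine tendsto_lintegral_filter_of_dominated_convergence
      (fun ξ => ‖7 ^ σ * A * decay (n + 1) ξ‖ₑ ^ (2 : ℝ)) ?_ ?_ ?_ ?_
    · filter_upwards [hF] with τ hτ
      exact ((hwc.mul hτ.continuous).enorm.measurable.pow_const _)
    · filter_upwards [hA] with τ hτ
      refine Eventually.of_forall fun ξ => ENNReal.rpow_le_rpow ?_ (by norm_num)
      rw [enorm_le_iff_norm_le]
      exact (norm_sobolev_weight_mul_le hs (hτ ξ)).trans (le_abs_self _)
    · have := ((memLp_decay (n := n) (Nat.lt_succ_self n)).const_mul (7 ^ σ * A))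
      have h2 := this.eLpNorm_lt_top
      rw [eLpNorm_eq_lintegral_rpow_enorm_toReal (by norm_num) (by norm_num)] at h2
      intro htop
      simp only [ENNReal.toReal_ofNat] at h2
      rw [htop] at h2
      simp at h2
    · refine Eventually.of_forall fun ξ => ?_
      have h1 : Tendsto (fun τ => w ξ * F τ ξ) l (𝓝 0) := by
        simpa using (hlim ξ).const_mul (w ξ)
      have h2 := (ENNReal.continuous_rpow_const (y := 2)).continuousAt.tendsto.comp h1.enorm
      simpa [Function.comp_def] using h2
  have h3 := (ENNReal.continuous_rpow_const (y := 1 / 2)).continuousAt.tendsto.comp hint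
  rw [ENNReal.zero_rpow_of_pos (by norm_num)] at h3
  refine h3.congr' ?_
  filter_upwards [hF] with τ hτ
  rw [sobolevENorm_phys (by omega) hτ, eLpNorm_eq_lintegral_rpow_enorm_toReal (by norm_num)
    (by norm_num)]
  simp [w]

lemma isSqrtNegLaplacian_phys (hM : n < M) (hF : IsSymbol (M + 1) F) :
    IsSqrtNegLaplacian (phys F) (phys fun ξ => ((2 * Real.pi * ‖ξ‖ : ℝ) : ℂ) * F ξ) := by
  have hG := hF.norm_mul (2 * Real.pi)
  have hF' := hF.mono (Nat.le_succ M)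
  refine ⟨memLp_phys hM hF', memLp_phys hM hG, ?_⟩
  rw [fourier_toL2_phys hM hF', fourier_toL2_phys hM hG]
  filter_upwards [(hF'.memLp hM).coeFn_toLp, (hG.memLp hM).coeFn_toLp] with ξ h1 h2
  rw [h1, h2]

lemma IsSymbol.norm_sq_mul (hF : IsSymbol (M + 2) F) :
    IsSymbol M fun ξ => ((-(2 * Real.pi * ‖ξ‖) ^ 2 : ℝ) : ℂ) * F ξ := by
  have := (((hF.norm_mul (2 * Real.pi)).norm_mul (2 * Real.pi)).const_mul (-1))
  convert! this using 2 with ξ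
  push_cast; ring

/-- As tempered distributions both sides are inverse transforms, so the claim becomes multiplication
by `-(2π‖ξ‖)²` under the pairing with a test function. -/
lemma isLaplacian_phys (hM : n < M) (hF : IsSymbol (M + 2) F) :
    IsLaplacian (phys F) (phys fun ξ => ((-(2 * Real.pi * ‖ξ‖) ^ 2 : ℝ) : ℂ) * F ξ) := by
  have hG := hF.norm_sq_mul
  have hF' := hF.mono (Nat.le_add_right M 2)
  refine ⟨memLp_phys hM hF', memLp_phys hM hG, ?_⟩
  rw [toL2_phys hM hF', toL2_phys hM hG, TemperedDistribution.laplacian_eq_fourierMultiplierCLM,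
    TemperedDistribution.fourierMultiplierCLM_apply, ← Lp.fourierInv_toTemperedDistribution_eq,
    ← Lp.fourierInv_toTemperedDistribution_eq, FourierTransform.fourier_fourierInv_eq]
  ext u
  simp only [smul_apply, TemperedDistribution.fourierInv_apply,
    TemperedDistribution.smulLeftCLM_apply_apply, Lp.toTemperedDistribution_apply]
  rw [← integral_smul]
  refine integral_congr_ae ?_
  have htg : Function.HasTemperateGrowth
      fun x : EuclideanSpace ℝ (Fin n) => Complex.ofReal (‖x‖ ^ 2) := by fun_prop
  filter_upwards [(hF'.memLp hM).coeFn_toLp, (hG.memLp hM).coeFn_toLp] with ξ h1 h2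
  rw [h1, h2, SchwartzMap.smulLeftCLM_apply_apply htg]
  simp only [smul_eq_mul, Complex.real_smul]
  push_cast
  ring

/-! ### Curves of functions given by their Fourier transforms -/

lemma continuousInSobolev_phys {s : ℝ} {σ : ℕ} (hs : s ≤ σ) {I : Set ℝ}
    {U : ℝ → EuclideanSpace ℝ (Fin n) → ℂ} {A : ℝ}
    (hU : ∀ t ∈ I, IsSymbol (n + 1 + σ) (U t))
    (hA : ∀ t ∈ I, ∀ ξ, ‖U t ξ‖ ≤ A * decay (n + 1 + σ) ξ)
    (hc : ∀ ξ, ContinuousOn (fun t => U t ξ) I) :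
    ContinuousInSobolev s I fun t => phys (U t) := by
  intro t ht
  refine ⟨(sobolevENorm_phys_le hs (hU t ht) (hA t ht)).trans_lt ENNReal.ofReal_lt_top, ?_⟩
  have h := tendsto_sobolevENorm_phys hs (l := 𝓝[I] t) (F := fun τ ξ => U τ ξ - U t ξ)
    (A := A + A)
    (by filter_upwards [self_mem_nhdsWithin] with τ hτ using (hU τ hτ).sub (hU t ht))
    (by
      filter_upwards [self_mem_nhdsWithin] with τ hτ ξ
      rw [add_mul]
      exact (norm_sub_le _ _).trans (add_le_add (hA τ hτ ξ) (hA t ht ξ)))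
    (fun ξ => by simpa using (hc ξ t ht).sub_const (U t ξ))
  refine h.congr' ?_
  filter_upwards [self_mem_nhdsWithin] with τ hτ
  congr 1; ext x
  exact phys_sub (by omega) (hU τ hτ) (hU t ht) x

/-- At each frequency the mean value inequality on the convex set `I` bounds the difference quotient
by the supremum of the derivative, which supplies the dominating function. -/
lemma hasSobolevTimeDeriv_phys {s : ℝ} {σ : ℕ} (hs : s ≤ σ) {I : Set ℝ} (hI : Convex ℝ I)
    {U W : ℝ → EuclideanSpace ℝ (Fin n) → ℂ} {A : ℝ}
    (hU : ∀ t ∈ I, IsSymbol (n + 1 + σ) (U t)) (hW : ∀ t ∈ I, IsSymbol (n + 1 + σ) (W t))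
    (hA : ∀ t ∈ I, ∀ ξ, ‖W t ξ‖ ≤ A * decay (n + 1 + σ) ξ)
    (hd : ∀ ξ, ∀ t ∈ I, HasDerivWithinAt (fun t => U t ξ) (W t ξ) I t) :
    HasSobolevTimeDeriv s I (fun t => phys (U t)) fun t => phys (W t) := by
  intro t ht
  have hsymb (τ : ℝ) (hτ : τ ∈ I) :
      IsSymbol (n + 1 + σ) fun ξ => (((τ - t)⁻¹ : ℝ) : ℂ) * (U τ ξ - U t ξ) :=
    ((hU τ hτ).sub (hU t ht)).const_mul _
  have hmem : ∀ᶠ τ in 𝓝[I \ {t}] t, τ ∈ I \ {t} := self_mem_nhdsWithin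
  have h := tendsto_sobolevENorm_phys hs (l := 𝓝[I \ {t}] t)
    (F := fun τ ξ => (((τ - t)⁻¹ : ℝ) : ℂ) * (U τ ξ - U t ξ) - W t ξ) (A := A + A)
    (by filter_upwards [hmem] with τ hτ using (hsymb τ hτ.1).sub (hW t ht))
    (by
      filter_upwards [hmem] with τ hτ ξ
      have hne : 0 < |τ - t| := abs_pos.2 (sub_ne_zero.2 hτ.2)
      have h1 : ‖U τ ξ - U t ξ‖ ≤ A * decay (n + 1 + σ) ξ * ‖τ - t‖ :=
        hI.norm_image_sub_le_of_norm_hasDerivWithin_le (hd ξ) (fun t ht => hA t ht ξ) ht hτ.1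
      rw [add_mul]
      refine (norm_sub_le _ _).trans (add_le_add ?_ (hA t ht ξ))
      rw [_root_.norm_mul, Complex.norm_real, Real.norm_eq_abs, abs_inv, inv_mul_le_iff₀ hne,
        mul_comm]
      exact h1)
    (fun ξ => by
      have h1 := (hasDerivWithinAt_iff_tendsto_slope.1 (hd ξ t ht)).sub_const (W t ξ)
      rw [sub_self] at h1
      refine h1.congr fun τ => ?_
      simp [slope, Complex.real_smul])
  refine h.congr' ?_
  filter_upwards [hmem] with τ hτ
  congr 1; ext x
  rw [phys_sub (by omega) (hsymb τ hτ.1) (hW t ht), phys_const_mul,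
    phys_sub (by omega) (hU τ hτ.1) (hU t ht), div_eq_inv_mul]

end Phys

/-! ### The damped oscillator `y'' + a y' + a² y = f` -/

section Oscillator

/-- The solution of `y'' + y' + y = 0` with `y(0) = 0` and `y'(0) = 1`. -/
noncomputable def oscPos (z : ℝ) : ℝ :=
  2 / √3 * (Real.exp (-z / 2) * Real.sin (√3 / 2 * z))

/-- The derivative of `oscPos`. -/
noncomputable def oscVel (z : ℝ) : ℝ :=
  Real.exp (-z / 2) * (Real.cos (√3 / 2 * z) - Real.sin (√3 / 2 * z) / √3)

lemma oscPos_zero : oscPos 0 = 0 := by simp [oscPos]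

lemma oscVel_zero : oscVel 0 = 1 := by simp [oscVel]

lemma continuous_oscPos : Continuous oscPos := by unfold oscPos; fun_prop

lemma continuous_oscVel : Continuous oscVel := by unfold oscVel; fun_prop

lemma hasDerivAt_oscPos (z : ℝ) : HasDerivAt oscPos (oscVel z) z := by
  have h1 : HasDerivAt (fun z : ℝ => Real.exp (-z / 2)) (Real.exp (-z / 2) * (-1 / 2)) z :=
    ((hasDerivAt_neg z).div_const 2).exp
  have h2 : HasDerivAt (fun z : ℝ => Real.sin (√3 / 2 * z))
      (Real.cos (√3 / 2 * z) * (√3 / 2 * 1)) z := ((hasDerivAt_id z).const_mul (√3 / 2)).sin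
  convert! (h1.mul h2).const_mul (2 / √3) using 1
  have h3 : √3 ≠ 0 := by positivity
  unfold oscVel
  field_simp
  ring

lemma hasDerivAt_oscVel (z : ℝ) : HasDerivAt oscVel (-oscVel z - oscPos z) z := by
  have h1 : HasDerivAt (fun z : ℝ => Real.exp (-z / 2)) (Real.exp (-z / 2) * (-1 / 2)) z :=
    ((hasDerivAt_neg z).div_const 2).exp
  have h2 : HasDerivAt (fun z : ℝ => Real.sin (√3 / 2 * z))
      (Real.cos (√3 / 2 * z) * (√3 / 2 * 1)) z := ((hasDerivAt_id z).const_mul (√3 / 2)).sin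
  have h2' : HasDerivAt (fun z : ℝ => Real.cos (√3 / 2 * z))
      (-Real.sin (√3 / 2 * z) * (√3 / 2 * 1)) z := ((hasDerivAt_id z).const_mul (√3 / 2)).cos
  convert! h1.mul (h2'.sub (h2.div_const √3)) using 1
  have h3 : √3 ≠ 0 := by positivity
  have h4 : √3 ^ 2 = 3 := Real.sq_sqrt (by norm_num)
  unfold oscVel oscPos
  simp only [Pi.sub_apply]
  field_simp
  linear_combination Real.sin (z * √3 / 2) * h4

/-- Translates of a solution of a second order linear equation are combinations of two fundamental
solutions. This separates `t` from `τ` in the Duhamel kernels. -/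
lemma oscVel_sub (z w : ℝ) :
    oscVel (z - w) = oscVel z * oscVel (-w) - oscPos z * oscPos (-w) := by
  have h3 : √3 ≠ 0 := by positivity
  have h4 : √3 ^ 2 = 3 := Real.sq_sqrt (by norm_num)
  unfold oscVel oscPos
  rw [show -(z - w) / 2 = -z / 2 + -(-w) / 2 by ring, Real.exp_add,
    show √3 / 2 * (z - w) = √3 / 2 * z + √3 / 2 * -w by ring, Real.cos_add, Real.sin_add]
  field_simp
  linear_combination -(Real.sin (z * √3 / 2) * Real.sin (-(w * √3 / 2))) * h4

lemma oscPos_sub (z w : ℝ) :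
    oscPos (z - w) = oscVel z * oscPos (-w) + oscPos z * (oscVel (-w) + oscPos (-w)) := by
  have h3 : √3 ≠ 0 := by positivity
  unfold oscVel oscPos
  rw [show -(z - w) / 2 = -z / 2 + -(-w) / 2 by ring, Real.exp_add,
    show √3 / 2 * (z - w) = √3 / 2 * z + √3 / 2 * -w by ring, Real.sin_add]
  field_simp
  ring

lemma abs_oscPos_le {z : ℝ} (hz : 0 ≤ z) : |oscPos z| ≤ 2 := by
  have h1 : (1 : ℝ) ≤ √3 := Real.one_le_sqrt.2 (by norm_num)
  have h2 : Real.exp (-z / 2) ≤ 1 := Real.exp_le_one_iff.2 (by linarith)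
  have h3 : 2 / √3 ≤ 2 := div_le_self (by norm_num) h1
  unfold oscPos
  rw [abs_mul, abs_mul, Real.abs_exp, abs_of_nonneg (by positivity : 0 ≤ 2 / √3)]
  have h4 : Real.exp (-z / 2) * |Real.sin (√3 / 2 * z)| ≤ 1 * 1 :=
    mul_le_mul h2 (Real.abs_sin_le_one _) (abs_nonneg _) zero_le_one
  have h5 := mul_le_mul h3 h4 (by positivity) (by norm_num)
  linarith

lemma abs_oscVel_le {z : ℝ} (hz : 0 ≤ z) : |oscVel z| ≤ 2 := by
  have h1 : (1 : ℝ) ≤ √3 := Real.one_le_sqrt.2 (by norm_num)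
  have h2 : Real.exp (-z / 2) ≤ 1 := Real.exp_le_one_iff.2 (by linarith)
  have h3 : |Real.cos (√3 / 2 * z) - Real.sin (√3 / 2 * z) / √3| ≤ 2 := by
    refine (abs_sub _ _).trans ?_
    rw [abs_div, abs_of_nonneg (by positivity : 0 ≤ √3)]
    have := Real.abs_cos_le_one (√3 / 2 * z)
    have : |Real.sin (√3 / 2 * z)| / √3 ≤ 1 :=
      div_le_one_of_le₀ ((Real.abs_sin_le_one _).trans h1) (by positivity)
    linarith
  unfold oscVel
  rw [abs_mul, Real.abs_exp]
  have h4 := mul_le_mul h2 h3 (abs_nonneg _) zero_le_one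
  linarith

/-- This measures the distance to the undamped limit `a = 0`, whose velocity kernel is the constant
`1`. The slope is `-oscVel - oscPos`, and both terms are at most `2` in absolute value. -/
lemma abs_oscVel_sub_one_le {z : ℝ} (hz : 0 ≤ z) : |oscVel z - 1| ≤ 4 * z := by
  have h := (convex_Ici (0 : ℝ)).norm_image_sub_le_of_norm_hasDerivWithin_le (C := 4)
    (fun x _ => (hasDerivAt_oscVel x).hasDerivWithinAt) (fun x hx => ?_)
    (mem_Ici.2 le_rfl) (mem_Ici.2 hz)
  · rwa [oscVel_zero, sub_zero, Real.norm_eq_abs, Real.norm_eq_abs, abs_of_nonneg hz] at h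
  · have h1 := abs_oscVel_le (mem_Ici.1 hx)
    have h2 := abs_oscPos_le (mem_Ici.1 hx)
    rw [Real.norm_eq_abs]
    have := abs_sub (-oscVel x) (oscPos x)
    rw [abs_neg] at this
    linarith

/-- The Duhamel integral of the forcing `f` with the kernel `k (a t)`. -/
noncomputable def duhamel (k : ℝ → ℝ) (a : ℝ) (f : ℝ → ℂ) (t : ℝ) : ℂ :=
  ∫ τ in (0 : ℝ)..t, (k (a * (t - τ)) : ℂ) * f τ

lemma continuous_kernel {k : ℝ → ℝ} (hk : Continuous k) (c : ℝ) {f : ℝ → ℂ} (hf : Continuous f) :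
    Continuous fun τ => (k (c * τ) : ℂ) * f τ := by fun_prop

/-- In this form the integral is differentiated by the product rule and the fundamental theorem of
calculus. It serves only for that: the factors at `-a * τ` grow exponentially in `a`, so bounds use
the original form. -/
lemma duhamel_oscVel_eq (a : ℝ) {f : ℝ → ℂ} (hf : Continuous f) (t : ℝ) :
    duhamel oscVel a f t =
      (oscVel (a * t) : ℂ) * (∫ τ in (0 : ℝ)..t, (oscVel (-a * τ) : ℂ) * f τ) -
      (oscPos (a * t) : ℂ) * ∫ τ in (0 : ℝ)..t, (oscPos (-a * τ) : ℂ) * f τ := by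
  have c1 := continuous_kernel continuous_oscVel (-a) hf
  have c2 := continuous_kernel continuous_oscPos (-a) hf
  rw [← intervalIntegral.integral_const_mul, ← intervalIntegral.integral_const_mul,
    ← intervalIntegral.integral_sub ((c1.const_mul _).intervalIntegrable _ _)
      ((c2.const_mul _).intervalIntegrable _ _)]
  unfold duhamel
  congr 1; ext τ
  rw [mul_sub, oscVel_sub, neg_mul]
  push_cast
  ring

lemma duhamel_oscPos_eq (a : ℝ) {f : ℝ → ℂ} (hf : Continuous f) (t : ℝ) :
    duhamel oscPos a f t =
      (oscVel (a * t) : ℂ) * (∫ τ in (0 : ℝ)..t, (oscPos (-a * τ) : ℂ) * f τ) +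
      (oscPos (a * t) : ℂ) * ((∫ τ in (0 : ℝ)..t, (oscVel (-a * τ) : ℂ) * f τ) +
        ∫ τ in (0 : ℝ)..t, (oscPos (-a * τ) : ℂ) * f τ) := by
  have c1 := continuous_kernel continuous_oscVel (-a) hf
  have c2 := continuous_kernel continuous_oscPos (-a) hf
  have c3 : Continuous fun τ => (oscVel (-a * τ) : ℂ) * f τ + (oscPos (-a * τ) : ℂ) * f τ :=
    c1.add c2
  rw [← intervalIntegral.integral_add (c1.intervalIntegrable _ _) (c2.intervalIntegrable _ _),
    ← intervalIntegral.integral_const_mul, ← intervalIntegral.integral_const_mul,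
    ← intervalIntegral.integral_add ((c2.const_mul _).intervalIntegrable _ _)
      ((c3.const_mul _).intervalIntegrable _ _)]
  unfold duhamel
  congr 1; ext τ
  rw [mul_sub, oscPos_sub, neg_mul]
  push_cast
  ring

lemma hasDerivAt_integral_of_continuous {f : ℝ → ℂ} (hf : Continuous f) (t : ℝ) :
    HasDerivAt (fun t => ∫ τ in (0 : ℝ)..t, f τ) (f t) t :=
  (hf.integral_hasStrictDerivAt 0 t).hasDerivAt

lemma hasDerivAt_oscVel_mul (a t : ℝ) : HasDerivAt (fun t : ℝ => (oscVel (a * t) : ℂ))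
    ((a : ℂ) * (-(oscVel (a * t) : ℂ) - oscPos (a * t))) t := by
  have h := ((hasDerivAt_oscVel (a * t)).scomp t ((hasDerivAt_id t).const_mul a)).ofReal_comp
  convert! h using 1
  simp

lemma hasDerivAt_oscPos_mul (a t : ℝ) : HasDerivAt (fun t : ℝ => (oscPos (a * t) : ℂ))
    ((a : ℂ) * oscVel (a * t)) t := by
  have h := ((hasDerivAt_oscPos (a * t)).scomp t ((hasDerivAt_id t).const_mul a)).ofReal_comp
  convert! h using 1
  simp

lemma hasDerivAt_duhamel_oscVel (a : ℝ) {f : ℝ → ℂ} (hf : Continuous f) (t : ℝ) :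
    HasDerivAt (duhamel oscVel a f)
      (f t - a * (duhamel oscVel a f t + duhamel oscPos a f t)) t := by
  have d1 := hasDerivAt_integral_of_continuous (continuous_kernel continuous_oscVel (-a) hf) t
  have d2 := hasDerivAt_integral_of_continuous (continuous_kernel continuous_oscPos (-a) hf) t
  have h := ((hasDerivAt_oscVel_mul a t).mul d1).sub ((hasDerivAt_oscPos_mul a t).mul d2)
  have e := oscVel_sub (a * t) (a * t)
  rw [sub_self, oscVel_zero, ← neg_mul] at e
  have e' : (oscVel (a * t) : ℂ) * oscVel (-a * t) =
      1 + oscPos (a * t) * oscPos (-a * t) := by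
    exact_mod_cast (by linarith : oscVel (a * t) * oscVel (-a * t) =
      1 + oscPos (a * t) * oscPos (-a * t))
  convert! h using 1
  · exact funext (duhamel_oscVel_eq a hf)
  · rw [duhamel_oscVel_eq a hf, duhamel_oscPos_eq a hf]
    linear_combination -f t * e'

lemma hasDerivAt_duhamel_oscPos (a : ℝ) {f : ℝ → ℂ} (hf : Continuous f) (t : ℝ) :
    HasDerivAt (duhamel oscPos a f) (a * duhamel oscVel a f t) t := by
  have d1 := hasDerivAt_integral_of_continuous (continuous_kernel continuous_oscVel (-a) hf) t
  have d2 := hasDerivAt_integral_of_continuous (continuous_kernel continuous_oscPos (-a) hf) t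
  have h := ((hasDerivAt_oscVel_mul a t).mul d2).add
    ((hasDerivAt_oscPos_mul a t).mul (d1.add d2))
  have e := oscPos_sub (a * t) (a * t)
  rw [sub_self, oscPos_zero, ← neg_mul] at e
  have e' : (oscVel (a * t) : ℂ) * oscPos (-a * t) +
      oscPos (a * t) * (oscVel (-a * t) + oscPos (-a * t)) = 0 := by exact_mod_cast e.symm
  convert! h using 1
  · exact funext (duhamel_oscPos_eq a hf)
  · rw [duhamel_oscVel_eq a hf]
    simp only [Pi.add_apply]
    linear_combination -f t * e'

/-- The velocity of the oscillator `y'' + a y' + a² y = -f` with `y(0) = y₀` and `y'(0) = 0`. -/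
noncomputable def forcedVel (a : ℝ) (y₀ : ℂ) (f : ℝ → ℂ) (t : ℝ) : ℂ :=
  -(a * oscPos (a * t)) * y₀ - duhamel oscVel a f t

lemma continuous_forcedVel (a : ℝ) (y₀ : ℂ) {f : ℝ → ℂ} (hf : Continuous f) :
    Continuous (forcedVel a y₀ f) := by
  have h : Continuous (duhamel oscVel a f) :=
    continuous_iff_continuousAt.2 fun t => (hasDerivAt_duhamel_oscVel a hf t).continuousAt
  have := continuous_oscPos
  unfold forcedVel
  fun_prop

/-- Both sides agree at `t = 0` and have the same derivative. The factor `a` is kept because the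
position itself would involve `oscPos (a t) / a`, which is meaningless at zero frequency; for the
same reason the velocity is the primary unknown throughout. -/
lemma mul_integral_forcedVel (a : ℝ) (y₀ : ℂ) {f : ℝ → ℂ} (hf : Continuous f) (t : ℝ) :
    (a : ℂ) * (y₀ + ∫ τ in (0 : ℝ)..t, forcedVel a y₀ f τ) =
      a * (oscVel (a * t) + oscPos (a * t)) * y₀ - duhamel oscPos a f t := by
  set H : ℝ → ℂ := fun t => (a : ℂ) * (y₀ + ∫ τ in (0 : ℝ)..t, forcedVel a y₀ f τ) -
    (a * (oscVel (a * t) + oscPos (a * t)) * y₀ - duhamel oscPos a f t) with hH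
  have hd (t : ℝ) : HasDerivAt H 0 t := by
    have h1 := ((hasDerivAt_integral_of_continuous
      (continuous_forcedVel a y₀ hf) t).const_add y₀).const_mul (a : ℂ)
    have h2 := ((((hasDerivAt_oscVel_mul a t).add (hasDerivAt_oscPos_mul a t)).const_mul
      (a : ℂ)).mul_const y₀).sub (hasDerivAt_duhamel_oscPos a hf t)
    convert! h1.sub h2 using 1
    unfold forcedVel
    ring
  have h0 := is_const_of_deriv_eq_zero (fun t => (hd t).differentiableAt)
    (fun t => (hd t).deriv) t 0
  have h1 : H 0 = 0 := by simp [hH, oscVel_zero, oscPos_zero, duhamel]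
  rw [h1] at h0
  exact sub_eq_zero.1 h0

lemma hasDerivAt_forcedVel (a : ℝ) (y₀ : ℂ) {f : ℝ → ℂ} (hf : Continuous f) (t : ℝ) :
    HasDerivAt (forcedVel a y₀ f) (-(a * forcedVel a y₀ f t) -
      a ^ 2 * (y₀ + ∫ τ in (0 : ℝ)..t, forcedVel a y₀ f τ) - f t) t := by
  have h1 := (((hasDerivAt_oscPos_mul a t).const_mul (a : ℂ)).neg.mul_const y₀).sub
    (hasDerivAt_duhamel_oscVel a hf t)
  convert! h1 using 1
  rw [sq, mul_assoc, mul_integral_forcedVel a y₀ hf]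
  unfold forcedVel
  ring

lemma forcedVel_zero (a : ℝ) (y₀ : ℂ) (f : ℝ → ℂ) : forcedVel a y₀ f 0 = 0 := by
  simp [forcedVel, oscPos_zero, duhamel]

end Oscillator

/-! ### The equation for the Fourier transform -/

/-- In the norm with weight `exp (l t)`, integration in time has size `1 / l`. This turns a
Lipschitz bound on a long interval into a contraction. -/
lemma norm_integral_le_exp {f : ℝ → ℂ} {c l t : ℝ} (hl : 0 < l) (ht : 0 ≤ t)
    (hf : ∀ τ ∈ Icc 0 t, ‖f τ‖ ≤ c * Real.exp (l * τ)) :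
    ‖∫ τ in (0 : ℝ)..t, f τ‖ ≤ c * Real.exp (l * t) / l := by
  have hc : 0 ≤ c := by
    have := (norm_nonneg _).trans (hf 0 ⟨le_rfl, ht⟩)
    simpa using this
  have hint : ∫ τ in (0 : ℝ)..t, c * Real.exp (l * τ) = c * (Real.exp (l * t) - 1) / l := by
    rw [intervalIntegral.integral_const_mul, intervalIntegral.integral_comp_mul_left
      (fun x => Real.exp x) hl.ne', integral_exp]
    simp; ring
  calc _ ≤ ∫ τ in (0 : ℝ)..t, c * Real.exp (l * τ) :=
        intervalIntegral.norm_integral_le_of_norm_le ht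
          (Eventually.of_forall fun τ hτ => hf τ (Ioc_subset_Icc_self hτ))
          (Continuous.intervalIntegrable (by fun_prop) _ _)
    _ ≤ _ := by
        rw [hint]
        gcongr
        linarith

lemma continuous_integral_field {E : Type*} [TopologicalSpace E]
    {D : ℝ → E → ℂ} (hD : Continuous fun z : ℝ × E => D z.1 z.2)
    {Y : Type*} [TopologicalSpace Y] [FirstCountableTopology Y] {s : Y → ℝ} {x : Y → E}
    (hs : Continuous s) (hx : Continuous x) :
    Continuous fun y => ∫ τ in (0 : ℝ)..s y, D τ (x y) :=
  intervalIntegral.continuous_parametric_intervalIntegral_of_continuous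
    (f := fun y τ => D τ (x y)) (by
      show Continuous fun p : Y × ℝ => D p.2 (x p.1)
      exact hD.comp (continuous_snd.prodMk (hx.comp continuous_fst))) hs

lemma norm_integral_field_le {E : Type*} [NormedAddCommGroup E] {D : ℝ → E → ℂ}
    {N : ℕ} {T l : ℝ} (hl : 1 ≤ l) {R : ℝ} {t : ℝ} (ht : t ∈ Icc 0 T) {ξ : E}
    (hDR : ∀ τ ∈ Icc 0 T, ‖D τ ξ‖ ≤ R * Real.exp (l * τ) * decay N ξ) :
    ‖∫ τ in (0 : ℝ)..t, D τ ξ‖ ≤ R * Real.exp (l * t) / l * decay N ξ := by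
  refine (norm_integral_le_exp (c := R * decay N ξ) (l := l) (by linarith) ht.1
    fun τ hτ => ?_).trans (le_of_eq (by ring))
  exact (hDR τ ⟨hτ.1, hτ.2.trans ht.2⟩).trans (le_of_eq (by ring))

lemma HermitianSymm.intervalIntegral {E : Type*} [NormedAddCommGroup E] {D : ℝ → E → ℂ}
    (hD : ∀ t, HermitianSymm (D t)) (s : ℝ) (ξ : E) :
    ∫ τ in (0 : ℝ)..s, D τ (-ξ) = starRingEnd ℂ (∫ τ in (0 : ℝ)..s, D τ ξ) := by
  simp only [hD _ ξ]
  exact intervalIntegral.intervalIntegral_conj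

/-- The projection of the real line to `[0, T]`. -/
def clampTime (T t : ℝ) : ℝ := max 0 (min t T)

lemma continuous_clampTime (T : ℝ) : Continuous (clampTime T) := by
  unfold clampTime; fun_prop

lemma clampTime_mem {T : ℝ} (hT : 0 ≤ T) (t : ℝ) : clampTime T t ∈ Icc 0 T :=
  ⟨le_max_left _ _, max_le hT (min_le_right _ _)⟩

lemma clampTime_of_mem {T t : ℝ} (ht : t ∈ Icc 0 T) : clampTime T t = t := by
  unfold clampTime; rw [min_eq_left ht.2, max_eq_right ht.1]

/-- The Fourier transform of the position at the clamped time, when its velocity differs by `D`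
from the one of `Ψ`. -/
noncomputable def posOf {E : Type*} (T : ℝ) (Ψ D : ℝ → E → ℂ) (t : ℝ) (ξ : E) : ℂ :=
  Ψ (clampTime T t) ξ + ∫ τ in (0 : ℝ)..clampTime T t, D τ ξ

lemma posOf_zero {E : Type*} {T : ℝ} {Ψ : ℝ → E → ℂ} (t : ℝ) : posOf T Ψ (fun _ _ => 0) t = Ψ (clampTime T t) := by
  ext ξ; simp [posOf]

/-! ### Comparison of the damped oscillators with the limit equation -/

section ViscousSymbol

variable {E : Type*} [NormedAddCommGroup E] [InnerProductSpace ℝ E] [FiniteDimensional ℝ E]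
  [MeasurableSpace E] [BorelSpace E]

/-- `Ψ`, with time derivative `Ψt`, is the Fourier transform of a solution of
`ψ_tt + ψ ^ (q + 1) = 0` with zero initial velocity, and decays. -/
structure LimitSymbol (q N : ℕ) (B : ℝ) (J : ℕ) (Ψ Ψt : ℝ → E → ℂ) : Prop where
  continuous : Continuous fun z : ℝ × E => Ψ z.1 z.2
  symm : ∀ t, HermitianSymm (Ψ t)
  hasDerivAt : ∀ t ξ, HasDerivAt (fun τ => Ψ τ ξ) (Ψt t ξ) t
  hasDerivAt_vel : ∀ t ξ, HasDerivAt (fun τ => Ψt τ ξ) (-cpow (Ψ t) q ξ) t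
  vel_zero : ∀ ξ, Ψt 0 ξ = 0
  one_le : 1 ≤ B
  bound : ∀ t, 0 ≤ t → ∀ ξ, ‖Ψ t ξ‖ ≤ B * (1 + t) ^ J * decay (N + 1) ξ
  bound_cpow : ∀ t, 0 ≤ t → ∀ ξ, ‖cpow (Ψ t) q ξ‖ ≤ B * (1 + t) ^ J * decay (N + 1) ξ

/-- The Fourier transform of the nonlinearity at `posOf T Ψ D`. -/
noncomputable def forceOf (q : ℕ) (T : ℝ) (Ψ D : ℝ → E → ℂ) (t : ℝ) (ξ : E) : ℂ :=
  cpow (posOf T Ψ D t) q ξ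

/-- The velocity of the damped oscillators driven by `forceOf q T Ψ D`. -/
noncomputable def velOf (q : ℕ) (T ν : ℝ) (Ψ D : ℝ → E → ℂ) (t : ℝ) (ξ : E) : ℂ :=
  forcedVel (ν * (2 * Real.pi * ‖ξ‖)) (Ψ 0 ξ) (fun τ => forceOf q T Ψ D τ ξ) t

section

variable {q N J : ℕ} {B T ν l : ℝ} {Ψ Ψt D D₁ D₂ : ℝ → E → ℂ}

lemma LimitSymbol.bound_le (h : LimitSymbol q N B J Ψ Ψt) {t : ℝ} (ht : t ∈ Icc 0 T) (ξ : E) :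
    ‖Ψ t ξ‖ ≤ B * (1 + T) ^ J * decay N ξ := by
  have h1 := h.one_le
  have h2 := ht.1
  have h3 := ht.2
  refine (h.bound t ht.1 ξ).trans ?_
  have := decay_antitone (Nat.le_succ N) ξ
  have := (decay_pos (N + 1) ξ).le
  have : 0 ≤ B * (1 + T) ^ J := mul_nonneg (by linarith) (pow_nonneg (by linarith) J)
  gcongr

lemma continuous_posOf (h : LimitSymbol q N B J Ψ Ψt)
    (hD : Continuous fun z : ℝ × E => D z.1 z.2) :
    Continuous fun z : ℝ × E => posOf T Ψ D z.1 z.2 := by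
  have hκ : Continuous fun z : ℝ × E => clampTime T z.1 :=
    (continuous_clampTime T).comp continuous_fst
  exact (h.continuous.comp (hκ.prodMk continuous_snd)).add
    (continuous_integral_field hD hκ continuous_snd)

lemma norm_posOf_le (h : LimitSymbol q N B J Ψ Ψt) (hT : 0 ≤ T) (hl : 1 ≤ l) {R : ℝ} (hR : 0 ≤ R)
    (hDR : ∀ τ ∈ Icc 0 T, ∀ ξ, ‖D τ ξ‖ ≤ R * Real.exp (l * τ) * decay N ξ) (t : ℝ) (ξ : E) :
    ‖posOf T Ψ D t ξ‖ ≤ (B * (1 + T) ^ J + R * Real.exp (l * T)) * decay N ξ := by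
  have hκ := clampTime_mem hT t
  rw [add_mul]
  refine (norm_add_le _ _).trans (add_le_add (h.bound_le hκ ξ) ?_)
  refine (norm_integral_field_le hl hκ fun τ hτ => hDR τ hτ ξ).trans ?_
  refine mul_le_mul_of_nonneg_right ?_ (decay_pos _ _).le
  refine (div_le_self (by positivity) hl).trans ?_
  have := hκ.2
  gcongr

lemma continuous_forceOf (hN : Module.finrank ℝ E < N) (h : LimitSymbol q N B J Ψ Ψt)
    (hD : Continuous fun z : ℝ × E => D z.1 z.2) {A : ℝ}
    (hA : ∀ t ξ, ‖posOf T Ψ D t ξ‖ ≤ A * decay N ξ) :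
    Continuous fun z : ℝ × E => forceOf q T Ψ D z.1 z.2 :=
  continuous_cpow hN (continuous_posOf h hD) hA q

lemma continuous_velOf (h : LimitSymbol q N B J Ψ Ψt)
    (hF : Continuous fun z : ℝ × E => forceOf q T Ψ D z.1 z.2) :
    Continuous fun z : ℝ × E => velOf q T ν Ψ D z.1 z.2 := by
  have hΨ : Continuous fun z : ℝ × E => Ψ 0 z.2 :=
    h.continuous.comp (continuous_const.prodMk continuous_snd)
  have h1 := continuous_oscPos
  have h2 := continuous_oscVel
  unfold velOf forcedVel
  refine Continuous.sub (Continuous.mul ?_ hΨ) ?_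
  · fun_prop
  · unfold duhamel
    refine intervalIntegral.continuous_parametric_intervalIntegral_of_continuous
      (f := fun (z : ℝ × E) τ => (oscVel (ν * (2 * Real.pi * ‖z.2‖) * (z.1 - τ)) : ℂ) *
        forceOf q T Ψ D τ z.2) ?_ continuous_fst
    refine Continuous.mul ?_ (hF.comp (continuous_snd.prodMk (continuous_snd.comp continuous_fst)))
    show Continuous fun p : (ℝ × E) × ℝ =>
      (oscVel (ν * (2 * Real.pi * ‖p.1.2‖) * (p.1.1 - p.2)) : ℂ)
    fun_prop

/-- There are two gains of `1 / l`: one from integrating the velocity to the position, one from the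
Duhamel integral. In between stands the Lipschitz constant of the convolution power; the `2` bounds
the kernel uniformly in the frequency. -/
lemma norm_velOf_sub_le (hN : Module.finrank ℝ E < N) (h : LimitSymbol q N B J Ψ Ψt)
    (hν : 0 ≤ ν) (hl : 1 ≤ l)
    (hD₁ : Continuous fun z : ℝ × E => D₁ z.1 z.2) (hD₂ : Continuous fun z : ℝ × E => D₂ z.1 z.2)
    {A ε : ℝ} (hA₁ : ∀ t ξ, ‖posOf T Ψ D₁ t ξ‖ ≤ A * decay N ξ)
    (hA₂ : ∀ t ξ, ‖posOf T Ψ D₂ t ξ‖ ≤ A * decay N ξ)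
    (hε : ∀ τ ∈ Icc 0 T, ∀ ξ, ‖D₁ τ ξ - D₂ τ ξ‖ ≤ ε * Real.exp (l * τ) * decay N ξ)
    {t : ℝ} (ht : t ∈ Icc 0 T) (ξ : E) :
    ‖velOf q T ν Ψ D₁ t ξ - velOf q T ν Ψ D₂ t ξ‖ ≤
      2 * ((q + 1) * convConst E N ^ q * A ^ q) / l ^ 2 * ε * Real.exp (l * t) * decay N ξ := by
  set L : ℝ := (q + 1) * convConst E N ^ q * A ^ q with hL
  have c₁ := continuous_forceOf hN h hD₁ hA₁
  have c₂ := continuous_forceOf hN h hD₂ hA₂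
  have i₁ (ξ : E) : Continuous fun τ => D₁ τ ξ := hD₁.comp (Continuous.prodMk_left ξ)
  have i₂ (ξ : E) : Continuous fun τ => D₂ τ ξ := hD₂.comp (Continuous.prodMk_left ξ)
  have f₁ : Continuous fun τ => forceOf q T Ψ D₁ τ ξ := c₁.comp (Continuous.prodMk_left ξ)
  have f₂ : Continuous fun τ => forceOf q T Ψ D₂ τ ξ := c₂.comp (Continuous.prodMk_left ξ)
  have p₁ (τ : ℝ) : Continuous (posOf T Ψ D₁ τ) :=
    (continuous_posOf h hD₁).comp (Continuous.prodMk_right τ)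
  have p₂ (τ : ℝ) : Continuous (posOf T Ψ D₂ τ) :=
    (continuous_posOf h hD₂).comp (Continuous.prodMk_right τ)
  have hpos (τ : ℝ) (hτ : τ ∈ Icc 0 T) (η : E) :
      ‖posOf T Ψ D₁ τ η - posOf T Ψ D₂ τ η‖ ≤ (ε * Real.exp (l * τ) / l) * decay N η := by
    have e : posOf T Ψ D₁ τ η - posOf T Ψ D₂ τ η =
        ∫ σ in (0 : ℝ)..τ, (fun σ η => D₁ σ η - D₂ σ η) σ η := by
      simp only [posOf, clampTime_of_mem hτ]
      rw [intervalIntegral.integral_sub ((i₁ η).intervalIntegrable _ _)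
        ((i₂ η).intervalIntegrable _ _)]
      ring
    rw [e]
    exact norm_integral_field_le (D := fun σ η => D₁ σ η - D₂ σ η) hl hτ fun σ hσ => hε σ hσ η
  have hforce (τ : ℝ) (hτ : τ ∈ Icc 0 T) :
      ‖forceOf q T Ψ D₁ τ ξ - forceOf q T Ψ D₂ τ ξ‖ ≤
        L * (ε * Real.exp (l * τ) / l) * decay N ξ :=
    norm_cpow_sub_cpow_le hN (p₁ τ) (p₂ τ) (hA₁ τ) (hA₂ τ) (hpos τ hτ) q ξ
  have hm : Continuous fun τ => (oscVel (ν * (2 * Real.pi * ‖ξ‖) * (t - τ)) : ℂ) := by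
    have := continuous_oscVel
    fun_prop
  have e : velOf q T ν Ψ D₁ t ξ - velOf q T ν Ψ D₂ t ξ =
      -∫ τ in (0 : ℝ)..t, (oscVel (ν * (2 * Real.pi * ‖ξ‖) * (t - τ)) : ℂ) *
        (forceOf q T Ψ D₁ τ ξ - forceOf q T Ψ D₂ τ ξ) := by
    have := intervalIntegral.integral_sub ((hm.mul f₁).intervalIntegrable (μ := volume) 0 t)
      ((hm.mul f₂).intervalIntegrable 0 t)
    simp only [Pi.mul_apply, ← mul_sub] at this
    simp only [velOf, forcedVel, duhamel]
    rw [this]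
    ring
  rw [e, norm_neg]
  refine (norm_integral_le_exp (c := 2 * (L * ε / l * decay N ξ)) (l := l) (by linarith) ht.1
    fun τ hτ => ?_).trans (le_of_eq (by ring))
  rw [_root_.norm_mul, Complex.norm_real, Real.norm_eq_abs]
  have ha : 0 ≤ ν * (2 * Real.pi * ‖ξ‖) * (t - τ) :=
    mul_nonneg (by positivity) (by linarith [hτ.2])
  calc _ ≤ 2 * (L * (ε * Real.exp (l * τ) / l) * decay N ξ) :=
        mul_le_mul (abs_oscVel_le ha) (hforce τ ⟨hτ.1, hτ.2.trans ht.2⟩) (norm_nonneg _)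
          (by norm_num)
    _ = _ := by ring

lemma continuous_forceOf_zero (hN : Module.finrank ℝ E < N) (h : LimitSymbol q N B J Ψ Ψt)
    (hT : 0 ≤ T) : Continuous fun z : ℝ × E => forceOf q T Ψ (fun _ _ => 0) z.1 z.2 :=
  continuous_forceOf hN h continuous_const (A := B * (1 + T) ^ J) fun t ξ => by
    rw [posOf_zero]; exact h.bound_le (clampTime_mem hT t) ξ

lemma LimitSymbol.vel_eq_integral (hN : Module.finrank ℝ E < N) (h : LimitSymbol q N B J Ψ Ψt)
    (hT : 0 ≤ T) {t : ℝ} (ht : t ∈ Icc 0 T) (ξ : E) :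
    Ψt t ξ = -∫ τ in (0 : ℝ)..t, forceOf q T Ψ (fun _ _ => 0) τ ξ := by
  have c : Continuous fun τ => -forceOf q T Ψ (fun _ _ => 0) τ ξ :=
    ((continuous_forceOf_zero hN h hT).comp (Continuous.prodMk_left ξ)).neg
  have := intervalIntegral.integral_eq_sub_of_hasDerivAt (a := 0) (b := t)
    (f := fun τ => Ψt τ ξ) (f' := fun τ => -forceOf q T Ψ (fun _ _ => 0) τ ξ) (fun τ hτ => ?_)
    (c.intervalIntegrable _ _)
  · rw [intervalIntegral.integral_neg, h.vel_zero, sub_zero] at this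
    exact this.symm
  · rw [uIcc_of_le ht.1] at hτ
    rw [forceOf, posOf_zero, clampTime_of_mem ⟨hτ.1, hτ.2.trans ht.2⟩]
    exact h.hasDerivAt_vel τ ξ

/-- The consistency error, the only source of the factor `ν`. Both velocities are driven by the same
force and differ by the kernel error `oscVel - 1` and the term of the initial position, each of size
`a = 2πν‖ξ‖`. The factor `‖ξ‖` is why `LimitSymbol` asks for decay of order `N + 1`. -/
lemma norm_velOf_zero_sub_le (hN : Module.finrank ℝ E < N) (h : LimitSymbol q N B J Ψ Ψt)
    (hν : 0 ≤ ν) {t : ℝ} (ht : t ∈ Icc 0 T) (ξ : E) :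
    ‖velOf q T ν Ψ (fun _ _ => 0) t ξ - Ψt t ξ‖ ≤
      ν * (28 * B * (1 + T) ^ (J + 2)) * decay N ξ := by
  have hT : 0 ≤ T := ht.1.trans ht.2
  set a : ℝ := ν * (2 * Real.pi * ‖ξ‖) with ha
  have ha0 : 0 ≤ a := by positivity
  have hB := h.one_le
  have hd := (decay_pos (N + 1) ξ).le
  have had : a * decay (N + 1) ξ ≤ 7 * ν * decay N ξ := by
    have h1 : 2 * Real.pi ≤ 7 := by linarith [Real.pi_lt_d2]
    calc a * decay (N + 1) ξ = ν * (2 * Real.pi) * (‖ξ‖ * decay (N + 1) ξ) := by rw [ha]; ring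
      _ ≤ ν * 7 * decay N ξ := by
          gcongr
          exact norm_mul_decay_succ_le N ξ
      _ = _ := by ring
  have f : Continuous fun τ => forceOf q T Ψ (fun _ _ => 0) τ ξ :=
    (continuous_forceOf_zero hN h hT).comp (Continuous.prodMk_left ξ)
  have hm : Continuous fun τ => (oscVel (a * (t - τ)) : ℂ) := by
    have := continuous_oscVel
    fun_prop
  have e : velOf q T ν Ψ (fun _ _ => 0) t ξ - Ψt t ξ = -((a * oscPos (a * t) : ℝ) : ℂ) * Ψ 0 ξ +
      -∫ τ in (0 : ℝ)..t, ((oscVel (a * (t - τ)) - 1 : ℝ) : ℂ) *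
        forceOf q T Ψ (fun _ _ => 0) τ ξ := by
    rw [h.vel_eq_integral hN hT ht]
    have := intervalIntegral.integral_sub ((hm.mul f).intervalIntegrable (μ := volume) 0 t)
      (f.intervalIntegrable 0 t)
    simp only [Pi.mul_apply] at this
    simp only [velOf, forcedVel, duhamel, ← ha]
    push_cast
    simp only [sub_mul, one_mul]
    rw [this]
    ring
  have h1 : ‖-((a * oscPos (a * t) : ℝ) : ℂ) * Ψ 0 ξ‖ ≤ a * 2 * (B * decay (N + 1) ξ) := by
    rw [_root_.norm_mul, norm_neg, Complex.norm_real, Real.norm_eq_abs, abs_mul,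
      abs_of_nonneg ha0]
    have := h.bound 0 le_rfl ξ
    simp only [add_zero, one_pow, mul_one] at this
    have := abs_oscPos_le (mul_nonneg ha0 ht.1)
    gcongr
  have h2 : ‖∫ τ in (0 : ℝ)..t, ((oscVel (a * (t - τ)) - 1 : ℝ) : ℂ) *
      forceOf q T Ψ (fun _ _ => 0) τ ξ‖ ≤
        (4 * (a * T) * (B * (1 + T) ^ J * decay (N + 1) ξ)) * |t - 0| := by
    refine intervalIntegral.norm_integral_le_of_norm_le_const fun τ hτ => ?_
    rw [uIoc_of_le ht.1] at hτ
    have hτT : τ ≤ T := hτ.2.trans ht.2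
    have hτ0 := hτ.1.le
    rw [_root_.norm_mul, Complex.norm_real, Real.norm_eq_abs]
    have h3 : |oscVel (a * (t - τ)) - 1| ≤ 4 * (a * T) := by
      refine (abs_oscVel_sub_one_le (mul_nonneg ha0 (by linarith [hτ.2]))).trans ?_
      have : t - τ ≤ T := by linarith [ht.2]
      gcongr
    have h4 : ‖forceOf q T Ψ (fun _ _ => 0) τ ξ‖ ≤ B * (1 + T) ^ J * decay (N + 1) ξ := by
      rw [forceOf, posOf_zero, clampTime_of_mem ⟨hτ0, hτT⟩]
      refine (h.bound_cpow τ hτ0 ξ).trans ?_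
      gcongr
    exact mul_le_mul h3 h4 (norm_nonneg _) (by positivity)
  rw [e]
  refine (norm_add_le _ _).trans ?_
  rw [norm_neg (∫ τ in (0 : ℝ)..t, _)]
  refine (add_le_add h1 h2).trans ?_
  rw [sub_zero, abs_of_nonneg ht.1]
  have h5 : (1 : ℝ) ≤ (1 + T) ^ J := one_le_pow₀ (by linarith)
  have had0 : 0 ≤ a * decay (N + 1) ξ := mul_nonneg ha0 hd
  calc a * 2 * (B * decay (N + 1) ξ) + 4 * (a * T) * (B * (1 + T) ^ J * decay (N + 1) ξ) * t
      = (a * decay (N + 1) ξ) * (B * (2 * 1 + 4 * T * t * (1 + T) ^ J)) := by ring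
    _ ≤ (a * decay (N + 1) ξ) * (B * (2 * (1 + T) ^ J + 4 * T * T * (1 + T) ^ J)) := by
        have := ht.2
        gcongr
    _ = (a * decay (N + 1) ξ) * (B * (1 + T) ^ J * (2 + 4 * T * T)) := by ring
    -- The constant `28` is `7 * 4`, with `7` from `2π ≤ 7`.
    _ ≤ (7 * ν * decay N ξ) * (B * (1 + T) ^ J * (4 * (1 + T) ^ 2)) := by
        have : 0 ≤ 7 * ν * decay N ξ := had0.trans had
        have : 2 + 4 * T * T ≤ 4 * (1 + T) ^ 2 := by nlinarith
        gcongr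
    _ = _ := by ring

lemma HermitianSymm.velOf (h : LimitSymbol q N B J Ψ Ψt) (hD : ∀ t, HermitianSymm (D t)) (t : ℝ) :
    HermitianSymm (velOf q T ν Ψ D t) := by
  have hpos (τ : ℝ) : HermitianSymm (posOf T Ψ D τ) := fun ξ => by
    simp only [posOf, map_add]
    rw [h.symm, HermitianSymm.intervalIntegral hD]
  have hforce (τ : ℝ) : HermitianSymm (forceOf q T Ψ D τ) := (hpos τ).cpow q
  intro ξ
  have h2 := HermitianSymm.intervalIntegral
    (D := fun τ ξ => (oscVel (ν * (2 * Real.pi * ‖ξ‖) * (t - τ)) : ℂ) * forceOf q T Ψ D τ ξ)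
    (fun τ ξ => by
      show _ * forceOf q T Ψ D τ (-ξ) = _
      rw [map_mul, Complex.conj_ofReal, hforce, norm_neg]) t ξ
  simp only [_root_.velOf, forcedVel, duhamel, map_sub, map_mul, map_neg, Complex.conj_ofReal]
  rw [← h.symm, ← h2]
  simp only [norm_neg]

lemma LimitSymbol.vel_symm (h : LimitSymbol q N B J Ψ Ψt) (t : ℝ) : HermitianSymm (Ψt t) := by
  intro ξ
  have h1 := h.hasDerivAt t (-ξ)
  have h2 := (h.hasDerivAt t ξ).star
  simp only [h.symm _ ξ] at h1
  exact h1.unique h2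

end

end ViscousSymbol

/-! ### The contraction for the difference of the velocities -/

section ViscousSolution

open scoped BoundedContinuousFunction

variable {E : Type*} [NormedAddCommGroup E] [InnerProductSpace ℝ E] [FiniteDimensional ℝ E]
  [MeasurableSpace E] [BorelSpace E] {q N J : ℕ} {B T ν : ℝ} {Ψ Ψt : ℝ → E → ℂ}

/-- The map `D ↦ velOf D - Ψt` contracts the ball of radius `R`. The smallness of `R exp (l T)`
keeps positions below `B (1 + T) ^ J + 1`, so the Lipschitz constant is `l / 2` and the contraction
factor is `l / l² ≤ 1 / 2`. The image of `0` has norm at most `R / 2`, so the ball is mapped to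
itself. -/
lemma LimitSymbol.exists_fixedPoint (hN : Module.finrank ℝ E < N) (h : LimitSymbol q N B J Ψ Ψt)
    (hT : 0 ≤ T) (hν : 0 ≤ ν) {l R : ℝ}
    (hl : l = 2 * ((q + 1) * convConst E N ^ q * (B * (1 + T) ^ J + 1) ^ q))
    (hR : R = 2 * (ν * (28 * B * (1 + T) ^ (J + 2)))) (hsmall : R * Real.exp (l * T) ≤ 1) :
    ∃ D : ℝ → E → ℂ, Continuous (fun z : ℝ × E => D z.1 z.2) ∧ (∀ t, HermitianSymm (D t)) ∧
      (∀ t ∈ Icc 0 T, ∀ ξ, ‖D t ξ‖ ≤ R * Real.exp (l * t) * decay N ξ) ∧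
      ∀ t ∈ Icc 0 T, ∀ ξ, velOf q T ν Ψ D t ξ - Ψt t ξ = D t ξ := by
  have hB := h.one_le
  have hC := one_le_convConst (E := E) N
  have hA1 : 1 ≤ B * (1 + T) ^ J + 1 := by
    have : 0 ≤ B * (1 + T) ^ J := by positivity
    linarith
  have hL1 : 1 ≤ (q + 1) * convConst E N ^ q * (B * (1 + T) ^ J + 1) ^ q := by
    have h1 := one_le_pow₀ hC (n := q)
    have h2 := one_le_pow₀ hA1 (n := q)
    have h3 : (1 : ℝ) ≤ q + 1 := by linarith [Nat.cast_nonneg (α := ℝ) q]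
    exact one_le_mul_of_one_le_of_one_le (one_le_mul_of_one_le_of_one_le h3 h1) h2
  have hl1 : 1 ≤ l := by linarith
  have hR0 : 0 ≤ R := by rw [hR]; positivity
  -- The unknown is written as `w` times a bounded continuous function, so that the weighted norm
  -- becomes the sup norm of a complete space. Clamping the time lets the functions live on all of
  -- `ℝ × E`.
  set w : ℝ × E → ℝ := fun z => Real.exp (l * clampTime T z.1) * decay N z.2 with hw
  have hκ : Continuous fun z : ℝ × E => clampTime T z.1 :=
    (continuous_clampTime T).comp continuous_fst
  have hw0 (z : ℝ × E) : 0 < w z := mul_pos (Real.exp_pos _) (decay_pos _ _)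
  have hwc : Continuous w :=
    (Real.continuous_exp.comp (continuous_const.mul hκ)).mul
      ((continuous_decay N).comp continuous_snd)
  set fld : ((ℝ × E) →ᵇ ℂ) → ℝ → E → ℂ := fun g t ξ => (w (t, ξ) : ℂ) * g (t, ξ) with hfld
  have hfc (g : (ℝ × E) →ᵇ ℂ) : Continuous fun z : ℝ × E => fld g z.1 z.2 :=
    (Complex.continuous_ofReal.comp hwc).mul g.continuous
  have hfd (g₁ g₂ : (ℝ × E) →ᵇ ℂ) (τ : ℝ) (hτ : τ ∈ Icc 0 T) (ξ : E) :
      ‖fld g₁ τ ξ - fld g₂ τ ξ‖ ≤ dist g₁ g₂ * Real.exp (l * τ) * decay N ξ := by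
    simp only [hfld]
    have e : w (τ, ξ) = Real.exp (l * τ) * decay N ξ := by simp only [hw, clampTime_of_mem hτ]
    rw [← mul_sub, norm_mul, Complex.norm_real, Real.norm_of_nonneg (hw0 _).le,
      mul_assoc (dist g₁ g₂), ← e, mul_comm, ← dist_eq_norm]
    exact mul_le_mul_of_nonneg_right (BoundedContinuousFunction.dist_coe_le_dist _) (hw0 _).le
  have hf0 : fld 0 = fun _ _ => 0 := by ext t ξ; simp [hfld]
  have hfb (g : (ℝ × E) →ᵇ ℂ) (r : ℝ) (hr : ‖g‖ ≤ r) (τ : ℝ) (hτ : τ ∈ Icc 0 T) (ξ : E) :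
      ‖fld g τ ξ‖ ≤ r * Real.exp (l * τ) * decay N ξ := by
    have h1 := hfd g 0 τ hτ ξ
    rw [hf0, sub_zero, dist_zero_right] at h1
    refine h1.trans ?_
    have := (decay_pos N ξ).le
    gcongr
  have hpos (g : (ℝ × E) →ᵇ ℂ) (r : ℝ) (hr : ‖g‖ ≤ r) (t : ℝ) (ξ : E) :
      ‖posOf T Ψ (fld g) t ξ‖ ≤ (B * (1 + T) ^ J + r * Real.exp (l * T)) * decay N ξ :=
    norm_posOf_le h hT hl1 ((norm_nonneg g).trans hr) (hfb g r hr) t ξ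
  have hdiff (g₁ g₂ : (ℝ × E) →ᵇ ℂ) (r : ℝ) (h₁ : ‖g₁‖ ≤ r) (h₂ : ‖g₂‖ ≤ r) (z : ℝ × E) :
      ‖velOf q T ν Ψ (fld g₁) (clampTime T z.1) z.2 -
        velOf q T ν Ψ (fld g₂) (clampTime T z.1) z.2‖ ≤
      2 * ((q + 1) * convConst E N ^ q * (B * (1 + T) ^ J + r * Real.exp (l * T)) ^ q) / l ^ 2 *
        dist g₁ g₂ * w z := by
    rw [hw, ← mul_assoc]
    exact norm_velOf_sub_le hN h hν hl1 (hfc g₁) (hfc g₂) (hpos g₁ r h₁) (hpos g₂ r h₂)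
      (hfd g₁ g₂) (clampTime_mem hT z.1) z.2
  have hzero (z : ℝ × E) : ‖velOf q T ν Ψ (fld 0) (clampTime T z.1) z.2 -
      Ψt (clampTime T z.1) z.2‖ ≤ R / 2 * w z := by
    rw [hf0]
    refine (norm_velOf_zero_sub_le hN h hν (clampTime_mem hT z.1) z.2).trans ?_
    have h1 : decay N z.2 ≤ w z :=
      le_mul_of_one_le_left (decay_pos _ _).le
        (Real.one_le_exp (mul_nonneg (by linarith) (clampTime_mem hT z.1).1))
    rw [show R / 2 = ν * (28 * B * (1 + T) ^ (J + 2)) by rw [hR]; ring]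
    exact mul_le_mul_of_nonneg_left h1 (by positivity)
  set nxt : ((ℝ × E) →ᵇ ℂ) → ℝ × E → ℂ := fun g z => ((w z)⁻¹ : ℝ) *
    (velOf q T ν Ψ (fld g) (clampTime T z.1) z.2 - Ψt (clampTime T z.1) z.2) with hnxt
  have hinv (z : ℝ × E) (c : ℝ) (y : ℂ) (hy : ‖y‖ ≤ c * w z) : ‖(((w z)⁻¹ : ℝ) : ℂ) * y‖ ≤ c := by
    rw [norm_mul, Complex.norm_real, Real.norm_of_nonneg (inv_pos.2 (hw0 z)).le,
      inv_mul_le_iff₀ (hw0 z), mul_comm]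
    exact hy
  -- Joint continuity of `Ψt` is not part of `LimitSymbol`; it follows from its expression as an
  -- integral of the force.
  have hΨt : Continuous fun z : ℝ × E => Ψt (clampTime T z.1) z.2 := by
    have e : (fun z : ℝ × E => Ψt (clampTime T z.1) z.2) = fun z =>
        -∫ τ in (0 : ℝ)..clampTime T z.1, forceOf q T Ψ (fun _ _ => 0) τ z.2 :=
      funext fun z => h.vel_eq_integral hN hT (clampTime_mem hT z.1) z.2
    rw [e]
    exact (continuous_integral_field (continuous_forceOf_zero hN h hT) hκ continuous_snd).neg
  have hnc (g : (ℝ × E) →ᵇ ℂ) : Continuous (nxt g) := by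
    have h1 := continuous_velOf (ν := ν) h (continuous_forceOf hN h (hfc g) (hpos g _ le_rfl))
    refine (Complex.continuous_ofReal.comp (hwc.inv₀ fun z => (hw0 z).ne')).mul (.sub ?_ hΨt)
    exact h1.comp (hκ.prodMk continuous_snd)
  have hnd (g₁ g₂ : (ℝ × E) →ᵇ ℂ) (r : ℝ) (h₁ : ‖g₁‖ ≤ r) (h₂ : ‖g₂‖ ≤ r) (z : ℝ × E) :
      ‖nxt g₁ z - nxt g₂ z‖ ≤ 2 * ((q + 1) * convConst E N ^ q *
        (B * (1 + T) ^ J + r * Real.exp (l * T)) ^ q) / l ^ 2 * dist g₁ g₂ := by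
    rw [hnxt, ← mul_sub, sub_sub_sub_cancel_right]
    exact hinv _ _ _ (hdiff g₁ g₂ r h₁ h₂ z)
  have hn0 (z : ℝ × E) : ‖nxt 0 z‖ ≤ R / 2 := hinv _ _ _ (hzero z)
  have hex (g : (ℝ × E) →ᵇ ℂ) : ∃ f : (ℝ × E) →ᵇ ℂ, ∀ z, f z = nxt g z := by
    have hb (z : ℝ × E) : ‖nxt g z‖ ≤ 2 * ((q + 1) * convConst E N ^ q *
        (B * (1 + T) ^ J + ‖g‖ * Real.exp (l * T)) ^ q) / l ^ 2 * dist g 0 + R / 2 := by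
      have h1 := hnd g 0 ‖g‖ le_rfl (by simp) z
      have h2 : ‖nxt g z‖ ≤ ‖nxt g z - nxt 0 z‖ + ‖nxt 0 z‖ := by
        simpa using norm_add_le (nxt g z - nxt 0 z) (nxt 0 z)
      exact h2.trans (add_le_add h1 (hn0 z))
    exact ⟨BoundedContinuousFunction.ofNormedAddCommGroup (nxt g) (hnc g) _ hb, fun z => rfl⟩
  choose f hf using hex
  have hcontr (g₁ g₂ : (ℝ × E) →ᵇ ℂ) (h₁ : ‖g₁‖ ≤ R) (h₂ : ‖g₂‖ ≤ R) :
      dist (f g₁) (f g₂) ≤ 1 / 2 * dist g₁ g₂ := by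
    rw [BoundedContinuousFunction.dist_le (by positivity)]
    intro z
    rw [hf, hf, dist_eq_norm]
    refine (hnd g₁ g₂ R h₁ h₂ z).trans (mul_le_mul_of_nonneg_right ?_ dist_nonneg)
    rw [div_le_iff₀ (by positivity)]
    calc _ ≤ 2 * ((q + 1) * convConst E N ^ q * (B * (1 + T) ^ J + 1) ^ q) := by gcongr
      _ = l := hl.symm
      _ ≤ 1 / 2 * l ^ 2 := by nlinarith
  -- The symmetry is a closed condition preserved by the map, so the fixed point in `S` belongs to a
  -- real-valued function.
  set S : Set ((ℝ × E) →ᵇ ℂ) := {g | ‖g‖ ≤ R} ∩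
    ⋂ (t : ℝ) (ξ : E), {g | g (t, -ξ) = starRingEnd ℂ (g (t, ξ))} with hS
  have hSc : IsClosed S := by
    refine (isClosed_le continuous_norm continuous_const).inter
      (isClosed_iInter fun t => isClosed_iInter fun ξ => ?_)
    exact isClosed_eq (continuous_eval_const _)
      (Complex.continuous_conj.comp (continuous_eval_const _))
  have hsymm (g : (ℝ × E) →ᵇ ℂ) (hg : g ∈ S) (t : ℝ) : HermitianSymm (fld g t) := fun ξ => by
    have h1 : g (t, -ξ) = starRingEnd ℂ (g (t, ξ)) :=
      mem_iInter.1 (mem_iInter.1 hg.2 t) ξ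
    simp only [hfld, hw]
    rw [h1, decay_neg, map_mul, Complex.conj_ofReal]
  have hmaps : MapsTo f S S := by
    intro g hg
    refine ⟨?_, mem_iInter.2 fun t => mem_iInter.2 fun ξ => ?_⟩
    · have h1 : dist (f g) (f 0) ≤ 1 / 2 * dist g 0 := hcontr g 0 hg.1 (by simpa using hR0)
      have h2 : ‖f 0‖ ≤ R / 2 :=
        (BoundedContinuousFunction.norm_le (by positivity)).2 fun z => by rw [hf]; exact hn0 z
      have h3 : ‖f g‖ ≤ dist (f g) (f 0) + ‖f 0‖ := by
        rw [dist_eq_norm]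
        simpa using norm_add_le (f g - f 0) (f 0)
      rw [dist_zero_right] at h1
      have h4 : ‖g‖ ≤ R := hg.1
      show ‖f g‖ ≤ R
      linarith
    · show f g (t, -ξ) = starRingEnd ℂ (f g (t, ξ))
      rw [hf, hf]
      simp only [hnxt, hw]
      rw [decay_neg, HermitianSymm.velOf h (hsymm g hg), h.vel_symm, map_mul, map_sub,
        Complex.conj_ofReal]
  have hK : ContractingWith (1 / 2 : NNReal) (hmaps.restrict f S S) := by
    refine ⟨by norm_num, LipschitzWith.of_dist_le_mul fun g₁ g₂ => ?_⟩
    have h1 := hcontr g₁ g₂ g₁.2.1 g₂.2.1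
    have e : (((1 / 2 : NNReal)) : ℝ) = 1 / 2 := by norm_num
    rw [e]
    exact h1
  have h0S : (0 : (ℝ × E) →ᵇ ℂ) ∈ S :=
    ⟨by simpa using hR0, mem_iInter.2 fun t => mem_iInter.2 fun ξ => by simp⟩
  obtain ⟨g, hgS, hgf, -⟩ := hK.exists_fixedPoint' hSc.isComplete hmaps h0S (edist_ne_top _ _)
  refine ⟨fld g, hfc g, hsymm g hgS, hfb g R hgS.1, fun t ht ξ => ?_⟩
  have h1 : nxt g (t, ξ) = g (t, ξ) := by rw [← hf, hgf]
  simp only [hfld]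
  rw [← h1]
  simp only [hnxt, clampTime_of_mem ht]
  rw [← mul_assoc, ← Complex.ofReal_mul, mul_inv_cancel₀ (hw0 _).ne', Complex.ofReal_one, one_mul]

/-- `U`, with time derivative `P`, is the Fourier transform on `[0, T]` of a solution of
`u_tt + ν √(-Δ) u_t - ν² Δ u + u ^ (q + 1) = 0` with zero initial velocity. -/
structure ViscousSymbol (q N : ℕ) (ν T : ℝ) (U P : ℝ → E → ℂ) : Prop where
  continuous : Continuous fun z : ℝ × E => U z.1 z.2
  continuous_vel : Continuous fun z : ℝ × E => P z.1 z.2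
  symm : ∀ t ∈ Icc 0 T, HermitianSymm (U t)
  symm_vel : ∀ t ∈ Icc 0 T, HermitianSymm (P t)
  bound : ∃ A, ∀ t ∈ Icc 0 T, ∀ ξ, ‖U t ξ‖ ≤ A * decay N ξ
  bound_vel : ∃ A, ∀ t ∈ Icc 0 T, ∀ ξ, ‖P t ξ‖ ≤ A * decay N ξ
  hasDerivAt : ∀ t ξ, HasDerivAt (fun τ => U τ ξ) (P t ξ) t
  hasDerivAt_vel : ∀ t ∈ Icc 0 T, ∀ ξ, HasDerivAt (fun τ => P τ ξ)
    (-((ν * (2 * Real.pi * ‖ξ‖) : ℝ) * P t ξ) - (ν * (2 * Real.pi * ‖ξ‖) : ℝ) ^ 2 * U t ξ -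
      cpow (U t) q ξ) t
  vel_zero : ∀ ξ, P 0 ξ = 0

/-- For a fixed point, `P - D = Ψt` on `[0, T]`. Integrating, the position `Ψ 0 + ∫ P` of the
oscillator is `Ψ + ∫ D`, the position that enters the force: the oscillator is driven by its own
nonlinearity. -/
lemma LimitSymbol.viscousSymbol_velOf (hN : Module.finrank ℝ E < N)
    (h : LimitSymbol q N B J Ψ Ψt) (hT : 0 ≤ T) {l R : ℝ} (hl1 : 1 ≤ l) (hR0 : 0 ≤ R)
    {D : ℝ → E → ℂ} (hDc : Continuous fun z : ℝ × E => D z.1 z.2)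
    (hDs : ∀ t, HermitianSymm (D t))
    (hDb : ∀ t ∈ Icc 0 T, ∀ ξ, ‖D t ξ‖ ≤ R * Real.exp (l * t) * decay N ξ)
    (hD : ∀ t ∈ Icc 0 T, ∀ ξ, velOf q T ν Ψ D t ξ - Ψt t ξ = D t ξ) :
    ∃ U P : ℝ → E → ℂ, ViscousSymbol q N ν T U P ∧ (∀ ξ, U 0 ξ = Ψ 0 ξ) ∧
      ∀ t ∈ Icc 0 T, ∀ ξ, ‖U t ξ - Ψ t ξ‖ ≤ R * Real.exp (l * T) * decay N ξ ∧
        ‖P t ξ - Ψt t ξ‖ ≤ R * Real.exp (l * T) * decay N ξ := by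
  have hB := h.one_le
  have hposb := norm_posOf_le h hT hl1 hR0 hDb
  have hFc := continuous_forceOf hN h hDc hposb
  obtain ⟨P, hP⟩ : ∃ P : ℝ → E → ℂ, P = velOf q T ν Ψ D := ⟨_, rfl⟩
  have hPc : Continuous fun z : ℝ × E => P z.1 z.2 := by
    rw [hP]; exact continuous_velOf h hFc
  have hPs (t : ℝ) : HermitianSymm (P t) := by
    rw [hP]; exact HermitianSymm.velOf h hDs t
  have hPd (t : ℝ) (ξ : E) : HasDerivAt (fun τ => P τ ξ)
      (-((ν * (2 * Real.pi * ‖ξ‖) : ℝ) * P t ξ) - (ν * (2 * Real.pi * ‖ξ‖) : ℝ) ^ 2 *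
        (Ψ 0 ξ + ∫ τ in (0 : ℝ)..t, P τ ξ) - cpow (posOf T Ψ D t) q ξ) t := by
    rw [hP]
    exact hasDerivAt_forcedVel (ν * (2 * Real.pi * ‖ξ‖)) (Ψ 0 ξ)
      (hFc.comp (Continuous.prodMk_left ξ)) t
  have hP0 (ξ : E) : P 0 ξ = 0 := by
    rw [hP]; exact forcedVel_zero _ _ _
  rw [← hP] at hD
  clear hP
  obtain ⟨U, hU⟩ : ∃ U : ℝ → E → ℂ, ∀ t ξ, U t ξ = Ψ 0 ξ + ∫ τ in (0 : ℝ)..t, P τ ξ :=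
    ⟨_, fun _ _ => rfl⟩
  have hUc : Continuous fun z : ℝ × E => U z.1 z.2 := by
    simp only [hU]
    exact (h.continuous.comp (continuous_const.prodMk continuous_snd)).add
      (continuous_integral_field hPc continuous_fst continuous_snd)
  have hUpos (t : ℝ) (ht : t ∈ Icc 0 T) (ξ : E) : U t ξ = posOf T Ψ D t ξ := by
    have cF : Continuous fun τ => P τ ξ := hPc.comp (Continuous.prodMk_left ξ)
    have cD : Continuous fun τ => D τ ξ := hDc.comp (Continuous.prodMk_left ξ)
    have hi := intervalIntegral.integral_eq_sub_of_hasDerivAt (a := 0) (b := t)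
      (f := fun τ => Ψ τ ξ) (f' := fun τ => P τ ξ - D τ ξ) (fun τ hτ => ?_)
      ((cF.sub cD).intervalIntegrable _ _)
    · rw [intervalIntegral.integral_sub (cF.intervalIntegrable _ _)
        (cD.intervalIntegrable _ _)] at hi
      rw [hU, posOf, clampTime_of_mem ht]
      linear_combination hi
    · rw [uIcc_of_le ht.1] at hτ
      rw [← hD τ ⟨hτ.1, hτ.2.trans ht.2⟩ ξ, sub_sub_cancel]
      exact h.hasDerivAt τ ξ
  have hexp (t : ℝ) (ht : t ∈ Icc 0 T) : R * Real.exp (l * t) ≤ R * Real.exp (l * T) := by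
    have := ht.2
    gcongr
  have hDbT (t : ℝ) (ht : t ∈ Icc 0 T) (ξ : E) :
      ‖P t ξ - Ψt t ξ‖ ≤ R * Real.exp (l * T) * decay N ξ := by
    rw [hD t ht]
    exact (hDb t ht ξ).trans (mul_le_mul_of_nonneg_right (hexp t ht) (decay_pos N ξ).le)
  have hUs (t : ℝ) : HermitianSymm (U t) := fun ξ => by
    have h1 := HermitianSymm.intervalIntegral (D := P) hPs t ξ
    rw [hU, hU, map_add, ← h1, h.symm]
  have hPb (t : ℝ) (ht : t ∈ Icc 0 T) (ξ : E) : ‖P t ξ‖ ≤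
      (T * (convConst E N ^ q * (B * (1 + T) ^ J) ^ (q + 1)) + R * Real.exp (l * T)) *
        decay N ξ := by
    have h1 : ‖Ψt t ξ‖ ≤ T * (convConst E N ^ q * (B * (1 + T) ^ J) ^ (q + 1)) * decay N ξ := by
      rw [h.vel_eq_integral hN hT ht, norm_neg]
      refine (intervalIntegral.norm_integral_le_of_norm_le_const (C := convConst E N ^ q *
        (B * (1 + T) ^ J) ^ (q + 1) * decay N ξ) fun τ _ => ?_).trans ?_
      · rw [forceOf, posOf_zero]
        exact norm_cpow_le hN (h.bound_le (clampTime_mem hT τ)) q ξ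
      · rw [sub_zero, abs_of_nonneg ht.1, mul_comm, ← mul_assoc]
        have := one_le_convConst (E := E) N
        exact mul_le_mul_of_nonneg_right (mul_le_mul_of_nonneg_right ht.2 (by positivity))
          (decay_pos N ξ).le
    have h2 : ‖P t ξ‖ ≤ ‖Ψt t ξ‖ + ‖P t ξ - Ψt t ξ‖ := by
      simpa using norm_add_le (Ψt t ξ) (P t ξ - Ψt t ξ)
    rw [add_mul]
    exact h2.trans (add_le_add h1 (hDbT t ht ξ))
  refine ⟨U, P, ⟨hUc, hPc, fun t _ => hUs t, fun t _ => hPs t,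
    ⟨B * (1 + T) ^ J + R * Real.exp (l * T), fun t ht ξ => ?_⟩,
    ⟨_, hPb⟩, fun t ξ => ?_, fun t ht ξ => ?_, hP0⟩, fun ξ => ?_,
    fun t ht ξ => ⟨?_, hDbT t ht ξ⟩⟩
  · rw [hUpos t ht]; exact hposb t ξ
  · simp only [hU]
    exact (hasDerivAt_integral_of_continuous (hPc.comp (Continuous.prodMk_left ξ)) t).const_add _
  · have h1 := hPd t ξ
    rw [← hU, ← funext (hUpos t ht)] at h1
    exact h1
  · simp [hU]
  · rw [hUpos t ht, posOf, clampTime_of_mem ht, add_sub_cancel_left]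
    refine (norm_integral_field_le hl1 ht fun τ hτ => hDb τ hτ ξ).trans ?_
    exact mul_le_mul_of_nonneg_right ((div_le_self (by positivity) hl1).trans (hexp t ht))
      (decay_pos _ _).le

lemma LimitSymbol.exists_viscousSymbol_of_small (hN : Module.finrank ℝ E < N)
    (h : LimitSymbol q N B J Ψ Ψt) (hT : 0 ≤ T) (hν : 0 ≤ ν) {l R : ℝ}
    (hl : l = 2 * ((q + 1) * convConst E N ^ q * (B * (1 + T) ^ J + 1) ^ q))
    (hR : R = 2 * (ν * (28 * B * (1 + T) ^ (J + 2)))) (hsmall : R * Real.exp (l * T) ≤ 1) :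
    ∃ U P : ℝ → E → ℂ, ViscousSymbol q N ν T U P ∧ (∀ ξ, U 0 ξ = Ψ 0 ξ) ∧
      ∀ t ∈ Icc 0 T, ∀ ξ, ‖U t ξ - Ψ t ξ‖ ≤ R * Real.exp (l * T) * decay N ξ ∧
        ‖P t ξ - Ψt t ξ‖ ≤ R * Real.exp (l * T) * decay N ξ := by
  obtain ⟨D, hDc, hDs, hDb, hD⟩ := h.exists_fixedPoint hN hT hν hl hR hsmall
  have hB := h.one_le
  refine h.viscousSymbol_velOf hN hT ?_ ?_ hDc hDs hDb hD
  · have hC := one_le_convConst (E := E) N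
    have hA1 : 1 ≤ B * (1 + T) ^ J + 1 := by
      have : 0 ≤ B * (1 + T) ^ J := by positivity
      linarith
    have h1 := one_le_pow₀ hC (n := q)
    have h2 := one_le_pow₀ hA1 (n := q)
    have h3 : (1 : ℝ) ≤ q + 1 := by linarith [Nat.cast_nonneg (α := ℝ) q]
    have := one_le_mul_of_one_le_of_one_le (one_le_mul_of_one_le_of_one_le h3 h1) h2
    linarith
  · rw [hR]; positivity

/-- Both the polynomial prefactor of `ν` in `R`, by `x ≤ exp x`, and `exp (l T)` are absorbed in a
single exponential of a power of `1 + T`. The exponent `J + 2 + (J * q + 1)` exceeds the one of each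
contribution. -/
theorem LimitSymbol.exists_viscousSymbol (hN : Module.finrank ℝ E < N)
    (h : LimitSymbol q N B J Ψ Ψt) : ∃ (K : ℝ) (j : ℕ), 0 < K ∧ 0 < j ∧ ∀ ν T : ℝ, 0 ≤ ν → 0 ≤ T →
      ν * Real.exp (K * (1 + T) ^ j) ≤ 1 →
      ∃ U P : ℝ → E → ℂ, ViscousSymbol q N ν T U P ∧ (∀ ξ, U 0 ξ = Ψ 0 ξ) ∧
        ∀ t ∈ Icc 0 T, ∀ ξ, ‖U t ξ - Ψ t ξ‖ ≤ ν * Real.exp (K * (1 + T) ^ j) * decay N ξ ∧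
          ‖P t ξ - Ψt t ξ‖ ≤ ν * Real.exp (K * (1 + T) ^ j) * decay N ξ := by
  have hB := h.one_le
  have hC := one_le_convConst (E := E) N
  set K₁ : ℝ := 2 * ((q + 1) * convConst E N ^ q * (2 * B) ^ q) with hK₁
  refine ⟨56 * B + K₁, J + 2 + (J * q + 1), by positivity, by omega, fun ν T hν hT hsmall => ?_⟩
  set l : ℝ := 2 * ((q + 1) * convConst E N ^ q * (B * (1 + T) ^ J + 1) ^ q) with hl
  set R : ℝ := 2 * (ν * (28 * B * (1 + T) ^ (J + 2))) with hR
  have hs : 1 ≤ 1 + T := by linarith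
  have h1 : 56 * B * (1 + T) ^ (J + 2) ≤
      Real.exp (56 * B * (1 + T) ^ (J + 2 + (J * q + 1))) := by
    refine le_trans ?_ (Real.add_one_le_exp _)
    have : (1 + T) ^ (J + 2) ≤ (1 + T) ^ (J + 2 + (J * q + 1)) :=
      pow_le_pow_right₀ hs (by omega)
    have := mul_le_mul_of_nonneg_left this (by positivity : 0 ≤ 56 * B)
    linarith
  have h2 : l * T ≤ K₁ * (1 + T) ^ (J + 2 + (J * q + 1)) := by
    have h3 : B * (1 + T) ^ J + 1 ≤ 2 * B * (1 + T) ^ J := by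
      have : 1 ≤ B * (1 + T) ^ J := one_le_mul_of_one_le_of_one_le hB (one_le_pow₀ hs)
      linarith
    calc l * T ≤ 2 * ((q + 1) * convConst E N ^ q * (2 * B * (1 + T) ^ J) ^ q) * (1 + T) := by
          rw [hl]
          gcongr
          linarith
      _ = K₁ * (1 + T) ^ (J * q + 1) := by rw [hK₁]; ring
      _ ≤ _ := by
          exact mul_le_mul_of_nonneg_left (pow_le_pow_right₀ hs (by omega)) (by positivity)
  have h4 : R * Real.exp (l * T) ≤
      ν * Real.exp ((56 * B + K₁) * (1 + T) ^ (J + 2 + (J * q + 1))) := by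
    rw [add_mul, Real.exp_add, ← mul_assoc]
    have e : R = ν * (56 * B * (1 + T) ^ (J + 2)) := by rw [hR]; ring
    rw [e]
    gcongr
  obtain ⟨U, P, hUP, h0, herr⟩ :=
    h.exists_viscousSymbol_of_small hN hT hν hl hR (h4.trans hsmall)
  refine ⟨U, P, hUP, h0, fun t ht ξ => ?_⟩
  have hd := (decay_pos N ξ).le
  exact ⟨(herr t ht ξ).1.trans (mul_le_mul_of_nonneg_right h4 hd),
    (herr t ht ξ).2.trans (mul_le_mul_of_nonneg_right h4 hd)⟩

end ViscousSolution

/-! ### Fourier transforms of the limit solution -/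

lemma Function.Periodic.exists_bound_iteratedFDeriv {g : ℝ → ℝ} {P : ℝ} (hP : 0 < P)
    (hg : ContDiff ℝ ∞ g) (hgP : Function.Periodic g P) (M : ℕ) :
    ∃ G, 0 ≤ G ∧ ∀ i ≤ M, ∀ s, ‖iteratedFDeriv ℝ i g s‖ ≤ G := by
  have h1 (i : ℕ) : ∃ G, ∀ s, ‖iteratedFDeriv ℝ i g s‖ ≤ G := by
    have hper : Function.Periodic (iteratedFDeriv ℝ i g) P := fun s => by
      rw [← iteratedFDeriv_comp_add_right, show (fun z => g (z + P)) = g from funext hgP]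
    have hb := hper.isBounded_of_continuous hP.ne'
      (hg.continuous_iteratedFDeriv (by exact_mod_cast le_top))
    obtain ⟨G, hG⟩ := hb.exists_norm_le
    exact ⟨G, fun s => hG _ (mem_range_self s)⟩
  choose G hG using h1
  refine ⟨∑ i ∈ Finset.range (M + 1), |G i|, by positivity, fun i hi s => ?_⟩
  refine (hG i s).trans ((le_abs_self _).trans ?_)
  exact Finset.single_le_sum (f := fun i => |G i|) (fun _ _ => abs_nonneg _)
    (Finset.mem_range.2 (by omega))

lemma exists_bound_iteratedFDeriv_of_hasCompactSupport {E : Type*} [NormedAddCommGroup E]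
    [NormedSpace ℝ E] {b : E → ℝ} (hb : ContDiff ℝ ∞ b) (hbs : HasCompactSupport b) (M : ℕ) :
    ∃ G, 1 ≤ G ∧ ∀ i ≤ M, ∀ x, ‖iteratedFDeriv ℝ i b x‖ ≤ G := by
  have h1 (i : ℕ) : ∃ G, ∀ x, ‖iteratedFDeriv ℝ i b x‖ ≤ G :=
    (hbs.iteratedFDeriv (𝕜 := ℝ) i).exists_bound_of_continuous
      (hb.continuous_iteratedFDeriv (by exact_mod_cast le_top))
  choose G hG using h1
  refine ⟨1 + ∑ i ∈ Finset.range (M + 1), |G i|, le_add_of_nonneg_right (by positivity),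
    fun i hi s => ?_⟩
  refine (hG i s).trans ((le_abs_self _).trans ?_)
  have := Finset.single_le_sum (f := fun i => |G i|) (fun _ _ => abs_nonneg _)
    (Finset.mem_range.2 (by omega : i < M + 1))
  linarith

/-- By the chain rule of higher order, every derivative falling on `g (t * b x)` produces at most
one factor `t`, and the derivatives of `g` are bounded. The growth in time is therefore only
polynomial. -/
lemma norm_iteratedFDeriv_modulated_le {E : Type*} [NormedAddCommGroup E] [NormedSpace ℝ E]
    {a b : E → ℝ} {g : ℝ → ℝ} (ha : ContDiff ℝ ∞ a)
    (hb : ContDiff ℝ ∞ b) (hg : ContDiff ℝ ∞ g) {M : ℕ} {G D : ℝ} (hD : 1 ≤ D) (hG0 : 0 ≤ G)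
    (hG : ∀ i ≤ M, ∀ s, ‖iteratedFDeriv ℝ i g s‖ ≤ G)
    (hbD : ∀ i ≤ M, ∀ x, ‖iteratedFDeriv ℝ i b x‖ ≤ D) (t : ℝ) {j : ℕ} (hj : j ≤ M) (x : E) :
    ‖iteratedFDeriv ℝ j (fun x => a x * g (t * b x)) x‖ ≤
      (2 ^ M * (M.factorial * G * (D * (1 + |t|)) ^ M)) *
        ∑ i ∈ Finset.range (M + 1), ‖iteratedFDeriv ℝ i a x‖ := by
  have ht : 1 ≤ 1 + |t| := by linarith [abs_nonneg t]
  have hDt : 1 ≤ D * (1 + |t|) := one_le_mul_of_one_le_of_one_le hD ht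
  have hcomp (i : ℕ) (hi : i ≤ M) : ‖iteratedFDeriv ℝ i (fun x => g (t * b x)) x‖ ≤
      M.factorial * G * (D * (1 + |t|)) ^ M := by
    have h1 := norm_iteratedFDeriv_comp_le (g := g) (f := fun x => t * b x) hg
      (contDiff_const.mul hb) (n := i) (by exact_mod_cast le_top) x (C := G) (D := D * (1 + |t|))
      (fun k hk => hG k (hk.trans hi) _) (fun k hk1 hk => by
        have e : iteratedFDeriv ℝ k (fun x => t * b x) x = t • iteratedFDeriv ℝ k b x :=
          iteratedFDeriv_const_smul_apply' (a := t) (hb.contDiffAt.of_le (by exact_mod_cast le_top))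
        rw [e, norm_smul, Real.norm_eq_abs]
        calc |t| * ‖iteratedFDeriv ℝ k b x‖ ≤ (1 + |t|) * D :=
              mul_le_mul (by linarith) (hbD k (hk.trans hi) x) (norm_nonneg _) (by linarith)
          _ = D * (1 + |t|) := mul_comm _ _
          -- The composition estimate wants a bound of the form `D ^ k` for the derivative of order
          -- `k`; a base of at least `1` and `k ≥ 1` provide it.
          _ ≤ (D * (1 + |t|)) ^ k := le_self_pow₀ hDt (by omega))
    refine h1.trans ?_
    have h2 : (i.factorial : ℝ) ≤ M.factorial := by exact_mod_cast Nat.factorial_le hi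
    have h3 : (D * (1 + |t|)) ^ i ≤ (D * (1 + |t|)) ^ M := pow_le_pow_right₀ hDt hi
    gcongr
  have hgb : ContDiff ℝ ∞ fun x => g (t * b x) := hg.comp (contDiff_const.mul hb)
  refine (norm_iteratedFDeriv_mul_le ha hgb x (n := j) (by exact_mod_cast le_top)).trans ?_
  have hsub : Finset.range (j + 1) ⊆ Finset.range (M + 1) := Finset.range_mono (by omega)
  calc _ ≤ ∑ i ∈ Finset.range (j + 1), (2 ^ M * (M.factorial * G * (D * (1 + |t|)) ^ M)) *
        ‖iteratedFDeriv ℝ i a x‖ := by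
        refine Finset.sum_le_sum fun i hi => ?_
        have h1 : (j.choose i : ℝ) ≤ 2 ^ M := by
          have h := (Nat.choose_le_two_pow j i).trans (Nat.pow_le_pow_right (by norm_num) hj)
          exact_mod_cast h
        have h2 := hcomp (j - i) (by omega)
        calc _ ≤ 2 ^ M * ‖iteratedFDeriv ℝ i a x‖ *
              (M.factorial * G * (D * (1 + |t|)) ^ M) := by gcongr
          _ = _ := by ring
    _ ≤ ∑ i ∈ Finset.range (M + 1), (2 ^ M * (M.factorial * G * (D * (1 + |t|)) ^ M)) *
        ‖iteratedFDeriv ℝ i a x‖ :=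
        Finset.sum_le_sum_of_subset_of_nonneg hsub fun _ _ _ => by positivity
    _ = _ := by rw [Finset.mul_sum]

lemma one_add_pow_le (s : ℝ) (hs : 0 ≤ s) (M : ℕ) : (1 + s) ^ M ≤ 2 ^ M * (1 + s ^ M) := by
  rcases le_total s 1 with h | h
  · calc (1 + s) ^ M ≤ 2 ^ M := pow_le_pow_left₀ (by linarith) (by linarith) M
      _ ≤ 2 ^ M * (1 + s ^ M) := le_mul_of_one_le_right (by positivity)
          (le_add_of_nonneg_right (by positivity))
  · calc (1 + s) ^ M ≤ (2 * s) ^ M := pow_le_pow_left₀ (by linarith) (by linarith) M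
      _ = 2 ^ M * s ^ M := mul_pow _ _ _
      _ ≤ 2 ^ M * (1 + s ^ M) := by gcongr; linarith

section Modulated

variable {E : Type*} [NormedAddCommGroup E] [InnerProductSpace ℝ E] [FiniteDimensional ℝ E]
  [MeasurableSpace E] [BorelSpace E]

/-- Derivatives in `L¹` bound `‖ξ‖ ^ j` times the transform. The cases `j = 0` and `j = M` together
control the weight `(1 + ‖ξ‖) ^ M`. -/
lemma norm_fourier_le_decay {f : E → ℂ} {M : ℕ} {A : ℝ} (hf : ContDiff ℝ ∞ f)
    (hi : ∀ j, Integrable (fun x => ‖iteratedFDeriv ℝ j f x‖))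
    (hA : ∀ j ≤ M, ∫ x, ‖iteratedFDeriv ℝ j f x‖ ≤ A) (ξ : E) :
    ‖𝓕 f ξ‖ ≤ (4 ^ M * (2 * (M + 1) * A)) * decay M ξ := by
  have hA0 : 0 ≤ A := (integral_nonneg fun _ => norm_nonneg _).trans (hA 0 (by omega))
  have h1 (j : ℕ) (hj : j ≤ M) : ‖ξ‖ ^ j * ‖𝓕 f ξ‖ ≤ 2 ^ M * ((M + 1) * A) := by
    have h := Real.pow_mul_norm_iteratedFDeriv_fourier_le (K := 0) (N := ⊤) (f := f) hf
      (fun k n hk _ => by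
        have : k = 0 := by exact_mod_cast le_antisymm hk (zero_le)
        subst this
        simpa using hi n) (k := 0) (n := j) (by simp) le_top ξ
    simp only [norm_iteratedFDeriv_zero, pow_zero, one_mul, zero_add, Nat.cast_zero, mul_zero,
      Finset.range_one, Finset.singleton_product, Finset.sum_map,
      Function.Embedding.coeFn_mk] at h
    refine h.trans ?_
    have h2 : ∑ p ∈ Finset.range (j + 1), ∫ v, ‖iteratedFDeriv ℝ p f v‖ ≤ (M + 1) * A := by
      calc _ ≤ ∑ p ∈ Finset.range (j + 1), A :=
            Finset.sum_le_sum fun p hp => hA p (by have := Finset.mem_range.1 hp; omega)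
        _ = (j + 1) * A := by simp
        _ ≤ _ := by
          have : (j : ℝ) ≤ M := by exact_mod_cast hj
          gcongr
    have h3 : (2 : ℝ) ^ j ≤ 2 ^ M := pow_le_pow_right₀ (by norm_num) hj
    exact mul_le_mul h3 h2 (Finset.sum_nonneg fun _ _ => integral_nonneg fun _ => norm_nonneg _)
      (by positivity)
  have h0 := h1 0 (by omega)
  have hM := h1 M le_rfl
  rw [pow_zero, one_mul] at h0
  rw [decay, ← div_eq_mul_inv, le_div_iff₀ (by positivity), mul_comm]
  calc (1 + ‖ξ‖) ^ M * ‖𝓕 f ξ‖ ≤ 2 ^ M * (1 + ‖ξ‖ ^ M) * ‖𝓕 f ξ‖ := by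
        gcongr; exact one_add_pow_le _ (norm_nonneg _) M
    _ = 2 ^ M * (‖𝓕 f ξ‖ + ‖ξ‖ ^ M * ‖𝓕 f ξ‖) := by ring
    _ ≤ 2 ^ M * (2 ^ M * ((M + 1) * A) + 2 ^ M * ((M + 1) * A)) := by gcongr
    _ = _ := by
      rw [show (4 : ℝ) = 2 * 2 by norm_num, mul_pow]; ring

lemma exists_norm_fourier_modulated_le {a b : E → ℝ} {g : ℝ → ℝ} {P : ℝ} (ha : ContDiff ℝ ∞ a)
    (has : HasCompactSupport a) (hb : ContDiff ℝ ∞ b) (hbs : HasCompactSupport b)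
    (hg : ContDiff ℝ ∞ g) (hP : 0 < P) (hgP : Function.Periodic g P) (M : ℕ) :
    ∃ C, ∀ t ξ, ‖𝓕 (fun x => ((a x * g (t * b x) : ℝ) : ℂ)) ξ‖ ≤
      C * (1 + |t|) ^ M * decay M ξ := by
  obtain ⟨G, hG0, hG⟩ := hgP.exists_bound_iteratedFDeriv hP hg M
  obtain ⟨D, hD, hbD⟩ := exists_bound_iteratedFDeriv_of_hasCompactSupport hb hbs M
  have hai (i : ℕ) : Integrable fun x => ‖iteratedFDeriv ℝ i a x‖ :=
    ((ha.continuous_iteratedFDeriv (m := i) (by exact_mod_cast le_top)).norm).integrable_of_hasCompactSupport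
      (has.iteratedFDeriv (𝕜 := ℝ) i).norm
  refine ⟨4 ^ M * (2 * (M + 1) * (2 ^ M * (M.factorial * G * D ^ M) *
    ∫ x, ∑ i ∈ Finset.range (M + 1), ‖iteratedFDeriv ℝ i a x‖)), fun t ξ => ?_⟩
  have hr : ContDiff ℝ ∞ fun x => a x * g (t * b x) := ha.mul (hg.comp (contDiff_const.mul hb))
  have hrs : HasCompactSupport fun x => a x * g (t * b x) := has.mul_right
  have hn (j : ℕ) (x : E) : ‖iteratedFDeriv ℝ j (fun x => ((a x * g (t * b x) : ℝ) : ℂ)) x‖ =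
      ‖iteratedFDeriv ℝ j (fun x => a x * g (t * b x)) x‖ :=
    Complex.ofRealLI.norm_iteratedFDeriv_comp_left (hr.contDiffAt (n := ∞))
      (by exact_mod_cast le_top)
  have hri (j : ℕ) : Integrable fun x => ‖iteratedFDeriv ℝ j (fun x => a x * g (t * b x)) x‖ :=
    ((hr.continuous_iteratedFDeriv (m := j) (by exact_mod_cast le_top)).norm).integrable_of_hasCompactSupport
      (hrs.iteratedFDeriv (𝕜 := ℝ) j).norm
  have := norm_fourier_le_decay (f := fun x => ((a x * g (t * b x) : ℝ) : ℂ)) (M := M)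
    (A := (2 ^ M * (M.factorial * G * (D * (1 + |t|)) ^ M)) *
      ∫ x, ∑ i ∈ Finset.range (M + 1), ‖iteratedFDeriv ℝ i a x‖)
    (Complex.ofRealCLM.contDiff.comp hr) (fun j => by simpa only [hn] using hri j)
    (fun j hj => by
      simp only [hn]
      rw [← integral_const_mul]
      exact integral_mono (hri j) ((integrable_finsetSum _ fun i _ => hai i).const_mul _)
        fun x => norm_iteratedFDeriv_modulated_le ha hb hg hD hG0 hG hbD t hj x) ξ
  refine this.trans (le_of_eq ?_)
  rw [mul_pow]
  ring

lemma continuous_fourier_of_dominated {f : ℝ → E → ℝ} {F : E → ℝ}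
    (hf : Continuous fun z : ℝ × E => f z.1 z.2) (hF : Integrable F)
    (hfF : ∀ t x, ‖f t x‖ ≤ F x) :
    Continuous fun z : ℝ × E => 𝓕 (fun x => (f z.1 x : ℂ)) z.2 := by
  simp only [Real.fourier_eq]
  refine continuous_of_dominated (bound := F) (fun z => ?_) (fun z => ?_) hF ?_
  · have : Continuous fun x => f z.1 x := hf.comp (Continuous.prodMk_right z.1)
    have h2 : Continuous fun v : E => Real.fourierChar (-(inner ℝ v z.2)) := by fun_prop
    exact (h2.smul (Complex.continuous_ofReal.comp this)).aestronglyMeasurable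
  · refine Eventually.of_forall fun x => ?_
    rw [Circle.norm_smul, Complex.norm_real]
    exact hfF _ _
  · refine Eventually.of_forall fun x => ?_
    have : Continuous fun z : ℝ × E => f z.1 x :=
      hf.comp (continuous_fst.prodMk continuous_const)
    have h2 : Continuous fun z : ℝ × E => Real.fourierChar (-(inner ℝ x z.2)) := by fun_prop
    exact h2.smul (Complex.continuous_ofReal.comp this)

lemma hasDerivAt_fourier_of_dominated {f f' : ℝ → E → ℝ} {F F' : E → ℝ}
    (hf : ∀ t, Continuous (f t)) (hf' : ∀ t, Continuous (f' t)) (hF : Integrable F)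
    (hfF : ∀ t x, ‖f t x‖ ≤ F x) (hF' : Integrable F') (hfF' : ∀ t x, ‖f' t x‖ ≤ F' x)
    (hd : ∀ t x, HasDerivAt (fun τ => f τ x) (f' t x) t) (t : ℝ) (ξ : E) :
    HasDerivAt (fun τ => 𝓕 (fun x => (f τ x : ℂ)) ξ) (𝓕 (fun x => (f' t x : ℂ)) ξ) t := by
  simp only [Real.fourier_eq]
  have h2 : Continuous fun v : E => Real.fourierChar (-(inner ℝ v ξ)) := by fun_prop
  have m1 (τ : ℝ) : AEStronglyMeasurable fun v : E => Real.fourierChar (-(inner ℝ v ξ)) • (f τ v : ℂ) :=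
    (h2.smul (Complex.continuous_ofReal.comp (hf τ))).aestronglyMeasurable
  refine (hasDerivAt_integral_of_dominated_loc_of_deriv_le (bound := F') (s := univ)
    (F' := fun τ v => Real.fourierChar (-(inner ℝ v ξ)) • (f' τ v : ℂ)) univ_mem
    (Eventually.of_forall m1) (hF.mono' (m1 t) (Eventually.of_forall fun x => ?_))
    (h2.smul (Complex.continuous_ofReal.comp (hf' t))).aestronglyMeasurable
    (Eventually.of_forall fun x τ _ => ?_) hF' (Eventually.of_forall fun x τ _ => ?_)).2
  · rw [Circle.norm_smul, Complex.norm_real]; exact hfF _ _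
  · show ‖Real.fourierChar (-(inner ℝ x ξ)) • (f' τ x : ℂ)‖ ≤ _
    rw [Circle.norm_smul, Complex.norm_real]; exact hfF' _ _
  · exact ((hd τ x).ofReal_comp).const_smul _

lemma hermitianSymm_fourier (f : E → ℝ) : HermitianSymm (𝓕 fun x => (f x : ℂ)) := by
  intro ξ
  simp only [Real.fourier_eq, ← integral_conj]
  congr 1
  ext x
  simp only [Circle.smul_def, smul_eq_mul, map_mul, Complex.conj_ofReal, inner_neg_right, neg_neg]
  rw [← Circle.coe_inv_eq_conj, ← AddChar.map_neg_eq_inv, neg_neg]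

end Modulated

/-! ### The limit solution as a decaying symbol -/

section LimitSymbol

variable {n : ℕ}

lemma IsSymbol.fourier_fourierInv {M : ℕ} {F : EuclideanSpace ℝ (Fin n) → ℂ} (hM : n < M)
    (hF : IsSymbol M F) (hi : Integrable (𝓕⁻ F)) : 𝓕 (𝓕⁻ F) = F := by
  refine hF.continuous.fourier_fourierInv_eq (hF.integrable hM) ?_
  rw [show 𝓕 F = fun x => 𝓕⁻ F (-x) from funext fun x => by
    rw [Real.fourierInv_eq_fourier_neg, neg_neg]]
  exact hi.comp_neg

lemma phys_fourier {M : ℕ} {f : EuclideanSpace ℝ (Fin n) → ℝ} (hM : n < M) (hf : Continuous f)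
    (hfi : Integrable f) (hF : IsSymbol M (𝓕 fun x => (f x : ℂ))) :
    phys (𝓕 fun x => (f x : ℂ)) = f := by
  have h : 𝓕⁻ (𝓕 fun x => (f x : ℂ)) = fun x => (f x : ℂ) :=
    Continuous.fourierInv_fourier_eq (Complex.continuous_ofReal.comp hf) hfi.ofReal
      (hF.integrable hM)
  ext x
  rw [phys, h, Complex.ofReal_re]

/-- The two sides have the same inverse transform by the convolution theorem for `phys`, and
inversion applies since the power is integrable. -/
lemma cpow_fourier {M : ℕ} {f : EuclideanSpace ℝ (Fin n) → ℝ} (hM : n < M) (hf : Continuous f)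
    (hfi : Integrable f) (hF : IsSymbol M (𝓕 fun x => (f x : ℂ))) (j : ℕ)
    (hfj : Integrable fun x => f x ^ (j + 1)) :
    cpow (𝓕 fun x => (f x : ℂ)) j = 𝓕 fun x => ((f x ^ (j + 1) : ℝ) : ℂ) := by
  have h := hF.cpow hM j
  have e : 𝓕⁻ (cpow (𝓕 fun x => (f x : ℂ)) j) = fun x => ((f x ^ (j + 1) : ℝ) : ℂ) := by
    ext x
    rw [← ofReal_phys h.symm, phys_cpow hM hF, phys_fourier hM hf hfi hF]
  rw [← e, h.fourier_fourierInv hM]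
  rw [e]
  exact hfj.ofReal

lemma exists_integrable_bound_modulated {a b : EuclideanSpace ℝ (Fin n) → ℝ} {g : ℝ → ℝ} {P : ℝ}
    (ha : Continuous a) (has : HasCompactSupport a) (hg : Continuous g) (hP : 0 < P)
    (hgP : Function.Periodic g P) :
    ∃ F : EuclideanSpace ℝ (Fin n) → ℝ, Integrable F ∧ ∀ t x, ‖a x * g (t * b x)‖ ≤ F x := by
  obtain ⟨G, hG⟩ := (hgP.isBounded_of_continuous hP.ne' hg).exists_norm_le
  refine ⟨fun x => ‖a x‖ * G, (ha.integrable_of_hasCompactSupport has).norm.mul_const G,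
    fun t x => ?_⟩
  rw [norm_mul]
  exact mul_le_mul_of_nonneg_left (hG _ (mem_range_self _)) (norm_nonneg _)

/-- The Fourier transform in space of a real function of time and space. -/
noncomputable def spaceFourier (f : ℝ → EuclideanSpace ℝ (Fin n) → ℝ) (t : ℝ) :
    EuclideanSpace ℝ (Fin n) → ℂ :=
  𝓕 fun x => (f t x : ℂ)

variable {q N : ℕ} {ψ v : ℝ → EuclideanSpace ℝ (Fin n) → ℝ}

lemma Continuous.slice {X Y Z : Type*} [TopologicalSpace X] [TopologicalSpace Y]
    [TopologicalSpace Z] {F : X → Y → Z} (h : Continuous fun z : X × Y => F z.1 z.2) (t : X) :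
    Continuous (F t) :=
  h.comp (Continuous.prodMk_right t)

lemma isSymbol_spaceFourier {F : EuclideanSpace ℝ (Fin n) → ℝ} {C t : ℝ} {M : ℕ}
    (hψ : Continuous fun z : ℝ × EuclideanSpace ℝ (Fin n) => ψ z.1 z.2) (hF : Integrable F)
    (hψF : ∀ t x, ‖ψ t x‖ ≤ F x) (hC : ∀ ξ, ‖spaceFourier ψ t ξ‖ ≤ C * decay M ξ) :
    IsSymbol M (spaceFourier ψ t) := by
  have h : Continuous fun z : ℝ × EuclideanSpace ℝ (Fin n) => spaceFourier ψ z.1 z.2 :=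
    continuous_fourier_of_dominated hψ hF hψF
  have h2 : HermitianSymm (spaceFourier ψ t) := hermitianSymm_fourier (ψ t)
  exact ⟨Continuous.slice (F := spaceFourier ψ) h t, h2, C, hC⟩

lemma limitSymbol_spaceFourier {F₁ F₂ F₃ : EuclideanSpace ℝ (Fin n) → ℝ} {C₁ C₃ : ℝ}
    (hN : n < N)
    (hψ : Continuous fun z : ℝ × EuclideanSpace ℝ (Fin n) => ψ z.1 z.2)
    (hv : Continuous fun z : ℝ × EuclideanSpace ℝ (Fin n) => v z.1 z.2)
    (hd : ∀ t x, HasDerivAt (fun τ => ψ τ x) (v t x) t)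
    (hd' : ∀ t x, HasDerivAt (fun τ => v τ x) (-ψ t x ^ (q + 1)) t)
    (hv0 : ∀ x, v 0 x = 0)
    (iF₁ : Integrable F₁) (iF₂ : Integrable F₂) (iF₃ : Integrable F₃)
    (hF₁ : ∀ t x, ‖ψ t x‖ ≤ F₁ x) (hF₂ : ∀ t x, ‖v t x‖ ≤ F₂ x)
    (hF₃ : ∀ t x, ‖ψ t x ^ (q + 1)‖ ≤ F₃ x)
    (hC₁ : ∀ t ξ, ‖spaceFourier ψ t ξ‖ ≤ C₁ * (1 + |t|) ^ (N + 1) * decay (N + 1) ξ)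
    (hC₃ : ∀ t ξ, ‖spaceFourier (fun t x => ψ t x ^ (q + 1)) t ξ‖ ≤
      C₃ * (1 + |t|) ^ (N + 1) * decay (N + 1) ξ) :
    LimitSymbol q N (1 + |C₁| + |C₃|) (N + 1) (spaceFourier ψ) (spaceFourier v) := by
  have cψ (t : ℝ) : Continuous (ψ t) := hψ.slice t
  have cv (t : ℝ) : Continuous (v t) := hv.slice t
  have iψ (t : ℝ) : Integrable (ψ t) :=
    iF₁.mono' (cψ t).aestronglyMeasurable (Eventually.of_forall (hF₁ t))
  have ip (t : ℝ) : Integrable fun x => ψ t x ^ (q + 1) :=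
    iF₃.mono' ((cψ t).pow _).aestronglyMeasurable (Eventually.of_forall (hF₃ t))
  have hcp (t : ℝ) : cpow (spaceFourier ψ t) q = spaceFourier (fun t x => ψ t x ^ (q + 1)) t :=
    cpow_fourier (Nat.lt_succ_of_lt hN) (cψ t) (iψ t)
      (isSymbol_spaceFourier hψ iF₁ hF₁ (hC₁ t)) q (ip t)
  have hbound (C t : ℝ) (ht : 0 ≤ t) (ξ : EuclideanSpace ℝ (Fin n)) (y : ℂ)
      (hy : ‖y‖ ≤ C * (1 + |t|) ^ (N + 1) * decay (N + 1) ξ) (hC : C ≤ 1 + |C₁| + |C₃|) :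
      ‖y‖ ≤ (1 + |C₁| + |C₃|) * (1 + t) ^ (N + 1) * decay (N + 1) ξ := by
    rw [abs_of_nonneg ht] at hy
    have := (decay_pos (N + 1) ξ).le
    exact hy.trans (by gcongr)
  refine ⟨continuous_fourier_of_dominated hψ iF₁ hF₁, fun t => hermitianSymm_fourier _,
    fun t ξ => hasDerivAt_fourier_of_dominated cψ cv iF₁ hF₁ iF₂ hF₂ hd t ξ,
    fun t ξ => ?_, fun ξ => ?_, by linarith [abs_nonneg C₁, abs_nonneg C₃], fun t ht ξ => ?_,
    fun t ht ξ => ?_⟩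
  · have h1 := hasDerivAt_fourier_of_dominated (f' := fun t x => -ψ t x ^ (q + 1)) cv
      (fun t => ((cψ t).pow _).neg) iF₂ hF₂ iF₃ (fun t x => by rw [norm_neg]; exact hF₃ t x)
      hd' t ξ
    have e : 𝓕 (fun x => ((-ψ t x ^ (q + 1) : ℝ) : ℂ)) ξ = -cpow (spaceFourier ψ t) q ξ := by
      rw [hcp]
      simp only [spaceFourier, Real.fourier_eq, Complex.ofReal_neg, smul_neg, integral_neg]
    rw [e] at h1
    exact h1
  · simp only [spaceFourier, hv0, Real.fourier_eq, Complex.ofReal_zero, smul_zero, integral_zero]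
  · exact hbound C₁ t ht ξ _ (hC₁ t ξ) (by linarith [le_abs_self C₁, abs_nonneg C₃])
  · rw [hcp]
    exact hbound C₃ t ht ξ _ (hC₃ t ξ) (by linarith [le_abs_self C₃, abs_nonneg C₁])

lemma phys_spaceFourier {F : EuclideanSpace ℝ (Fin n) → ℝ} {M : ℕ} (hM : n < M) {t : ℝ}
    (hψ : Continuous (ψ t)) (hF : Integrable F) (hψF : ∀ t x, ‖ψ t x‖ ≤ F x)
    (h : IsSymbol M (spaceFourier ψ t)) : phys (spaceFourier ψ t) = ψ t :=
  phys_fourier hM hψ (hF.mono' hψ.aestronglyMeasurable (Eventually.of_forall (hψF t))) h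

variable {V : ℝ → ℝ} {φ₀ : EuclideanSpace ℝ (Fin n) → ℝ}

theorem exists_limitSymbol (hq : Odd (q + 1)) (hq0 : 0 < q) (hV : IsLimitProfile (q + 1) V)
    (hφ₀ : ContDiff ℝ ∞ φ₀) (hφ₀s : HasCompactSupport φ₀) (hN : n < N) :
    ∃ (B : ℝ) (J : ℕ) (Ψ Ψt : ℝ → EuclideanSpace ℝ (Fin n) → ℂ), LimitSymbol q N B J Ψ Ψt ∧
      (∀ t, IsSymbol N (Ψ t)) ∧ (∀ t, IsSymbol N (Ψt t)) ∧
      (∀ t, phys (Ψ t) = limitSolution (q + 1) V φ₀ t) ∧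
      ∀ t, phys (Ψt t) = limitVelocity (q + 1) V φ₀ t := by
  obtain ⟨P, hP, hVP⟩ := hV.periodic
  -- Positivity of `m` gives the phase `φ₀ ^ m` compact support, hence bounded derivatives.
  obtain ⟨m, hm, hqm⟩ : ∃ m, 0 < m ∧ (q + 1 - 1) / 2 = m := ⟨_, by
    obtain ⟨r, hr⟩ := hq
    omega, rfl⟩
  have hVP' : Function.Periodic (deriv V) P := fun s => by
    rw [← deriv_comp_add_const, show (fun x => V (x + P)) = V from funext hVP]
  have hVPp : Function.Periodic (fun s => V s ^ (q + 1)) P := fun s => by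
    show V (s + P) ^ (q + 1) = _
    rw [hVP]
  have hpow (i : ℕ) (hi : 0 < i) : HasCompactSupport fun x => φ₀ x ^ i :=
    hφ₀s.comp_left (g := fun y : ℝ => y ^ i) (zero_pow hi.ne')
  have cpw (i : ℕ) : ContDiff ℝ ∞ fun x => φ₀ x ^ i := hφ₀.pow i
  have hVq : ContDiff ℝ ∞ fun s => V s ^ (q + 1) := hV.smooth.pow _
  have hdψ := hasDerivAt_limitSolution (φ₀ := φ₀) hV
  have hdv := hasDerivAt_limitVelocity (φ₀ := φ₀) hq hV
  obtain ⟨ψ, hψ⟩ : ∃ ψ, ψ = limitSolution (q + 1) V φ₀ := ⟨_, rfl⟩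
  obtain ⟨v, hv⟩ : ∃ v, v = limitVelocity (q + 1) V φ₀ := ⟨_, rfl⟩
  have eψ (t : ℝ) (x) : ψ t x = φ₀ x * V (t * φ₀ x ^ m) := by
    rw [hψ, limitSolution, hqm]
  have ev (t : ℝ) (x) : v t x = φ₀ x ^ (m + 1) * deriv V (t * φ₀ x ^ m) := by
    rw [hv, limitVelocity, hqm]
  have ep (t : ℝ) (x) : ψ t x ^ (q + 1) = φ₀ x ^ (q + 1) * V (t * φ₀ x ^ m) ^ (q + 1) := by
    rw [eψ, mul_pow]
  obtain ⟨C₁, hC₁⟩ := exists_norm_fourier_modulated_le hφ₀ hφ₀s (cpw m) (hpow m hm) hV.smooth hP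
    hVP (N + 1)
  obtain ⟨C₂, hC₂⟩ := exists_norm_fourier_modulated_le (cpw (m + 1)) (hpow (m + 1) (by omega))
    (cpw m) (hpow m hm) hV.contDiff_deriv hP hVP' (N + 1)
  obtain ⟨C₃, hC₃⟩ := exists_norm_fourier_modulated_le (cpw (q + 1)) (hpow (q + 1) (by omega))
    (cpw m) (hpow m hm) hVq hP hVPp (N + 1)
  obtain ⟨F₁, iF₁, hF₁⟩ := exists_integrable_bound_modulated (b := fun x => φ₀ x ^ m)
    hφ₀.continuous hφ₀s hV.smooth.continuous hP hVP
  obtain ⟨F₂, iF₂, hF₂⟩ := exists_integrable_bound_modulated (b := fun x => φ₀ x ^ m)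
    (cpw (m + 1)).continuous (hpow (m + 1) (by omega)) hV.contDiff_deriv.continuous hP hVP'
  obtain ⟨F₃, iF₃, hF₃⟩ := exists_integrable_bound_modulated (b := fun x => φ₀ x ^ m)
    (cpw (q + 1)).continuous (hpow (q + 1) (by omega)) hVq.continuous hP hVPp
  simp only [← eψ, ← ev, ← ep] at hC₁ hC₂ hC₃ hF₁ hF₂ hF₃
  have cψ : Continuous fun z : ℝ × EuclideanSpace ℝ (Fin n) => ψ z.1 z.2 := by
    simp only [eψ]
    have := hφ₀.continuous
    have := hV.smooth.continuous
    fun_prop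
  have cv : Continuous fun z : ℝ × EuclideanSpace ℝ (Fin n) => v z.1 z.2 := by
    simp only [ev]
    have := hφ₀.continuous
    have := hV.contDiff_deriv.continuous
    fun_prop
  have hv0 (x) : v 0 x = 0 := by rw [ev, zero_mul, hV.initial_deriv, mul_zero]
  rw [← hψ, ← hv]
  rw [← hψ, ← hv] at hdψ
  rw [← hψ, ← hv] at hdv
  have sΨ (t : ℝ) : IsSymbol (N + 1) (spaceFourier ψ t) :=
    isSymbol_spaceFourier cψ iF₁ hF₁ (hC₁ t)
  have sΨt (t : ℝ) : IsSymbol (N + 1) (spaceFourier v t) :=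
    isSymbol_spaceFourier cv iF₂ hF₂ (hC₂ t)
  exact ⟨_, _, spaceFourier ψ, spaceFourier v,
    limitSymbol_spaceFourier hN cψ cv hdψ hdv hv0 iF₁ iF₂ iF₃ hF₁ hF₂ hF₃ hC₁ hC₃,
    fun t => (sΨ t).mono (by omega), fun t => (sΨt t).mono (by omega),
    fun t => phys_spaceFourier (Nat.lt_succ_of_lt hN) (cψ.slice t) iF₁
      hF₁ (sΨ t),
    fun t => phys_spaceFourier (Nat.lt_succ_of_lt hN) (cv.slice t) iF₂
      hF₂ (sΨt t)⟩

end LimitSymbol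

/-! ### Solutions in physical space -/

/-- With `l = |log ν|`, the choice `c j ≤ 1 / 2` makes `K (1 + c l ^ c) ^ j` at most `K 2^j √l`,
which is below `ε l` for large `l`; and `ν exp (ε l) = ν ^ (1 - ε)`. -/
lemma exists_logarithmic_time_scale {K δ : ℝ} {j : ℕ} (hK : 0 < K) (hj : 0 < j) (hδ : 0 < δ) :
    ∃ c : ℝ, 0 < c ∧ ∀ ν : ℝ, 0 < ν → ν ≤ c →
      ν * Real.exp (K * (1 + c * |Real.log ν| ^ c) ^ j) ≤ 1 ∧
        ν * Real.exp (K * (1 + c * |Real.log ν| ^ c) ^ j) ≤ ν ^ (1 - δ) := by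
  -- The cap at `1` makes `ν ^ (1 - ε) ≤ 1`, the smallness that the fixed point requires even when
  -- `δ > 1`.
  set ε : ℝ := min δ 1 with hε
  have hε0 : 0 < ε := lt_min hδ one_pos
  set r : ℝ := K * 2 ^ j with hr
  -- From `l₀` on, `r √l ≤ ε l`; the bound `ν ≤ c ≤ exp (-l₀)` ensures `l ≥ l₀`.
  set l₀ : ℝ := max 1 ((r / ε) ^ 2) with hl₀
  have hl₀1 : 1 ≤ l₀ := le_max_left _ _
  set c : ℝ := min (Real.exp (-l₀)) (1 / (2 * j)) with hc
  have hc0 : 0 < c := lt_min (Real.exp_pos _) (by positivity)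
  have hc1 : c ≤ 1 := (min_le_left _ _).trans (Real.exp_le_one_iff.2 (by linarith))
  refine ⟨c, hc0, fun ν hν hνc => ?_⟩
  have hν1 : ν ≤ 1 := hνc.trans hc1
  set l : ℝ := |Real.log ν| with hl
  have hl' : l = -Real.log ν := abs_of_nonpos (Real.log_nonpos hν.le hν1)
  have hl₀l : l₀ ≤ l := by
    have := Real.log_le_log hν (hνc.trans (min_le_left _ _))
    rw [Real.log_exp] at this
    linarith
  have hl1 : 1 ≤ l := hl₀1.trans hl₀l
  have hcj : c * j ≤ 1 / 2 := by
    have h1 : c ≤ 1 / (2 * j) := min_le_right _ _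
    have hj0 : (0 : ℝ) < j := by exact_mod_cast hj
    rw [le_div_iff₀ (by positivity)] at h1
    linarith
  have hpow : (1 + c * l ^ c) ^ j ≤ 2 ^ j * Real.sqrt l := by
    have h1 : 1 ≤ l ^ c := Real.one_le_rpow hl1 hc0.le
    have h2 : 1 + c * l ^ c ≤ 2 * l ^ c := by nlinarith
    calc (1 + c * l ^ c) ^ j ≤ (2 * l ^ c) ^ j := pow_le_pow_left₀ (by positivity) h2 j
      _ = 2 ^ j * l ^ (c * j) := by
        rw [mul_pow, Real.rpow_mul (by linarith), Real.rpow_natCast]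
      _ ≤ 2 ^ j * l ^ (1 / 2 : ℝ) := by
        gcongr
      _ = _ := by rw [Real.sqrt_eq_rpow]
  have hsqrt : r / ε ≤ Real.sqrt l :=
    Real.le_sqrt_of_sq_le ((le_max_right _ _).trans hl₀l)
  have hexp : K * (1 + c * l ^ c) ^ j ≤ ε * l := by
    have h1 : r ≤ Real.sqrt l * ε := (div_le_iff₀ hε0).1 hsqrt
    calc K * (1 + c * l ^ c) ^ j ≤ K * (2 ^ j * Real.sqrt l) := by gcongr
      _ = r * Real.sqrt l := by rw [hr]; ring
      _ ≤ Real.sqrt l * ε * Real.sqrt l := by gcongr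
      _ = ε * (Real.sqrt l * Real.sqrt l) := by ring
      _ = ε * l := by rw [Real.mul_self_sqrt (by linarith)]
  have hmain : ν * Real.exp (K * (1 + c * l ^ c) ^ j) ≤ ν ^ (1 - ε) := by
    calc _ ≤ ν * Real.exp (ε * l) := by gcongr
      _ = ν ^ (1 - ε) := by
        rw [Real.rpow_def_of_pos hν, hl', mul_sub, mul_one, sub_eq_add_neg, Real.exp_add,
          Real.exp_log hν]
        congr 2
        ring
  exact ⟨hmain.trans (Real.rpow_le_one hν.le hν1 (by linarith [min_le_right δ 1])),
    hmain.trans (Real.rpow_le_rpow_of_exponent_ge hν hν1 (by linarith [min_le_left δ 1]))⟩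

/-! ### From decaying symbols to solutions in Sobolev spaces -/

section Physical

variable {n q k : ℕ} {ν T : ℝ} {U P : ℝ → EuclideanSpace ℝ (Fin n) → ℂ}

lemma norm_mul_norm_mul_le {M : ℕ} {A : ℝ} {ξ : EuclideanSpace ℝ (Fin n)} {y : ℂ}
    (hy : ‖y‖ ≤ A * decay (M + 1) ξ) (hA : 0 ≤ A) (c : ℝ) :
    ‖((c * ‖ξ‖ : ℝ) : ℂ) * y‖ ≤ |c| * A * decay M ξ := by
  rw [norm_mul, Complex.norm_real, Real.norm_eq_abs, abs_mul, abs_norm]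
  calc |c| * ‖ξ‖ * ‖y‖ ≤ |c| * ‖ξ‖ * (A * decay (M + 1) ξ) := by gcongr
    _ = |c| * A * (‖ξ‖ * decay (M + 1) ξ) := by ring
    _ ≤ _ := mul_le_mul_of_nonneg_left (norm_mul_decay_succ_le M ξ) (by positivity)

/-- The Fourier transform of the acceleration. -/
noncomputable def accelOf (q : ℕ) (ν : ℝ) (U P : ℝ → EuclideanSpace ℝ (Fin n) → ℂ) (t : ℝ)
    (ξ : EuclideanSpace ℝ (Fin n)) : ℂ :=
  ((-ν : ℝ) : ℂ) * (((2 * Real.pi * ‖ξ‖ : ℝ) : ℂ) * P t ξ) +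
    ((ν ^ 2 : ℝ) : ℂ) * (((-(2 * Real.pi * ‖ξ‖) ^ 2 : ℝ) : ℂ) * U t ξ) - cpow (U t) q ξ

variable {N : ℕ}

lemma ViscousSymbol.isSymbol (h : ViscousSymbol q N ν T U P) {t : ℝ} (ht : t ∈ Icc 0 T) :
    IsSymbol N (U t) := by
  obtain ⟨A, hA⟩ := h.bound
  exact ⟨h.continuous.slice t, h.symm t ht, A, hA t ht⟩

lemma ViscousSymbol.isSymbol_vel (h : ViscousSymbol q N ν T U P) {t : ℝ} (ht : t ∈ Icc 0 T) :
    IsSymbol N (P t) := by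
  obtain ⟨A, hA⟩ := h.bound_vel
  exact ⟨h.continuous_vel.slice t, h.symm_vel t ht, A, hA t ht⟩

lemma ViscousSymbol.hasDerivAt_accel (h : ViscousSymbol q N ν T U P) {t : ℝ} (ht : t ∈ Icc 0 T)
    (ξ : EuclideanSpace ℝ (Fin n)) : HasDerivAt (fun τ => P τ ξ) (accelOf q ν U P t ξ) t := by
  convert! h.hasDerivAt_vel t ht ξ using 1
  simp only [accelOf]
  push_cast
  ring

lemma ViscousSymbol.isSymbol_accel {M : ℕ} (hM : n < M) (h : ViscousSymbol q (M + 2) ν T U P)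
    {t : ℝ} (ht : t ∈ Icc 0 T) : IsSymbol M (accelOf q ν U P t) := by
  have hU := h.isSymbol ht
  have hP : IsSymbol (M + 1) (P t) := (h.isSymbol_vel ht).mono (by omega)
  exact (((hP.norm_mul (2 * Real.pi)).const_mul (-ν)).add (hU.norm_sq_mul.const_mul (ν ^ 2))).sub
    ((hU.mono (by omega : M ≤ M + 2)).cpow hM q)

lemma ViscousSymbol.bound_accel {M : ℕ} (hM : n < M) (h : ViscousSymbol q (M + 2) ν T U P) :
    ∃ A, ∀ t ∈ Icc 0 T, ∀ ξ, ‖accelOf q ν U P t ξ‖ ≤ A * decay M ξ := by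
  obtain ⟨A, hA⟩ := h.bound
  obtain ⟨A', hA'⟩ := h.bound_vel
  refine ⟨|-ν| * (|2 * Real.pi| * A') + |ν ^ 2| * (|2 * Real.pi| * (|-(2 * Real.pi)| * A)) +
    convConst (EuclideanSpace ℝ (Fin n)) M ^ q * A ^ (q + 1), fun t ht ξ => ?_⟩
  have hA0 : 0 ≤ A := nonneg_of_decay (hA t ht)
  have hA'0 : 0 ≤ A' := nonneg_of_decay (hA' t ht)
  have h1 : ‖((2 * Real.pi * ‖ξ‖ : ℝ) : ℂ) * P t ξ‖ ≤ |2 * Real.pi| * A' * decay M ξ :=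
    norm_mul_norm_mul_le ((hA' t ht ξ).trans
      (mul_le_mul_of_nonneg_left (decay_antitone (by omega) ξ) hA'0)) hA'0 _
  have h2 : ‖((-(2 * Real.pi * ‖ξ‖) ^ 2 : ℝ) : ℂ) * U t ξ‖ ≤
      |2 * Real.pi| * (|-(2 * Real.pi)| * A) * decay M ξ := by
    have := norm_mul_norm_mul_le (norm_mul_norm_mul_le (hA t ht ξ) hA0 (-(2 * Real.pi)))
      (by positivity) (2 * Real.pi)
    convert! this using 2
    push_cast
    ring
  have h3 : ‖cpow (U t) q ξ‖ ≤ convConst (EuclideanSpace ℝ (Fin n)) M ^ q * A ^ (q + 1) *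
      decay M ξ :=
    norm_cpow_le (finrank_lt_of_lt hM) (fun η => (hA t ht η).trans
      (mul_le_mul_of_nonneg_left (decay_antitone (by omega) η) hA0)) q ξ
  rw [accelOf]
  refine (norm_sub_le _ _).trans ?_
  rw [add_mul]
  refine add_le_add ((norm_add_le _ _).trans ?_) h3
  rw [norm_mul, norm_mul ((ν ^ 2 : ℝ) : ℂ), Complex.norm_real, Complex.norm_real,
    Real.norm_eq_abs, Real.norm_eq_abs, add_mul, mul_assoc (|-ν|), mul_assoc (|ν ^ 2|)]
  exact add_le_add (mul_le_mul_of_nonneg_left h1 (abs_nonneg _))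
    (mul_le_mul_of_nonneg_left h2 (abs_nonneg _))

lemma ViscousSymbol.continuousOn_accel {M : ℕ} (hM : n < M)
    (h : ViscousSymbol q (M + 2) ν T U P) (ξ : EuclideanSpace ℝ (Fin n)) :
    ContinuousOn (fun t => accelOf q ν U P t ξ) (Icc 0 T) := by
  obtain ⟨A, hA⟩ := h.bound
  have cU : Continuous fun t => U t ξ := h.continuous.comp (Continuous.prodMk_left ξ)
  have cP : Continuous fun t => P t ξ := h.continuous_vel.comp (Continuous.prodMk_left ξ)
  have hcpow : ContinuousOn (fun t => cpow (U t) q ξ) (Icc 0 T) := by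
    rcases lt_or_ge T 0 with hT | hT
    · rw [Icc_eq_empty (not_le.2 hT)]
      exact continuousOn_empty _
    -- The decay of `U` is known only on `[0, T]`, while continuity of convolution powers needs it
    -- uniformly over all parameters.
    have hUc : Continuous fun z : ℝ × EuclideanSpace ℝ (Fin n) => U (clampTime T z.1) z.2 :=
      h.continuous.comp
        (((continuous_clampTime T).comp continuous_fst).prodMk continuous_snd)
    have h1 : Continuous fun z : ℝ × EuclideanSpace ℝ (Fin n) =>
        cpow (U (clampTime T z.1)) q z.2 :=
      continuous_cpow (finrank_lt_of_lt (hM.trans (by omega : M < M + 2)))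
        (F := fun t => U (clampTime T t)) hUc (fun t => hA _ (clampTime_mem hT t)) q
    refine (h1.comp (Continuous.prodMk_left ξ)).continuousOn.congr fun t ht => ?_
    simp only [Function.comp, clampTime_of_mem ht]
  simp only [accelOf]
  exact (Continuous.continuousOn (by fun_prop)).sub hcpow

/-- The factors `‖ξ‖` and `‖ξ‖²` cost the acceleration two orders of decay, from `n + 1 + (k + 3)`
to `n + 1 + (k + 1)`. Both exponents leave more regularity than the spaces `H^(k+1)`, `H^k` and
`H^(k-1)` require. -/
theorem ViscousSymbol.isViscoDispersiveSolution
    (h : ViscousSymbol q (n + 1 + (k + 3)) ν T U P) {φ₀ : EuclideanSpace ℝ (Fin n) → ℝ}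
    (h0 : phys (U 0) = φ₀) :
    IsViscoDispersiveSolution (q + 1) k ν T φ₀ (fun t => phys (U t)) fun t => phys (P t) := by
  have hM : n < n + 1 + (k + 1) := by omega
  have h' : ViscousSymbol q (n + 1 + (k + 1) + 2) ν T U P := h
  obtain ⟨A, hA⟩ := h.bound
  obtain ⟨A', hA'⟩ := h.bound_vel
  obtain ⟨B, hB⟩ := h'.bound_accel hM
  have cU (ξ) : ContinuousOn (fun t => U t ξ) (Icc 0 T) :=
    (h.continuous.comp (Continuous.prodMk_left ξ)).continuousOn
  have cP (ξ) : ContinuousOn (fun t => P t ξ) (Icc 0 T) :=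
    (h.continuous_vel.comp (Continuous.prodMk_left ξ)).continuousOn
  have hI : Convex ℝ (Icc 0 T) := convex_Icc 0 T
  refine ⟨continuousInSobolev_phys (σ := k + 3) (by push_cast; linarith)
      (fun t ht => h.isSymbol ht) hA cU,
    continuousInSobolev_phys (σ := k + 3) (by push_cast; linarith)
      (fun t ht => h.isSymbol_vel ht) hA' cP,
    hasSobolevTimeDeriv_phys (σ := k + 3) (by push_cast; linarith) hI
      (fun t ht => h.isSymbol ht) (fun t ht => h.isSymbol_vel ht) hA'
      fun ξ t _ => (h.hasDerivAt t ξ).hasDerivWithinAt,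
    ⟨fun t => phys (accelOf q ν U P t),
      continuousInSobolev_phys (σ := k + 1) (by push_cast; linarith)
        (fun t ht => h'.isSymbol_accel hM ht) hB (h'.continuousOn_accel hM),
      hasSobolevTimeDeriv_phys (σ := k + 1) (by push_cast; linarith) hI
        (fun t ht => (h.isSymbol_vel ht).mono (by omega)) (fun t ht => h'.isSymbol_accel hM ht) hB
        fun ξ t ht => (h.hasDerivAt_accel ht ξ).hasDerivWithinAt, fun t ht => ?_⟩,
    fun x => congrFun h0 x, fun x => ?_⟩
  · have hU : IsSymbol (n + 1 + (k + 1) + 2) (U t) := h'.isSymbol ht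
    have hP : IsSymbol (n + 1 + (k + 1) + 1) (P t) := (h'.isSymbol_vel ht).mono (by omega)
    refine ⟨_, _, isLaplacian_phys hM hU, isSqrtNegLaplacian_phys hM hP,
      Eventually.of_forall fun x => ?_⟩
    have hD := (hP.norm_mul (2 * Real.pi)).const_mul (-ν)
    have hL := hU.norm_sq_mul.const_mul (ν ^ 2)
    have hU' := hU.mono (by omega : n + 1 + (k + 1) ≤ n + 1 + (k + 1) + 2)
    have e : phys (accelOf q ν U P t) x =
        -ν * phys (fun ξ => ((2 * Real.pi * ‖ξ‖ : ℝ) : ℂ) * P t ξ) x +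
        ν ^ 2 * phys (fun ξ => ((-(2 * Real.pi * ‖ξ‖) ^ 2 : ℝ) : ℂ) * U t ξ) x -
        phys (U t) x ^ (q + 1) := by
      rw [← phys_const_mul, ← phys_const_mul, ← phys_add hM hD hL, ← phys_cpow hM hU',
        ← phys_sub hM (hD.add hL) (hU'.cpow hM q)]
      rfl
    simp only [e]
    ring
  · show phys (P 0) x = 0
    -- Writing zero as a product makes the homogeneity of `phys` applicable.
    rw [show P 0 = fun _ => ((0 : ℝ) : ℂ) * 0 from funext fun ξ => by simp [h.vel_zero ξ],
      phys_const_mul (F := fun _ => 0), zero_mul]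

end Physical

theorem proposition1 (n p k : ℕ) (hp_odd : Odd p) (hp : 1 < p) (hk : n + 1 ≤ k)
    (φ₀ : EuclideanSpace ℝ (Fin n) → ℝ) (hφ₀_smooth : ContDiff ℝ ∞ φ₀)
    (hφ₀_supp : HasCompactSupport φ₀) (δ : ℝ) (hδ : 0 < δ) :
    (∃! V : ℝ → ℝ, IsLimitProfile p V) ∧
    ∀ V : ℝ → ℝ, IsLimitProfile p V →
      (IsLimitSolution p φ₀ (limitSolution p V φ₀) ∧
        ∀ ψ, IsLimitSolution p φ₀ ψ → ψ = limitSolution p V φ₀) ∧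
      ∃ C c : ℝ, 0 < C ∧ 0 < c ∧
        ∀ ν : ℝ, 0 < ν → ν ≤ c →
          ∃ φ φt : ℝ → EuclideanSpace ℝ (Fin n) → ℝ,
            IsViscoDispersiveSolution p k ν (c * |Real.log ν| ^ c) φ₀ φ φt ∧
            ∀ t : ℝ, 0 ≤ t → t ≤ c * |Real.log ν| ^ c →
              sobolevENorm (k : ℝ) (fun x => φ t x - limitSolution p V φ₀ t x) +
                sobolevENorm (k : ℝ)
                  (fun x => φt t x - deriv (fun τ => limitSolution p V φ₀ τ x) t) ≤
              ENNReal.ofReal (C * ν ^ (1 - δ)) := by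
  refine ⟨existsUnique_isLimitProfile hp_odd, fun V hV =>
    ⟨⟨isLimitSolution_limitSolution hp_odd hV, fun ψ hψ => hψ.eq_limitSolution hp_odd hV⟩, ?_⟩⟩
  obtain ⟨q, rfl⟩ : ∃ q, p = q + 1 := ⟨p - 1, by omega⟩
  have hN : n < n + 1 + (k + 3) := by omega
  obtain ⟨B, J, Ψ, Ψt, hΨ, sΨ, sΨt, eΨ, eΨt⟩ :=
    exists_limitSymbol hp_odd (by omega) hV hφ₀_smooth hφ₀_supp hN
  obtain ⟨K, j, hK, hj, hsol⟩ := hΨ.exists_viscousSymbol (finrank_lt_of_lt hN)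
  obtain ⟨c, hc, hscale⟩ := exists_logarithmic_time_scale hK hj hδ
  have hS : 0 ≤ sobolevConst n (k + 3) := by unfold sobolevConst; positivity
  -- One `sobolevConst` for each of the two norms; the `1` only makes the constant positive.
  refine ⟨2 * sobolevConst n (k + 3) + 1, c, by positivity, hc, fun ν hν hνc => ?_⟩
  obtain ⟨hs1, hs2⟩ := hscale ν hν hνc
  obtain ⟨U, P, hUP, hU0, herr⟩ := hsol ν (c * |Real.log ν| ^ c) hν.le (by positivity) hs1
  have h0 : phys (U 0) = φ₀ := by
    rw [show U 0 = Ψ 0 from funext hU0, eΨ]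
    ext x
    simp [limitSolution, hV.initial]
  refine ⟨_, _, hUP.isViscoDispersiveSolution h0, fun t ht0 htT => ?_⟩
  have ht : t ∈ Icc 0 (c * |Real.log ν| ^ c) := ⟨ht0, htT⟩
  have hk3 : (k : ℝ) ≤ (k + 3 : ℕ) := by push_cast; linarith
  have e1 : (fun x => phys (U t) x - limitSolution (q + 1) V φ₀ t x) =
      phys fun ξ => U t ξ - Ψ t ξ := by
    ext x
    rw [phys_sub hN (hUP.isSymbol ht) (sΨ t), eΨ]
  have e2 : (fun x => phys (P t) x - deriv (fun τ => limitSolution (q + 1) V φ₀ τ x) t) =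
      phys fun ξ => P t ξ - Ψt t ξ := by
    ext x
    rw [phys_sub hN (hUP.isSymbol_vel ht) (sΨt t), eΨt, (hasDerivAt_limitSolution hV t x).deriv]
  have b1 := sobolevENorm_phys_le hk3 ((hUP.isSymbol ht).sub (sΨ t)) fun ξ => (herr t ht ξ).1
  have b2 := sobolevENorm_phys_le hk3 ((hUP.isSymbol_vel ht).sub (sΨt t))
    fun ξ => (herr t ht ξ).2
  rw [e1, e2]
  refine (add_le_add b1 b2).trans ?_
  rw [← ENNReal.ofReal_add (by positivity) (by positivity)]
  refine ENNReal.ofReal_le_ofReal ?_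
  have h3 := mul_le_mul_of_nonneg_left hs2 hS
  have h4 : 0 ≤ ν ^ (1 - δ) := Real.rpow_nonneg hν.le _
  linarith
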